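/- **Setting.** Let $d\ge 1$, $0<\alpha<2$, $0<\mu_-\le\mu_+<\infty$, and let $\mu\in L_\infty(\mathbb R^d\times\mathbb R^d)$ be real-valued with $\mu_-\le\mu(x,y)\le\mu_+$, $\mu(x,y)=\mu(y,x)$ and $\mu(x+k,y+l)=\mu(x,y)$ for all $k,l\in\mathbb Z^d$. Let $\Omega=[0,1)^d$, and let $\widetilde H^{\alpha/2}(\Omega)$ be the space of those $u\in L_2(\Omega)$ whose $\mathbb Z^d$-periodic extension (again denoted by $u$) belongs to $H^{\alpha/2}_{\mathrm{loc}}(\mathbb R^d)$. For $\xi\in\mathbb R^d$ let $\mathbb A(\xi)=\mathbb A(\xi;\alpha,\mu)$ be the self-adjoint operator in $L_2(\Omega)$ generated by the closed non-negative form $$a(\xi)[u,u]=\frac12\int_{\mathbb R^d}dy\int_\Omega dx\,\mu(x,y)\,\frac{|e^{i\langle\xi,x\rangle}u(x)-e^{i\langle\xi,y\rangle}u(y)|^2}{|x-y|^{d+\alpha}},\qquad u\in\widetilde H^{\alpha/2}(\Omega).$$ Put $$\mu^0=\int_\Omega\int_\Omega\mu(x,y)\,dx\,dy,\qquad V_\alpha(\xi)=c_0(d,\alpha)|\xi|^\alpha,\qquad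 c_0(d,\alpha)=\int_{\mathbb R^d}\frac{1-\cos z_1}{|z|^{d+\alpha}}\,dz,\qquad \delta_0(\alpha,\mu)=\pi\Bigl(\frac{\mu_-}{3\mu_+}\Bigr)^{1/\alpha},$$ and let $P$ be the orthogonal projection of $L_2(\Omega)$ onto the constant functions. **Theorem 4.2.** There is a constant $C_5(\alpha,\mu)$, depending only on $d,\alpha,\mu_-,\mu_+$, such that for all $\varepsilon>0$ and all $\xi\in\mathbb R^d$ with $|\xi|\le\delta_0(\alpha,\mu)$ the operator $\mathbb A(\xi)+\varepsilon^\alpha I$ has a bounded inverse in $L_2(\Omega)$ and $$\left\|(\mathbb A(\xi)+\varepsilon^{\alpha}I)^{-1}-(\mu^0V_\alpha(\xi)+\varepsilon^{\alpha})^{-1}P\right\|_{L_2(\Omega)\to L_2(\Omega)}\le C_5(\alpha,\mu)\begin{cases}1,&0<\alpha<1,\\(1+|\ln\varepsilon|)^2,&\alpha=1,\\ \varepsilon^{2-2\alpha},&1<\alpha<2.\end{cases}$$ -/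

import Mathlib

open MeasureTheory Set
open scoped ComplexConjugate InnerProductSpace Pointwise ContDiff

noncomputable section

namespace LevyPeriodic

/-- The Euclidean space `ℝ^d`. -/
abbrev Space (d : ℕ) : Type := EuclideanSpace ℝ (Fin d)

/-- The periodicity cell `Ω = [0,1)^d`. -/
def cell (d : ℕ) : Set (Space d) := {x | ∀ i, x i ∈ Ico (0 : ℝ) 1}

/-- The complex Hilbert space `L₂(Ω)`. -/
abbrev L2Cell (d : ℕ) : Type := Lp ℂ 2 ((volume : Measure (Space d)).restrict (cell d))

/-- The representative in the cell `Ω` of a point of `ℝ^d` modulo `ℤ^d`. -/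
def toCell {d : ℕ} (x : Space d) : Space d := WithLp.toLp 2 fun i => Int.fract (x i)

/-- The `ℤ^d`-periodic extension to `ℝ^d` of an element of `L₂(Ω)`. -/
def perExt {d : ℕ} (u : L2Cell d) (x : Space d) : ℂ := u (toCell x)

/-- The lattice vector of `ℝ^d` with integer coordinates `n`. -/
def latticeVec {d : ℕ} (n : Fin d → ℤ) : Space d := WithLp.toLp 2 fun i => (n i : ℝ)

/-- The measure `dx dy` on `Ω × ℝ^d`. -/
abbrev cellProd (d : ℕ) : Measure (Space d × Space d) :=
  ((volume : Measure (Space d)).restrict (cell d)).prod volume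

lemma measurableSet_cell (d : ℕ) : MeasurableSet (cell d) := by
  have : cell d = ⋂ i, (fun x : Space d => x i) ⁻¹' Ico (0 : ℝ) 1 := by
    ext x; simp [cell]
  rw [this]
  exact MeasurableSet.iInter fun i => (by fun_prop : Measurable fun x : Space d => x i)
    measurableSet_Ico

lemma cell_eq (d : ℕ) :
    cell d = ZSpan.fundamentalDomain (EuclideanSpace.basisFun (Fin d) ℝ).toBasis := by
  ext x; simp [cell, ZSpan.mem_fundamentalDomain]

lemma isBounded_cell (d : ℕ) : Bornology.IsBounded (cell d) := by
  rw [cell_eq]; exact ZSpan.fundamentalDomain_isBounded _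

lemma volume_cell_lt_top (d : ℕ) : volume (cell d) < ⊤ := (isBounded_cell d).measure_lt_top

instance (d : ℕ) : IsFiniteMeasure ((volume : Measure (Space d)).restrict (cell d)) :=
  ⟨by simpa using volume_cell_lt_top d⟩

lemma toCell_mem {d : ℕ} (x : Space d) : toCell x ∈ cell d := fun _ =>
  ⟨Int.fract_nonneg _, Int.fract_lt_one _⟩

lemma toCell_of_mem {d : ℕ} {x : Space d} (hx : x ∈ cell d) : toCell x = x := by
  ext i; simpa [toCell] using Int.fract_eq_self.2 (hx i)

lemma toCell_eq_sub {d : ℕ} (x : Space d) :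
    toCell x = x - latticeVec fun i => ⌊x i⌋ := by
  ext i; rfl

lemma toCell_add {d : ℕ} (x : Space d) (n : Fin d → ℤ) :
    toCell (x + latticeVec n) = toCell x := by
  ext i; simp [toCell, latticeVec]

lemma measurable_toCell {d : ℕ} : Measurable (toCell : Space d → Space d) := by
  unfold toCell
  refine (WithLp.measurable_toLp 2 _).comp ?_
  exact measurable_pi_lambda _ fun i => measurable_fract.comp (by fun_prop)

lemma quasi_toCell {d : ℕ} : Measure.QuasiMeasurePreserving (toCell : Space d → Space d)
    volume ((volume : Measure (Space d)).restrict (cell d)) := by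
  refine ⟨measurable_toCell, Measure.AbsolutelyContinuous.mk fun s hs h0 => ?_⟩
  rw [Measure.restrict_apply hs] at h0
  rw [Measure.map_apply measurable_toCell hs]
  refine measure_mono_null (t := ⋃ n : Fin d → ℤ,
    (fun x => x - latticeVec n) ⁻¹' (s ∩ cell d)) ?_ ?_
  · intro x hx
    refine mem_iUnion.2 ⟨fun i => ⌊x i⌋, ?_⟩
    rw [mem_preimage, ← toCell_eq_sub]
    exact ⟨hx, toCell_mem x⟩
  · refine measure_iUnion_null fun n => ?_
    have h := (measurePreserving_sub_right (volume : Measure (Space d))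
      (latticeVec n)).measure_preimage (hs.inter (measurableSet_cell d)).nullMeasurableSet
    exact h.trans h0

lemma measurable_perExt {d : ℕ} (u : L2Cell d) : Measurable (perExt u) :=
  (Lp.stronglyMeasurable u).measurable.comp measurable_toCell

lemma perExt_add {d : ℕ} (u v : L2Cell d) :
    perExt (u + v) =ᵐ[volume] fun x => perExt u x + perExt v x :=
  quasi_toCell.ae_eq (Lp.coeFn_add u v)

lemma perExt_smul {d : ℕ} (c : ℂ) (u : L2Cell d) :
    perExt (c • u) =ᵐ[volume] fun x => c * perExt u x :=
  quasi_toCell.ae_eq (Lp.coeFn_smul c u)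

lemma perExt_zero {d : ℕ} : perExt (0 : L2Cell d) =ᵐ[volume] fun _ => 0 :=
  quasi_toCell.ae_eq (Lp.coeFn_zero ℂ 2 _)

lemma ae_fst {d : ℕ} {p : Space d → Prop} (h : ∀ᵐ x, p x) :
    ∀ᵐ q : Space d × Space d, p q.1 :=
  Measure.quasiMeasurePreserving_fst.ae h

lemma ae_snd {d : ℕ} {p : Space d → Prop} (h : ∀ᵐ x, p x) :
    ∀ᵐ q : Space d × Space d, p q.2 :=
  Measure.quasiMeasurePreserving_snd.ae h

/-- The periodic Sobolev space `H̃^s(Ω)`, `0 < s < 1`: the elements of `L₂(Ω)` whose periodic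
extension belongs to `H^s_loc(ℝ^d)`, that is, has a finite Gagliardo seminorm over every ball. -/
def perSobolev (d : ℕ) (s : ℝ) : Submodule ℂ (L2Cell d) where
  carrier := {u | ∀ r : ℝ, IntegrableOn
    (fun p : Space d × Space d => ‖perExt u p.1 - perExt u p.2‖ ^ 2 / ‖p.1 - p.2‖ ^ (d + 2 * s))
    (Metric.ball 0 r ×ˢ Metric.ball 0 r)}
  zero_mem' r := by
    refine (integrableOn_zero).congr (ae_restrict_of_ae ?_)
    filter_upwards [ae_fst (perExt_zero (d := d)), ae_snd (perExt_zero (d := d))] with p h1 h2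
    simp [h1, h2]
  add_mem' {u v} hu hv r := by
    refine (((hu r).add (hv r)).const_mul 2).mono' ?_ (ae_restrict_of_ae ?_)
    · have := measurable_perExt (u + v)
      exact (by fun_prop : Measurable _).aestronglyMeasurable
    · filter_upwards [ae_fst (perExt_add u v), ae_snd (perExt_add u v)] with p h1 h2
      rw [h1, h2, Real.norm_of_nonneg (by positivity), Pi.add_apply, ← add_div, ← mul_div_assoc]
      gcongr
      rw [add_sub_add_comm]
      have h3 := norm_add_le (perExt u p.1 - perExt u p.2) (perExt v p.1 - perExt v p.2)
      have h4 := norm_nonneg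
        ((perExt u p.1 - perExt u p.2) + (perExt v p.1 - perExt v p.2))
      nlinarith [sq_nonneg (‖perExt u p.1 - perExt u p.2‖ - ‖perExt v p.1 - perExt v p.2‖)]
  smul_mem' c u hu r := by
    refine ((hu r).const_mul (‖c‖ ^ 2)).congr (ae_restrict_of_ae ?_)
    filter_upwards [ae_fst (perExt_smul c u), ae_snd (perExt_smul c u)] with p h1 h2
    rw [h1, h2, ← mul_sub, norm_mul, mul_pow, mul_div_assoc]

/-- A coefficient: an element of `L_∞(ℝ^d × ℝ^d)` with values in `[m, M]` which is symmetric and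
`ℤ^d`-periodic in each variable. -/
structure Coefficient (d : ℕ) (m M : ℝ) where
  toFun : Space d → Space d → ℝ
  aestronglyMeasurable' : AEStronglyMeasurable (fun p : Space d × Space d => toFun p.1 p.2)
  bounds' : ∀ᵐ p : Space d × Space d, m ≤ toFun p.1 p.2 ∧ toFun p.1 p.2 ≤ M
  symm' : ∀ᵐ p : Space d × Space d, toFun p.1 p.2 = toFun p.2 p.1
  periodic' : ∀ k l : Fin d → ℤ, ∀ᵐ p : Space d × Space d,
    toFun (p.1 + latticeVec k) (p.2 + latticeVec l) = toFun p.1 p.2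

/-- The mean value `μ⁰ = ∫_Ω ∫_Ω μ(x, y) dx dy`. -/
def Coefficient.mean {d : ℕ} {m M : ℝ} (μ : Coefficient d m M) : ℝ :=
  ∫ x in cell d, ∫ y in cell d, μ.toFun x y

/-- The difference `e^{i⟨ξ,x⟩} u(x) - e^{i⟨ξ,y⟩} u(y)`, where `u` is extended periodically. -/
def twistedDiff {d : ℕ} (ξ : Space d) (u : L2Cell d) (p : Space d × Space d) : ℂ :=
  Complex.exp (Complex.I * (⟪ξ, p.1⟫_ℝ : ℝ)) * perExt u p.1 -
    Complex.exp (Complex.I * (⟪ξ, p.2⟫_ℝ : ℝ)) * perExt u p.2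

lemma measurable_twistedDiff {d : ℕ} (ξ : Space d) (u : L2Cell d) :
    Measurable (twistedDiff ξ u) := by
  have := measurable_perExt u
  unfold twistedDiff
  fun_prop

/-- The Lévy measure density truncated at the origin is integrable. -/
lemma integrable_levy {d : ℕ} [NeZero d] {α : ℝ} (h0 : 0 < α) (h2 : α < 2) :
    Integrable (fun z : Space d => min 1 (‖z‖ ^ 2) / ‖z‖ ^ (d + α)) := by
  have hd : 1 ≤ Module.finrank ℝ (Space d) := by simpa using NeZero.one_le
  have hm : AEStronglyMeasurable (fun z : Space d => min 1 (‖z‖ ^ 2) / ‖z‖ ^ (d + α)) :=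
    (by fun_prop : Measurable _).aestronglyMeasurable
  rw [← integrableOn_univ, ← union_compl_self (Metric.ball (0 : Space d) 1)]
  refine IntegrableOn.union ?_ ?_
  · refine integrableOn_ball_of_norm_le_rpow (C := 1) (α := d + α - 2) hd
      (by simp only [finrank_euclideanSpace, Fintype.card_fin]; linarith)
      (Filter.Eventually.of_forall fun z => ?_) hm
    rw [Real.norm_of_nonneg (by positivity), one_mul]
    rcases eq_or_ne z 0 with rfl | hz
    · simp; positivity
    have hz : 0 < ‖z‖ := norm_pos_iff.2 hz
    rw [div_le_iff₀ (by positivity), ← Real.rpow_add hz, show -(d + α - 2) + (d + α) = (2 : ℕ) by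
      push_cast; ring, Real.rpow_natCast]
    exact min_le_right _ _
  · have h := ((integrable_one_add_norm (E := Space d) (μ := volume) (r := d + α)
      (by simpa using h0)).const_mul ((2 : ℝ) ^ (d + α))).integrableOn
      (s := (Metric.ball (0 : Space d) 1)ᶜ)
    refine h.mono' hm.restrict (ae_restrict_of_forall_mem measurableSet_ball.compl fun z hz => ?_)
    have hz : 1 ≤ ‖z‖ := by simpa using hz
    rw [Real.norm_of_nonneg (by positivity), Real.rpow_neg (by positivity),
      ← div_eq_mul_inv, ← Real.div_rpow (by positivity) (by positivity),
      ← one_div_one_div (2 / (1 + ‖z‖))] 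
    rw [Real.div_rpow (by positivity) (by positivity), Real.one_rpow]
    have : (0:ℝ) ≤ d + α := by positivity
    gcongr
    · exact min_le_left _ _
    · rw [one_div_div]; linarith

lemma lintegral_perExt_lt_top {d : ℕ} (u : L2Cell d) :
    ∫⁻ x in cell d, ‖perExt u x‖ₑ ^ 2 < ⊤ := by
  have h := (Lp.memLp u).eLpNorm_lt_top
  have h1 := (eLpNorm_lt_top_iff_lintegral_rpow_enorm_lt_top (by simp) (by simp)).1 h
  refine lt_of_le_of_lt (le_of_eq ?_) h1
  refine setLIntegral_congr_fun (measurableSet_cell d) fun x hx => ?_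
  simp [perExt, toCell_of_mem hx]

lemma lintegral_perExt_shift {d : ℕ} (u : L2Cell d) (z : Space d) :
    ∫⁻ x in cell d, ‖perExt u (x - z)‖ₑ ^ 2 = ∫⁻ x in cell d, ‖perExt u x‖ₑ ^ 2 := by
  have hF := ZSpan.isAddFundamentalDomain (EuclideanSpace.basisFun (Fin d) ℝ).toBasis
    (volume : Measure (Space d))
  rw [← cell_eq] at hF
  have : VAddInvariantMeasure
      (Submodule.span ℤ (range (EuclideanSpace.basisFun (Fin d) ℝ).toBasis)) (Space d) volume :=
    inferInstanceAs <| VAddInvariantMeasure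
      (Submodule.span ℤ (range (EuclideanSpace.basisFun (Fin d) ℝ).toBasis)).toAddSubgroup
      (Space d) volume
  have : MeasurableConstVAdd
      (Submodule.span ℤ (range (EuclideanSpace.basisFun (Fin d) ℝ).toBasis)) (Space d) :=
    inferInstanceAs <| MeasurableConstVAdd
      (Submodule.span ℤ (range (EuclideanSpace.basisFun (Fin d) ℝ).toBasis)).toAddSubgroup
      (Space d)
  have hG := hF.vadd_of_comm (-z)
  have h1 := hG.setLIntegral_eq hF (fun x => ‖perExt u x‖ₑ ^ 2) ?_
  · have h2 := (measurePreserving_sub_right (volume : Measure (Space d))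
      z).setLIntegral_comp_preimage_emb (MeasurableEquiv.subRight z).measurableEmbedding
      (fun x => ‖perExt u x‖ₑ ^ 2) (-z +ᵥ cell d)
    have h3 : (fun x => x - z) ⁻¹' (-z +ᵥ cell d) = cell d := by
      ext x; simp [mem_vadd_set_iff_neg_vadd_mem]
    rw [h3] at h2
    rw [← h1, ← h2]
  · rintro ⟨g, hg⟩ x
    obtain ⟨n, rfl⟩ : ∃ n : Fin d → ℤ, latticeVec n = g := by
      obtain ⟨n, hn⟩ := (Submodule.mem_span_range_iff_exists_fun ℤ).1 hg
      refine ⟨n, ?_⟩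
      rw [← hn]
      ext i
      simp [latticeVec, Finset.sum_apply, Pi.single_apply]
    simp only [Submodule.vadd_def, vadd_eq_add, perExt]
    rw [add_comm, toCell_add]

lemma integrable_far {d : ℕ} (u : L2Cell d) {k : Space d → ℝ} (hk : Integrable k)
    (hm : Measurable k) :
    Integrable (fun p : Space d × Space d => ‖perExt u p.1‖ ^ 2 * k (p.1 - p.2)) (cellProd d) ∧
    Integrable (fun p : Space d × Space d => ‖perExt u p.2‖ ^ 2 * k (p.1 - p.2)) (cellProd d) := by
  have hu := measurable_perExt u
  have hK : ∫⁻ z, ‖k z‖ₑ < ⊤ := hk.hasFiniteIntegral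
  have hU := lintegral_perExt_lt_top u
  refine ⟨⟨(by fun_prop : Measurable _).aestronglyMeasurable, ?_⟩,
    ⟨(by fun_prop : Measurable _).aestronglyMeasurable, ?_⟩⟩
  · rw [HasFiniteIntegral, lintegral_prod _ (by fun_prop)]
    simp only [enorm_mul, enorm_pow, enorm_norm]
    have : ∀ x : Space d, ∫⁻ y, ‖perExt u x‖ₑ ^ 2 * ‖k (x - y)‖ₑ =
        ‖perExt u x‖ₑ ^ 2 * ∫⁻ z, ‖k z‖ₑ := fun x => by
      rw [lintegral_const_mul _ (by fun_prop), lintegral_sub_left_eq_self (fun z => ‖k z‖ₑ)]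
    simp only [this]
    rw [lintegral_mul_const _ (by fun_prop)]
    exact ENNReal.mul_lt_top hU hK
  · rw [HasFiniteIntegral, lintegral_prod _ (by fun_prop)]
    simp only [enorm_mul, enorm_pow, enorm_norm]
    have : ∀ x : Space d, ∫⁻ y, ‖perExt u y‖ₑ ^ 2 * ‖k (x - y)‖ₑ =
        ∫⁻ z, ‖perExt u (x - z)‖ₑ ^ 2 * ‖k z‖ₑ := fun x => by
      rw [← lintegral_sub_left_eq_self
        (fun z => ‖perExt u (x - z)‖ₑ ^ 2 * ‖k z‖ₑ) x]
      simp
    simp only [this]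
    rw [lintegral_lintegral_swap (by fun_prop)]
    have : ∀ z : Space d, ∫⁻ x in cell d, ‖perExt u (x - z)‖ₑ ^ 2 * ‖k z‖ₑ =
        (∫⁻ x in cell d, ‖perExt u x‖ₑ ^ 2) * ‖k z‖ₑ := fun z => by
      rw [lintegral_mul_const _ (by fun_prop), lintegral_perExt_shift]
    simp only [this]
    rw [lintegral_const_mul _ (by fun_prop)]
    exact ENNReal.mul_lt_top hU hK

lemma norm_twistedDiff_sq_le {d : ℕ} (ξ : Space d) (u : L2Cell d) (p : Space d × Space d) :
    ‖twistedDiff ξ u p‖ ^ 2 ≤ 2 * ‖perExt u p.1 - perExt u p.2‖ ^ 2 +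
      2 * (4 + ‖ξ‖ ^ 2) * (‖perExt u p.2‖ ^ 2 * min 1 (‖p.1 - p.2‖ ^ 2)) := by
  set a := perExt u p.1
  set b := perExt u p.2
  set e : Space d → ℂ := fun x => Complex.exp (Complex.I * (⟪ξ, x⟫_ℝ : ℝ)) with he
  have hn : ∀ x, ‖e x‖ = 1 := fun x => by
    rw [he]; simp only; rw [mul_comm]; exact Complex.norm_exp_ofReal_mul_I _
  have hsplit : twistedDiff ξ u p = e p.1 * (a - b) + (e p.1 - e p.2) * b := by
    simp only [twistedDiff, he]; ring
  have hE : ‖e p.1 - e p.2‖ ^ 2 ≤ (4 + ‖ξ‖ ^ 2) * min 1 (‖p.1 - p.2‖ ^ 2) := by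
    have h1 : ‖e p.1 - e p.2‖ ≤ 2 := (norm_sub_le _ _).trans (by rw [hn, hn]; norm_num)
    have h2 : ‖e p.1 - e p.2‖ ≤ ‖ξ‖ * ‖p.1 - p.2‖ := by
      have : e p.1 - e p.2 =
          e p.2 * (Complex.exp (Complex.I * (⟪ξ, p.1 - p.2⟫_ℝ : ℝ)) - 1) := by
        simp only [he, mul_sub, ← Complex.exp_add, inner_sub_right]
        congr 2
        · push_cast; ring
        · ring
      rw [this, norm_mul, hn, one_mul]
      exact Real.norm_exp_I_mul_ofReal_sub_one_le.trans (abs_real_inner_le_norm _ _)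
    rcases le_total 1 (‖p.1 - p.2‖ ^ 2) with h | h
    · rw [min_eq_left h]; nlinarith [norm_nonneg (e p.1 - e p.2), sq_nonneg ‖ξ‖]
    · rw [min_eq_right h]
      have := pow_le_pow_left₀ (norm_nonneg _) h2 2
      rw [mul_pow] at this
      nlinarith [sq_nonneg ‖p.1 - p.2‖]
  have h3 : ‖twistedDiff ξ u p‖ ≤ ‖a - b‖ + ‖e p.1 - e p.2‖ * ‖b‖ := by
    rw [hsplit]
    refine (norm_add_le _ _).trans ?_
    rw [norm_mul, norm_mul, hn, one_mul]
  have h4 := pow_le_pow_left₀ (norm_nonneg _) h3 2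
  have h5 : (‖e p.1 - e p.2‖ * ‖b‖) ^ 2 ≤
      (4 + ‖ξ‖ ^ 2) * (‖b‖ ^ 2 * min 1 (‖p.1 - p.2‖ ^ 2)) := by
    rw [mul_pow]
    calc _ ≤ ((4 + ‖ξ‖ ^ 2) * min 1 (‖p.1 - p.2‖ ^ 2)) * ‖b‖ ^ 2 := by gcongr
      _ = _ := by ring
  nlinarith [sq_nonneg (‖a - b‖ - ‖e p.1 - e p.2‖ * ‖b‖)]

/-- On the form domain, the quadratic form with unit coefficient is finite. -/
lemma integrable_twistedDiff {d : ℕ} [NeZero d] {α : ℝ} (h0 : 0 < α) (h2 : α < 2) (ξ : Space d)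
    {u : L2Cell d} (hu : u ∈ perSobolev d (α / 2)) :
    Integrable (fun p => ‖twistedDiff ξ u p‖ ^ 2 / ‖p.1 - p.2‖ ^ (d + α)) (cellProd d) := by
  obtain ⟨R, hR0, hR⟩ := (isBounded_cell d).exists_pos_norm_lt
  have hum := measurable_perExt u
  have htm := measurable_twistedDiff ξ u
  have hk := integrable_levy (d := d) h0 h2
  have hkm : Measurable (fun z : Space d => min 1 (‖z‖ ^ 2) / ‖z‖ ^ (d + α)) := by fun_prop
  obtain ⟨hf1, hf2⟩ := integrable_far u hk hkm
  set B : Set (Space d × Space d) := Metric.ball 0 (R + 1) ×ˢ Metric.ball 0 (R + 1)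
  have hBm : MeasurableSet B := measurableSet_ball.prod measurableSet_ball
  have hnear : Integrable (B.indicator fun p : Space d × Space d =>
      ‖perExt u p.1 - perExt u p.2‖ ^ 2 / ‖p.1 - p.2‖ ^ (d + α)) (cellProd d) := by
    have h := hu (R + 1)
    rw [show (d + 2 * (α / 2) : ℝ) = d + α by ring] at h
    have h' := (integrable_indicator_iff hBm).2 h
    refine h'.mono_measure ?_
    exact Measure.prod_mono Measure.restrict_le_self le_rfl
  refine ((hnear.const_mul 2).add (((hf1.add hf2).const_mul 4).add
    (hf2.const_mul (2 * (4 + ‖ξ‖ ^ 2))))).mono' (by fun_prop : Measurable _).aestronglyMeasurable ?_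
  have hcell : ∀ᵐ p ∂(cellProd d), p.1 ∈ cell d :=
    Measure.quasiMeasurePreserving_fst.ae (ae_restrict_mem (measurableSet_cell d))
  filter_upwards [hcell] with p hp
  rw [Real.norm_of_nonneg (by positivity)]
  have hmain := norm_twistedDiff_sq_le ξ u p
  have hD : 0 ≤ ‖p.1 - p.2‖ ^ (d + α) := by positivity
  have hsum : 2 * ‖perExt u p.1 - perExt u p.2‖ ^ 2 / ‖p.1 - p.2‖ ^ (d + α) ≤
      2 * B.indicator (fun p : Space d × Space d =>
      ‖perExt u p.1 - perExt u p.2‖ ^ 2 / ‖p.1 - p.2‖ ^ (d + α)) p +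
      4 * (‖perExt u p.1‖ ^ 2 * (min 1 (‖p.1 - p.2‖ ^ 2) / ‖p.1 - p.2‖ ^ (d + α)) +
        ‖perExt u p.2‖ ^ 2 * (min 1 (‖p.1 - p.2‖ ^ 2) / ‖p.1 - p.2‖ ^ (d + α))) := by
    by_cases hpB : p ∈ B
    · rw [indicator_of_mem hpB, ← mul_div_assoc]
      have : 0 ≤ 4 * (‖perExt u p.1‖ ^ 2 * (min 1 (‖p.1 - p.2‖ ^ 2) / ‖p.1 - p.2‖ ^ (d + α)) +
        ‖perExt u p.2‖ ^ 2 * (min 1 (‖p.1 - p.2‖ ^ 2) / ‖p.1 - p.2‖ ^ (d + α))) := by positivity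
      linarith
    · have hp1 := hR p.1 hp
      have hp2 : R + 1 ≤ ‖p.2‖ := by
        by_contra! h
        exact hpB ⟨by simp; linarith, by simpa using h⟩
      have h1 : 1 ≤ ‖p.1 - p.2‖ := by
        have := norm_sub_norm_le p.2 p.1
        rw [norm_sub_rev] at this; linarith
      rw [indicator_of_notMem hpB, mul_zero, zero_add, min_eq_left (one_le_pow₀ h1), ← add_mul,
        mul_one_div, ← mul_div_assoc]
      refine div_le_div_of_nonneg_right ?_ hD
      have h3 := norm_sub_le (perExt u p.1) (perExt u p.2)
      have h4 := pow_le_pow_left₀ (norm_nonneg _) h3 2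
      nlinarith [sq_nonneg (‖perExt u p.1‖ - ‖perExt u p.2‖)]
  calc _ ≤ (2 * ‖perExt u p.1 - perExt u p.2‖ ^ 2 +
      2 * (4 + ‖ξ‖ ^ 2) * (‖perExt u p.2‖ ^ 2 * min 1 (‖p.1 - p.2‖ ^ 2))) /
        ‖p.1 - p.2‖ ^ (d + α) := by gcongr
    _ = 2 * ‖perExt u p.1 - perExt u p.2‖ ^ 2 / ‖p.1 - p.2‖ ^ (d + α) +
      2 * (4 + ‖ξ‖ ^ 2) * (‖perExt u p.2‖ ^ 2 *
        (min 1 (‖p.1 - p.2‖ ^ 2) / ‖p.1 - p.2‖ ^ (d + α))) := by ring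
    _ ≤ _ := by
      simp only [Pi.add_apply]
      linarith

/-- The integrand of the sesquilinear form `a(ξ)[u,v]`, conjugate-linear in `u`. -/
def formIntegrand {d : ℕ} (α : ℝ) {m M : ℝ} (μ : Coefficient d m M) (ξ : Space d)
    (u v : L2Cell d) (p : Space d × Space d) : ℂ :=
  ((μ.toFun p.1 p.2 / ‖p.1 - p.2‖ ^ (d + α) : ℝ) : ℂ) *
    (conj (twistedDiff ξ u p) * twistedDiff ξ v p)

lemma cellProd_ac (d : ℕ) : cellProd d ≪ (volume : Measure (Space d × Space d)) :=
  Measure.absolutelyContinuous_of_le (Measure.prod_mono Measure.restrict_le_self le_rfl)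

lemma integrable_formIntegrand {d : ℕ} [NeZero d] {α : ℝ} (h0 : 0 < α) (h2 : α < 2) {m M : ℝ}
    (μ : Coefficient d m M) (ξ : Space d) {u v : L2Cell d} (hu : u ∈ perSobolev d (α / 2))
    (hv : v ∈ perSobolev d (α / 2)) :
    Integrable (formIntegrand α μ ξ u v) (cellProd d) := by
  have hum := measurable_twistedDiff ξ u
  have hvm := measurable_twistedDiff ξ v
  have hμ := μ.aestronglyMeasurable'.aemeasurable.mono_ac (cellProd_ac d)
  refine (((integrable_twistedDiff h0 h2 ξ hu).add
    (integrable_twistedDiff h0 h2 ξ hv)).const_mul (max |m| |M|)).mono' ?_ ?_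
  · unfold formIntegrand
    refine AEMeasurable.aestronglyMeasurable ?_
    refine AEMeasurable.mul (Complex.measurable_ofReal.comp_aemeasurable (hμ.div ?_)) ?_
    · exact (by fun_prop : Measurable _).aemeasurable
    · exact ((Complex.continuous_conj.measurable.comp hum).mul hvm).aemeasurable
  · filter_upwards [(cellProd_ac d).ae_le μ.bounds'] with p hp
    have h1 : |μ.toFun p.1 p.2| ≤ max |m| |M| := abs_le_max_abs_abs hp.1 hp.2
    rw [formIntegrand, norm_mul, norm_mul, RCLike.norm_conj, Complex.norm_real, Real.norm_eq_abs,
      abs_div, abs_of_nonneg (a := ‖p.1 - p.2‖ ^ (d + α)) (by positivity), Pi.add_apply,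
      ← add_div, div_mul_eq_mul_div, ← mul_div_assoc]
    gcongr
    nlinarith [sq_nonneg (‖twistedDiff ξ u p‖ - ‖twistedDiff ξ v p‖),
      mul_nonneg (norm_nonneg (twistedDiff ξ u p)) (norm_nonneg (twistedDiff ξ v p))]

lemma twistedDiff_add {d : ℕ} (ξ : Space d) (u v : L2Cell d) :
    ∀ᵐ p ∂(cellProd d), twistedDiff ξ (u + v) p = twistedDiff ξ u p + twistedDiff ξ v p := by
  filter_upwards [(cellProd_ac d).ae_le (ae_fst (perExt_add u v)),
    (cellProd_ac d).ae_le (ae_snd (perExt_add u v))] with p h1 h2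
  simp only [twistedDiff, h1, h2]; ring

lemma twistedDiff_smul {d : ℕ} (ξ : Space d) (c : ℂ) (u : L2Cell d) :
    ∀ᵐ p ∂(cellProd d), twistedDiff ξ (c • u) p = c * twistedDiff ξ u p := by
  filter_upwards [(cellProd_ac d).ae_le (ae_fst (perExt_smul c u)),
    (cellProd_ac d).ae_le (ae_snd (perExt_smul c u))] with p h1 h2
  simp only [twistedDiff, h1, h2]; ring

/-- The sesquilinear form `a(ξ)` with domain `H̃^{α/2}(Ω)`,
`a(ξ)[u,v] = (1/2) ∫∫ μ(x,y) conj(e^{i⟨ξ,x⟩}u(x) - e^{i⟨ξ,y⟩}u(y))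
(e^{i⟨ξ,x⟩}v(x) - e^{i⟨ξ,y⟩}v(y)) / |x-y|^{d+α} dx dy` over `x ∈ Ω`, `y ∈ ℝ^d`. As for Mathlib's
inner product, the first argument is the conjugate-linear one. -/
def fiberForm {d : ℕ} [NeZero d] {α : ℝ} (h0 : 0 < α) (h2 : α < 2) {m M : ℝ}
    (μ : Coefficient d m M) (ξ : Space d) :
    perSobolev d (α / 2) →ₗ⋆[ℂ] perSobolev d (α / 2) →ₗ[ℂ] ℂ :=
  LinearMap.mk₂'ₛₗ (starRingEnd ℂ) (RingHom.id ℂ)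
    (fun u v => (1 / 2) * ∫ p, formIntegrand α μ ξ u v p ∂(cellProd d))
    (fun u₁ u₂ v => by
      rw [← mul_add, ← integral_add (integrable_formIntegrand h0 h2 μ ξ u₁.2 v.2)
        (integrable_formIntegrand h0 h2 μ ξ u₂.2 v.2)]
      congr 1
      refine integral_congr_ae ?_
      filter_upwards [twistedDiff_add ξ (u₁ : L2Cell d) u₂] with p hp
      simp only [formIntegrand, Submodule.coe_add, hp, map_add]; ring)
    (fun c u v => by
      rw [smul_eq_mul, mul_left_comm, ← integral_const_mul (starRingEnd ℂ c)]
      congr 1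
      refine integral_congr_ae ?_
      filter_upwards [twistedDiff_smul ξ c (u : L2Cell d)] with p hp
      simp only [formIntegrand, Submodule.coe_smul, hp, map_mul]; ring)
    (fun u v₁ v₂ => by
      rw [← mul_add, ← integral_add (integrable_formIntegrand h0 h2 μ ξ u.2 v₁.2)
        (integrable_formIntegrand h0 h2 μ ξ u.2 v₂.2)]
      congr 1
      refine integral_congr_ae ?_
      filter_upwards [twistedDiff_add ξ (v₁ : L2Cell d) v₂] with p hp
      simp only [formIntegrand, Submodule.coe_add, hp]; ring)
    (fun c u v => by
      rw [smul_eq_mul, RingHom.id_apply, mul_left_comm, ← integral_const_mul c]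
      congr 1
      refine integral_congr_ae ?_
      filter_upwards [twistedDiff_smul ξ c (v : L2Cell d)] with p hp
      simp only [formIntegrand, Submodule.coe_smul, hp]; ring)

/-- A Lipschitz function supported in the cell belongs to the periodic Sobolev spaces. -/
lemma mem_perSobolev_of_lipschitz {d : ℕ} [NeZero d] {α : ℝ} (h2 : α < 2)
    {u : L2Cell d} {g : Space d → ℂ} {L : ℝ} (hL : ∀ x y, ‖g x - g y‖ ≤ L * ‖x - y‖)
    (hg : ∀ x, x ∉ cell d → g x = 0)
    (hu : u =ᵐ[volume.restrict (cell d)] g) : u ∈ perSobolev d (α / 2) := by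
  have hper : perExt u =ᵐ[volume] fun x => g (toCell x) := quasi_toCell.ae_eq hu
  have hL0 : 0 ≤ L := by
    obtain ⟨x, hx⟩ := exists_ne (0 : Space d)
    have := (norm_nonneg _).trans (hL x 0)
    rw [sub_zero] at this
    exact nonneg_of_mul_nonneg_left this (norm_pos_iff.2 hx)
  have hone : ∀ x y : Space d, toCell y ≠ y - latticeVec (fun i => ⌊x i⌋) →
      ‖g (toCell x)‖ ≤ L * ‖x - y‖ := fun x y hxy => by
    have hz : g (y - latticeVec fun i => ⌊x i⌋) = 0 := by
      refine hg _ fun hmem => hxy ?_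
      rw [← toCell_of_mem hmem, ← toCell_add (y - latticeVec fun i => ⌊x i⌋) fun i => ⌊x i⌋]
      simp
    have := hL (toCell x) (y - latticeVec fun i => ⌊x i⌋)
    rw [hz, sub_zero] at this
    refine this.trans (le_of_eq ?_)
    rw [toCell_eq_sub x]; congr 2; abel
  have hper2 : ∀ x y : Space d, ‖g (toCell x) - g (toCell y)‖ ≤ 2 * L * ‖x - y‖ := fun x y => by
    have hnn : 0 ≤ L * ‖x - y‖ := by positivity
    by_cases hxy : toCell y = y - latticeVec (fun i => ⌊x i⌋)
    · have := hL (toCell x) (toCell y)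
      have he : toCell x - toCell y = x - y := by rw [hxy, toCell_eq_sub x]; abel
      rw [he] at this; linarith
    · have h1 := hone x y hxy
      have h3 : toCell x ≠ x - latticeVec (fun i => ⌊y i⌋) := fun h => hxy <| by
        have : latticeVec (fun i => ⌊x i⌋) = latticeVec fun i => ⌊y i⌋ := by
          rw [toCell_eq_sub] at h; exact sub_right_injective h
        rw [this, toCell_eq_sub]
      have h4 := hone y x h3
      rw [norm_sub_rev y x] at h4
      have := norm_sub_le (g (toCell x)) (g (toCell y))
      linarith
  have hd : 1 ≤ Module.finrank ℝ (Space d) := by simpa using NeZero.one_le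
  intro r
  have hum := measurable_perExt u
  have hk : IntegrableOn (fun z : Space d => ‖z‖ ^ (-(d + α - 2))) (Metric.ball 0 (2 * r)) :=
    integrableOn_ball_of_norm_le_rpow (C := 1) (α := d + α - 2) hd
      (by simp only [finrank_euclideanSpace, Fintype.card_fin]; linarith)
      (Filter.Eventually.of_forall fun z => by
        rw [one_mul, Real.norm_of_nonneg (by positivity)])
      (by fun_prop : Measurable _).aestronglyMeasurable
  have hk' := (integrable_indicator_iff measurableSet_ball).2 hk
  have hB : IsFiniteMeasure ((volume : Measure (Space d)).restrict (Metric.ball 0 r)) :=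
    ⟨by simpa using measure_ball_lt_top⟩
  have hprod : Integrable (fun p : Space d × Space d =>
      (Metric.ball 0 (2 * r)).indicator (fun z : Space d => ‖z‖ ^ (-(d + α - 2))) (p.1 - p.2))
      (((volume : Measure (Space d)).restrict (Metric.ball 0 r)).prod volume) := by
    have h3 := (integrable_const (μ := (volume : Measure (Space d)).restrict (Metric.ball 0 r))
      (1 : ℝ)).mul_prod hk'
    have h4 : MeasurePreserving (fun p : Space d × Space d => (p.1, p.1 - p.2))
        (((volume : Measure (Space d)).restrict (Metric.ball 0 r)).prod volume)
        (((volume : Measure (Space d)).restrict (Metric.ball 0 r)).prod volume) :=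
      (MeasurePreserving.id _).skew_product (by fun_prop)
        (Filter.Eventually.of_forall fun x => (Measure.measurePreserving_sub_left volume x).map_eq)
    have h5 := h4.integrable_comp_of_integrable h3
    simpa [Function.comp_def] using h5
  have hle : ((volume : Measure (Space d)).restrict (Metric.ball 0 r)).prod
      ((volume : Measure (Space d)).restrict (Metric.ball 0 r)) ≤
      ((volume : Measure (Space d)).restrict (Metric.ball 0 r)).prod volume :=
    Measure.prod_mono le_rfl Measure.restrict_le_self
  have hprod2 := (hprod.const_mul ((2 * L) ^ 2)).mono_measure hle
  rw [Measure.prod_restrict] at hprod2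
  refine hprod2.mono' (by fun_prop : Measurable _).aestronglyMeasurable ?_
  filter_upwards [ae_restrict_of_ae (ae_fst hper), ae_restrict_of_ae (ae_snd hper),
    ae_restrict_mem (measurableSet_ball.prod measurableSet_ball)] with p h3 h4 hp
  rw [Real.norm_of_nonneg (by positivity), h3, h4, show (d + 2 * (α / 2) : ℝ) = d + α by ring]
  rcases eq_or_ne (p.1 - p.2) 0 with hz | hz
  · rw [sub_eq_zero.1 hz]
    simp only [sub_self, norm_zero]
    rw [zero_pow two_ne_zero, zero_div]
    exact mul_nonneg (by positivity) (indicator_nonneg (fun _ _ => by positivity) _)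
  have hz : 0 < ‖p.1 - p.2‖ := norm_pos_iff.2 hz
  rw [indicator_of_mem, div_le_iff₀ (by positivity), mul_assoc, ← Real.rpow_add hz,
    show -(d + α - 2) + (d + α) = (2 : ℕ) by push_cast; ring, Real.rpow_natCast, ← mul_pow]
  · exact pow_le_pow_left₀ (norm_nonneg _) (hper2 _ _) 2
  · have h5 : ‖p.1‖ < r := by simpa using hp.1
    have h6 : ‖p.2‖ < r := by simpa using hp.2
    have := norm_sub_le p.1 p.2
    simp only [Metric.mem_ball, dist_zero_right]; linarith

lemma ae_mem_interior_cell (d : ℕ) :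
    ∀ᵐ x ∂((volume : Measure (Space d)).restrict (cell d)), x ∈ interior (cell d) := by
  have h : volume (frontier (cell d)) = 0 := by
    have hc : Convex ℝ (cell d) := by
      intro x hx y hy a b ha hb hab i
      exact (convex_Ico (𝕜 := ℝ) (0 : ℝ) 1) (hx i) (hy i) ha hb hab
    exact hc.addHaar_frontier volume
  have h' : ∀ᵐ x : Space d, x ∉ frontier (cell d) := measure_eq_zero_iff_ae_notMem.1 h
  filter_upwards [ae_restrict_of_ae h', ae_restrict_mem (measurableSet_cell d)] with x h1 h2
  by_contra h3
  exact h1 ⟨subset_closure h2, h3⟩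

/-- The form domain `H̃^{α/2}(Ω)` is dense in `L₂(Ω)`. -/
lemma dense_perSobolev {d : ℕ} [NeZero d] {α : ℝ} (h2 : α < 2) :
    Dense (perSobolev d (α / 2) : Set (L2Cell d)) := by
  rw [Submodule.dense_iff_topologicalClosure_eq_top, Submodule.topologicalClosure_eq_top_iff,
    Submodule.eq_bot_iff]
  intro w hw
  rw [Submodule.mem_orthogonal] at hw
  have hint : Integrable w (volume.restrict (cell d)) :=
    (Lp.memLp w).integrable (by norm_num)
  have key : ∀ᵐ x ∂((volume : Measure (Space d)).restrict (cell d)),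
      x ∈ interior (cell d) → w x = 0 := by
    refine isOpen_interior.ae_eq_zero_of_integral_contDiff_smul_eq_zero
      (hint.locallyIntegrable.locallyIntegrableOn _) fun g hg hgc hgs => ?_
    obtain ⟨L, hL⟩ := (hg.of_le (by simp) : ContDiff ℝ 1 g).lipschitzWith_of_hasCompactSupport
      hgc one_ne_zero
    have hG : MemLp (fun x => (g x : ℂ)) 2 ((volume : Measure (Space d)).restrict (cell d)) :=
      ((hg.continuous.memLp_of_hasCompactSupport hgc).ofReal).restrict _
    have hmem := mem_perSobolev_of_lipschitz h2 (u := hG.toLp _) (g := fun x => (g x : ℂ))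
      (L := L) (fun x y => by
        rw [← Complex.ofReal_sub, Complex.norm_real, ← dist_eq_norm, ← dist_eq_norm]
        exact hL.dist_le_mul x y)
      (fun x hx => by
        rw [image_eq_zero_of_notMem_tsupport fun h => hx (interior_subset (hgs h))]; simp)
      hG.coeFn_toLp
    have h3 := hw _ hmem
    rw [L2.inner_def] at h3
    rw [← h3]
    refine integral_congr_ae ?_
    filter_upwards [hG.coeFn_toLp] with x hx
    rw [hx, RCLike.inner_apply, Complex.conj_ofReal, Complex.real_smul, mul_comm]
  have h3 : w =ᵐ[volume.restrict (cell d)] 0 := by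
    filter_upwards [key, ae_mem_interior_cell d] with x hx hx'
    exact hx hx'
  exact (Lp.eq_zero_iff_ae_eq_zero).2 h3

/-- The domain of the operator generated by a sesquilinear form `a` with domain `D`: the vectors
`u ∈ D` such that `a[u,v] = ⟪w,v⟫` for some `w` and all `v ∈ D`. -/
def formOperatorDomain {H : Type*} [NormedAddCommGroup H] [InnerProductSpace ℂ H]
    (D : Submodule ℂ H) (a : D →ₗ⋆[ℂ] D →ₗ[ℂ] ℂ) : Submodule ℂ H where
  carrier := {u | ∃ w : H, ∃ h : u ∈ D, ∀ v : D, a ⟨u, h⟩ v = ⟪w, (v : H)⟫_ℂ}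
  zero_mem' := ⟨0, D.zero_mem, fun v => by
    rw [show (⟨0, D.zero_mem⟩ : D) = 0 from rfl, map_zero]; simp⟩
  add_mem' := by
    rintro u₁ u₂ ⟨w₁, h₁, e₁⟩ ⟨w₂, h₂, e₂⟩
    refine ⟨w₁ + w₂, D.add_mem h₁ h₂, fun v => ?_⟩
    rw [show (⟨u₁ + u₂, D.add_mem h₁ h₂⟩ : D) = ⟨u₁, h₁⟩ + ⟨u₂, h₂⟩ from rfl, map_add,
      LinearMap.add_apply, e₁, e₂, inner_add_left]
  smul_mem' := by
    rintro c u ⟨w, h, e⟩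
    refine ⟨c • w, D.smul_mem c h, fun v => ?_⟩
    rw [show (⟨c • u, D.smul_mem c h⟩ : D) = c • ⟨u, h⟩ from rfl, LinearMap.map_smulₛₗ,
      LinearMap.smul_apply, e, inner_smul_left, smul_eq_mul]

/-- The operator in a complex Hilbert space generated by a densely defined sesquilinear form `a`:
its value at a vector `u` of its domain is the unique `w` such that `a[u,v] = ⟪w,v⟫` for all `v` in
the domain of the form. For a closed nonnegative form this is the self-adjoint operator
corresponding to the form. -/
def formOperator {H : Type*} [NormedAddCommGroup H] [InnerProductSpace ℂ H] (D : Submodule ℂ H)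
    (hD : Dense (D : Set H)) (a : D →ₗ⋆[ℂ] D →ₗ[ℂ] ℂ) : H →ₗ.[ℂ] H where
  domain := formOperatorDomain D a
  toFun :=
    { toFun := fun u => u.2.choose
      map_add' := fun u₁ u₂ => by
        obtain ⟨h₁, e₁⟩ := u₁.2.choose_spec
        obtain ⟨h₂, e₂⟩ := u₂.2.choose_spec
        obtain ⟨h, e⟩ := (u₁ + u₂).2.choose_spec
        refine hD.eq_of_inner_left ℂ fun v hv => ?_
        rw [inner_add_left, ← e ⟨v, hv⟩, ← e₁ ⟨v, hv⟩, ← e₂ ⟨v, hv⟩, ← LinearMap.add_apply,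
          ← map_add]
        rfl
      map_smul' := fun c u => by
        obtain ⟨h₁, e₁⟩ := u.2.choose_spec
        obtain ⟨h, e⟩ := (c • u).2.choose_spec
        have h3 : (⟨((c • u : formOperatorDomain D a) : H), h⟩ : D) = c • ⟨u, h₁⟩ := rfl
        refine hD.eq_of_inner_left ℂ fun v hv => ?_
        rw [RingHom.id_apply, inner_smul_left, ← e ⟨v, hv⟩, ← e₁ ⟨v, hv⟩, h3,
          LinearMap.map_smulₛₗ, LinearMap.smul_apply, smul_eq_mul] }

/-- The self-adjoint operator `A(ξ)` in `L₂(Ω)` generated by the form `a(ξ)`. -/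
def fiberOperator {d : ℕ} [NeZero d] {α : ℝ} (h0 : 0 < α) (h2 : α < 2) {m M : ℝ}
    (μ : Coefficient d m M) (ξ : Space d) : L2Cell d →ₗ.[ℂ] L2Cell d :=
  formOperator (perSobolev d (α / 2)) (dense_perSobolev h2) (fiberForm h0 h2 μ ξ)

/-- `R = (A + t I)⁻¹`: the bounded everywhere defined operator `R` is the two-sided inverse of
`A + t I : Dom A → H`. -/
def IsShiftedInverse {H : Type*} [NormedAddCommGroup H] [InnerProductSpace ℂ H] (A : H →ₗ.[ℂ] H)
    (t : ℝ) (R : H →L[ℂ] H) : Prop :=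
  (∀ f : H, ∃ u : A.domain, (u : H) = R f ∧ A u + (t : ℂ) • (u : H) = f) ∧
    ∀ u : A.domain, R (A u + (t : ℂ) • (u : H)) = u

/-- The orthogonal projection `P` of `L₂(Ω)` onto the constants. -/
def constProj (d : ℕ) : L2Cell d →L[ℂ] L2Cell d :=
  (ℂ ∙ (Lp.const 2 ((volume : Measure (Space d)).restrict (cell d)) (1 : ℂ))).starProjection

/-- The constant `c₀(d,α) = ∫_{ℝ^d} (1 - cos z₁) / |z|^{d+α} dz`. -/
def c₀ (d : ℕ) [NeZero d] (α : ℝ) : ℝ :=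
  ∫ z : Space d, (1 - Real.cos (z 0)) / ‖z‖ ^ (d + α)

/-- The symbol `V_α(ξ) = c₀(d,α) |ξ|^α`. -/
def symbolV {d : ℕ} [NeZero d] (α : ℝ) (ξ : Space d) : ℝ := c₀ d α * ‖ξ‖ ^ α

/-- The radius `δ₀ = π (m / (3 M))^{1/α}`. -/
def δ₀ (α m M : ℝ) : ℝ := Real.pi * (m / (3 * M)) ^ (1 / α)

/-- The error bound as a function of `ε`: it is `1` for `0 < α < 1`, `(1 + |ln ε|)²` for `α = 1`,
and `ε^{2-2α}` for `1 < α < 2`. -/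
def errorBound (α ε : ℝ) : ℝ :=
  if α < 1 then 1 else if α = 1 then (1 + |Real.log ε|) ^ 2 else ε ^ (2 - 2 * α)

end LevyPeriodic

end

/-!
The form `a(ξ)` is written as `a(ξ)[u, v] = ⟪T u, T v⟫`, where `T` sends `u` to its weighted twisted
difference in `L₂(Ω × ℝ^d)` (`formRoot`). The operator `T` is closed (`isClosed_formRoot`), so the
resolvent exists, is bounded by `ε^{-α}`, and solves the weak equation `A(ξ)u + ε^α u = f`
(`exists_isShiftedInverse`).

The solution `u = c·1 + w`, with `w` of zero mean, is found approximately by a Schur complement with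
respect to the constant function `1` (`norm_weakSolution_sub_le`). Neither Fourier series nor the
perturbation theory of eigenvalues is needed, only four estimates, uniform in `|ξ| ≤ π`. Let
`b = |ξ| + ∫_{|z| ≥ 1} min(1, |ξ||z|) |z|^{-d-α} dz` (`couplingSize`).

* Gap: the form is bounded below on functions of zero mean (`exists_gap`). Already the jumps inside
  the cell suffice, as `e^{i⟨ξ,x⟩}w` is a fixed distance away from constants.
* Lower bound: `a(ξ)[u, u] ≥ κ V_α(ξ) ‖u‖²` on the whole domain (`exists_symbolV_mul_le`). For the
  unit coefficient constants and functions of zero mean are orthogonal with respect to the form, and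
  the form takes the value `V_α(ξ)` at `1`; a general coefficient is compared with a constant one.
* Coupling: `|a(ξ)[1, w]| ≤ C b a(ξ)[w, w]^{1/2}` (`exists_norm_inner_formRoot_le`), by the
  Cauchy–Schwarz inequality for short jumps and by an `L₁` bound for long ones.
* Mean value: `|a(ξ)[1, 1] - μ⁰ V_α(ξ)| ≤ C b²` (`exists_norm_formRoot_constForm_sq_sub_le`), since
  replacing the periodic coefficient by its average amounts to translating the kernel
  `(1 - cos⟨ξ,z⟩) |z|^{-d-α}` within the cell.

They bound the difference of the resolvents by a constant times `1 + (b / N)²` with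
`N = |ξ|^α + ε^α`. Finally `b / N` is at most a constant times the square root of the error bound
(`exists_couplingSize_le`), which is at least `1` when `ε ≤ 1`. For `ε ≥ 1` each of the two operators
is by itself small enough.
-/

open MeasureTheory Set
open scoped ComplexConjugate InnerProductSpace Pointwise ContDiff

noncomputable section

namespace LevyPeriodic

/-! ### Forms with closed factorization and their resolvents -/

section Abstract

variable {H G : Type*} [NormedAddCommGroup H] [InnerProductSpace ℂ H]
  [NormedAddCommGroup G] [InnerProductSpace ℂ G]

lemma inner_self_eq_ofReal (x : H) : ⟪x, x⟫_ℂ = ((‖x‖ ^ 2 : ℝ) : ℂ) := by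
  rw [inner_self_eq_norm_sq_to_K, Complex.ofReal_pow]
  rfl

lemma formOperator_apply_eq {D : Submodule ℂ H} (hD : Dense (D : Set H))
    (a : D →ₗ⋆[ℂ] D →ₗ[ℂ] ℂ) (u : (formOperator D hD a).domain) {h : (u : H) ∈ D} {w : H}
    (hw : ∀ v : D, a ⟨u, h⟩ v = ⟪w, (v : H)⟫_ℂ) : formOperator D hD a u = w := by
  obtain ⟨h', e⟩ := u.2.choose_spec
  refine hD.eq_of_inner_left ℂ fun v hv => ?_
  rw [← hw ⟨v, hv⟩, e ⟨v, hv⟩]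
  rfl

/-- The graph of `s⁻¹ T` as a subspace of the Hilbert space `H ⊕ G`. -/
def scaledGraph {D : Submodule ℂ H} (T : D →ₗ[ℂ] G) (s : ℂ) : Submodule ℂ (WithLp 2 (H × G)) where
  carrier := {x | ∃ u : D, (u : H) = x.fst ∧ T u = s • x.snd}
  zero_mem' := ⟨0, by simp⟩
  add_mem' := by
    rintro x y ⟨u, hu, hu'⟩ ⟨v, hv, hv'⟩
    exact ⟨u + v, by simp [hu, hv], by simp [hu', hv']⟩
  smul_mem' := by
    rintro c x ⟨u, hu, hu'⟩
    exact ⟨c • u, by simp [hu], by simp [hu', smul_comm c s]⟩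

lemma isClosed_scaledGraph {D : Submodule ℂ H} {T : D →ₗ[ℂ] G}
    (hT : IsClosed {p : H × G | ∃ u : D, (u : H) = p.1 ∧ T u = p.2}) (s : ℂ) :
    IsClosed (scaledGraph T s : Set (WithLp 2 (H × G))) := by
  have : Continuous fun x : WithLp 2 (H × G) => (x.fst, s • x.snd) := by fun_prop
  exact hT.preimage this

/-- A form `a[u, v] = ⟪T u, T v⟫` with `T` closed has a bounded resolvent. The vector
`(R f, t^{-1/2} T R f)` is obtained by projecting `t⁻¹ (f, 0)` orthogonally onto the graph of
`t^{-1/2} T`: orthogonality to the graph is the weak form of the equation `A u + t u = f`. -/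
theorem exists_isShiftedInverse [CompleteSpace H] [CompleteSpace G] {D : Submodule ℂ H}
    (hD : Dense (D : Set H)) (a : D →ₗ⋆[ℂ] D →ₗ[ℂ] ℂ) (T : D →ₗ[ℂ] G)
    (ha : ∀ u v, a u v = ⟪T u, T v⟫_ℂ)
    (hT : IsClosed {p : H × G | ∃ u : D, (u : H) = p.1 ∧ T u = p.2}) {t : ℝ} (ht : 0 < t) :
    ∃ R : H →L[ℂ] H, IsShiftedInverse (formOperator D hD a) t R ∧ ‖R‖ ≤ t⁻¹ ∧
      ∀ f, ∃ u : D, (u : H) = R f ∧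
        ∀ v : D, ⟪T u, T v⟫_ℂ + t * ⟪(u : H), (v : H)⟫_ℂ = ⟪f, (v : H)⟫_ℂ := by
  set s : ℂ := ((Real.sqrt t : ℝ) : ℂ) with hs
  have hss : s * s = t := by rw [hs, ← Complex.ofReal_mul, Real.mul_self_sqrt ht.le]
  have hs0 : s ≠ 0 := by
    rw [hs, Complex.ofReal_ne_zero]; exact (Real.sqrt_pos.2 ht).ne'
  have hconj : conj s = s := Complex.conj_ofReal _
  have ht0 : (t : ℂ) ≠ 0 := Complex.ofReal_ne_zero.2 ht.ne'
  set K := scaledGraph T s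
  have : CompleteSpace K := (isClosed_scaledGraph hT s).completeSpace_coe
  set R₀ : H → H := fun f => (t : ℂ)⁻¹ • (K.starProjection (WithLp.toLp 2 (f, 0))).fst
  let R : H →L[ℂ] H := LinearMap.mkContinuous
    { toFun := R₀
      map_add' := fun f g => by
        have : (WithLp.toLp 2 (f + g, 0) : WithLp 2 (H × G)) =
          WithLp.toLp 2 (f, 0) + WithLp.toLp 2 (g, 0) := by
            rw [← WithLp.toLp_add]; simp
        simp only [R₀]
        rw [this, map_add, WithLp.add_fst, smul_add]
      map_smul' := fun c f => by
        have : (WithLp.toLp 2 (c • f, 0) : WithLp 2 (H × G)) =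
          c • WithLp.toLp 2 (f, 0) := by
            rw [← WithLp.toLp_smul]; simp
        simp only [R₀]
        rw [this, map_smul, WithLp.smul_fst, smul_comm, RingHom.id_apply] } t⁻¹ (fun f => by
      change ‖(t : ℂ)⁻¹ • (K.starProjection (WithLp.toLp 2 (f, 0))).fst‖ ≤ _
      rw [norm_smul, norm_inv, Complex.norm_real, Real.norm_of_nonneg ht.le]
      gcongr
      refine (WithLp.norm_fst_le (p := 2) (α := H) (β := G) _).trans ?_
      refine (K.norm_starProjection_apply_le _).trans (le_of_eq ?_)
      simp)
  have hR : ∀ f, R f = (t : ℂ)⁻¹ • (K.starProjection (WithLp.toLp 2 (f, 0))).fst := fun f => rfl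
  have weak : ∀ f, ∃ u : D, (u : H) = R f ∧
        ∀ v : D, ⟪T u, T v⟫_ℂ + t * ⟪(u : H), (v : H)⟫_ℂ = ⟪f, (v : H)⟫_ℂ := by
    intro f
    set x := K.starProjection (WithLp.toLp 2 (f, 0)) with hx
    obtain ⟨u, hu, hu'⟩ : x ∈ K := K.starProjection_apply_mem _
    refine ⟨(t : ℂ)⁻¹ • u, by rw [hR, Submodule.coe_smul, hu], fun v => ?_⟩
    have hv : (WithLp.toLp 2 ((v : H), s⁻¹ • T v) : WithLp 2 (H × G)) ∈ K :=
      ⟨v, rfl, by simp [smul_smul, hs0]⟩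
    have h := Submodule.starProjection_inner_eq_zero (K := K) (WithLp.toLp 2 (f, 0)) _ hv
    have hsnd : x.snd = s⁻¹ • T u := by rw [hu', smul_smul, inv_mul_cancel₀ hs0, one_smul]
    have hsub : WithLp.toLp 2 (f, 0) - x = WithLp.toLp 2 (f - (u : H), 0 - s⁻¹ • T u) := by
      rw [hu, ← hsnd]; rfl
    rw [← hx, hsub, WithLp.prod_inner_apply] at h
    simp only [zero_sub, inner_neg_left, inner_smul_left, inner_smul_right, map_inv₀, hconj,
      inner_sub_left] at h
    rw [map_smul, Submodule.coe_smul, inner_smul_left, inner_smul_left, map_inv₀,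
      Complex.conj_ofReal, ← hss]
    have h2 : ⟪f, (v : H)⟫_ℂ = ⟪(u : H), (v : H)⟫_ℂ + s⁻¹ * (s⁻¹ * ⟪T u, T v⟫_ℂ) := by
      linear_combination h
    rw [h2]
    field_simp
    ring
  refine ⟨R, ⟨fun f => ?_, fun u => ?_⟩, LinearMap.mkContinuous_norm_le _ (by positivity) _, weak⟩
  · obtain ⟨u, hu, hw⟩ := weak f
    have hw' : ∀ v : D, a ⟨u, u.2⟩ v = ⟪f - (t : ℂ) • (u : H), (v : H)⟫_ℂ := fun v => by
      rw [ha, inner_sub_left, inner_smul_left, Complex.conj_ofReal, ← hw v]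
      simp
    refine ⟨⟨u, _, u.2, hw'⟩, hu, ?_⟩
    rw [formOperator_apply_eq hD a ⟨u, _, u.2, hw'⟩ hw']
    simp
  · obtain ⟨w, h, e⟩ := u.2
    have hA := formOperator_apply_eq hD a u e
    rw [hA]
    obtain ⟨u', hu', hw⟩ := weak (w + (t : ℂ) • (u : H))
    rw [← hu']
    have h1 := hw (u' - ⟨u, h⟩)
    have h2 := e (u' - ⟨u, h⟩)
    rw [ha] at h2
    rw [inner_add_left, ← h2, inner_smul_left, Complex.conj_ofReal] at h1
    have h3 : ⟪T (u' - ⟨u, h⟩), T (u' - ⟨u, h⟩)⟫_ℂ +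
        t * ⟪((u' - ⟨u, h⟩ : D) : H), ((u' - ⟨u, h⟩ : D) : H)⟫_ℂ = 0 := by
      set z := u' - ⟨u, h⟩ with hz
      have hz1 : T z = T u' - T ⟨u, h⟩ := by rw [hz, map_sub]
      have hz2 : (z : H) = (u' : H) - (u : H) := rfl
      have e1 : ⟪T z, T z⟫_ℂ = ⟪T u', T z⟫_ℂ - ⟪T ⟨u, h⟩, T z⟫_ℂ := by
        rw [← inner_sub_left, ← hz1]
      have e2 : ⟪(z : H), (z : H)⟫_ℂ = ⟪(u' : H), (z : H)⟫_ℂ - ⟪(u : H), (z : H)⟫_ℂ := by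
        rw [← inner_sub_left, ← hz2]
      rw [e1, e2]
      linear_combination h1
    rw [inner_self_eq_ofReal, inner_self_eq_ofReal] at h3
    have h4 : ‖T (u' - ⟨u, h⟩)‖ ^ 2 + t * ‖((u' - ⟨u, h⟩ : D) : H)‖ ^ 2 = 0 := by
      exact_mod_cast h3
    have h5 : ‖((u' - ⟨u, h⟩ : D) : H)‖ ^ 2 = 0 := by
      have h6 := sq_nonneg ‖T (u' - ⟨u, h⟩)‖
      have h7 := sq_nonneg ‖((u' - ⟨u, h⟩ : D) : H)‖
      nlinarith
    have h6 := norm_eq_zero.1 (pow_eq_zero_iff two_ne_zero |>.1 h5)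
    exact sub_eq_zero.1 h6

/-- Resolvent comparison by a Schur complement: if the form `‖T u‖²` couples the unit vector `e`
to `eᗮ` with strength `B`, is bounded below by `k²` on `eᗮ`, and takes at `e` a value close to
`lam`, then the solution `u` of `A u + t u = f` is close to `(lam + t)⁻¹ ⟪e, f⟫ e`. -/
theorem norm_weakSolution_sub_le {D : Submodule ℂ H} (T : D →ₗ[ℂ] G) {e : D}
    (he : ‖(e : H)‖ = 1) {t k B n lam Δ : ℝ} (ht : 0 < t) (hk : 0 < k) (hB : 0 ≤ B) (hn : 0 < n)
    (hlam : 0 ≤ lam)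
    (hcouple : ∀ w : D, ⟪(e : H), (w : H)⟫_ℂ = 0 → ‖⟪T e, T w⟫_ℂ‖ ≤ B * ‖T w‖)
    (hgap : ∀ w : D, ⟪(e : H), (w : H)⟫_ℂ = 0 → k * ‖(w : H)‖ ≤ ‖T w‖)
    (hlow : ∀ u : D, n * ‖(u : H)‖ ^ 2 ≤ ‖T u‖ ^ 2 + t * ‖(u : H)‖ ^ 2)
    (hmean : |‖T e‖ ^ 2 - lam| ≤ Δ) {u : D} {f : H}
    (hu : ∀ v : D, ⟪T u, T v⟫_ℂ + t * ⟪(u : H), (v : H)⟫_ℂ = ⟪f, (v : H)⟫_ℂ) :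
    ‖(u : H) - (((lam + t)⁻¹ : ℝ) : ℂ) • ⟪(e : H), f⟫_ℂ • (e : H)‖ ≤
      (((Δ + B ^ 2) / n + B / k) / (lam + t) + (B / n + 1 / k) / k) * ‖f‖ := by
  have hlt : 0 < lam + t := by positivity
  set c : ℂ := ⟪(e : H), (u : H)⟫_ℂ with hc
  set w : D := u - c • e with hw
  have hee : ⟪(e : H), (e : H)⟫_ℂ = 1 := by
    rw [inner_self_eq_ofReal, he]; simp
  have hew : ⟪(e : H), (w : H)⟫_ℂ = 0 := by
    rw [hw, Submodule.coe_sub, Submodule.coe_smul, inner_sub_right, inner_smul_right, hee, hc]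
    ring
  have hsplit : u = c • e + w := by rw [hw]; abel
  have hsplitH : (u : H) = c • (e : H) + (w : H) := by
    conv_lhs => rw [hsplit]
    rfl
  have hue : ⟪(u : H), (e : H)⟫_ℂ = conj c := by rw [hc, inner_conj_symm]
  have huw : ⟪(u : H), (w : H)⟫_ℂ = ((‖(w : H)‖ ^ 2 : ℝ) : ℂ) := by
    rw [hsplitH, inner_add_left, inner_smul_left, hew, mul_zero, zero_add,
      inner_self_eq_ofReal]
  have hTsplit : T u = c • T e + T w := by
    conv_lhs => rw [hsplit]
    rw [map_add, map_smul]
  -- the a priori bound for the full solution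
  have hnorm : n * ‖(u : H)‖ ≤ ‖f‖ := by
    have h1 := hu u
    rw [inner_self_eq_ofReal, inner_self_eq_ofReal] at h1
    have h2 : ‖⟪f, (u : H)⟫_ℂ‖ = ‖T u‖ ^ 2 + t * ‖(u : H)‖ ^ 2 := by
      rw [← h1, ← Complex.ofReal_mul, ← Complex.ofReal_add, Complex.norm_real, Real.norm_of_nonneg (by positivity)]
    have h3 := norm_inner_le_norm (𝕜 := ℂ) f (u : H)
    have h4 := hlow u
    rcases (norm_nonneg (u : H)).eq_or_lt with h0 | h0
    · rw [← h0, mul_zero]; positivity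
    · refine le_of_mul_le_mul_right ?_ h0
      nlinarith
  have hcu : ‖c‖ ≤ ‖(u : H)‖ := by
    have := norm_inner_le_norm (𝕜 := ℂ) (e : H) (u : H)
    rwa [he, one_mul] at this
  have hcn : ‖c‖ ≤ ‖f‖ / n := by
    rw [le_div_iff₀ hn]; nlinarith
  -- testing with `w`
  have hTw : ‖T w‖ ≤ B * ‖c‖ + ‖f‖ / k := by
    have h1 := hu w
    rw [huw, hTsplit, inner_add_left, inner_smul_left, inner_self_eq_ofReal] at h1
    have h2 : ((‖T w‖ ^ 2 + t * ‖(w : H)‖ ^ 2 : ℝ) : ℂ) =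
        ⟪f, (w : H)⟫_ℂ - conj c * ⟪T e, T w⟫_ℂ := by
      rw [← h1]; push_cast; ring
    have h3 := congrArg norm h2
    rw [Complex.norm_real, Real.norm_of_nonneg (by positivity)] at h3
    have h4 := norm_sub_le ⟪f, (w : H)⟫_ℂ (conj c * ⟪T e, T w⟫_ℂ)
    rw [norm_mul, RCLike.norm_conj] at h4
    have h5 := norm_inner_le_norm (𝕜 := ℂ) f (w : H)
    have h6 := hcouple w hew
    have h7 := hgap w hew
    have h8 : ‖(w : H)‖ ≤ ‖T w‖ / k := by rw [le_div_iff₀ hk]; linarith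
    have h9 : ‖T w‖ ^ 2 ≤ (B * ‖c‖ + ‖f‖ / k) * ‖T w‖ := by
      have ha : ‖f‖ * ‖(w : H)‖ ≤ ‖f‖ * (‖T w‖ / k) := by gcongr
      have hb : ‖c‖ * ‖⟪T e, T w⟫_ℂ‖ ≤ ‖c‖ * (B * ‖T w‖) := by gcongr
      have hc : 0 ≤ t * ‖(w : H)‖ ^ 2 := by positivity
      have hd : (B * ‖c‖ + ‖f‖ / k) * ‖T w‖ = ‖c‖ * (B * ‖T w‖) + ‖f‖ * (‖T w‖ / k) := by ring
      linarith
    rcases (norm_nonneg (T w)).eq_or_lt with h0 | h0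
    · rw [← h0]; positivity
    · refine le_of_mul_le_mul_right ?_ h0
      nlinarith
  have hTw' : ‖T w‖ ≤ (B / n + 1 / k) * ‖f‖ := by
    have : B * ‖c‖ ≤ B * (‖f‖ / n) := by gcongr
    calc _ ≤ _ := hTw
      _ ≤ B * (‖f‖ / n) + ‖f‖ / k := by linarith
      _ = _ := by ring
  have hwn : ‖(w : H)‖ ≤ (B / n + 1 / k) / k * ‖f‖ := by
    have h7 := hgap w hew
    rw [div_mul_eq_mul_div, le_div_iff₀ hk]
    linarith
  -- testing with `e`
  have hcoef : ‖c - (((lam + t)⁻¹ : ℝ) : ℂ) * ⟪(e : H), f⟫_ℂ‖ ≤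
      ((Δ + B ^ 2) / n + B / k) / (lam + t) * ‖f‖ := by
    have h1 := congrArg conj (hu e)
    rw [hue, hTsplit, inner_add_left, inner_smul_left, inner_self_eq_ofReal] at h1
    simp only [map_add, map_mul, Complex.conj_conj, inner_conj_symm, Complex.conj_ofReal] at h1
    have h2 : ((lam + t : ℝ) : ℂ) * (c - (((lam + t)⁻¹ : ℝ) : ℂ) * ⟪(e : H), f⟫_ℂ) =
        -(c * ((‖T e‖ ^ 2 - lam : ℝ) : ℂ)) - ⟪T e, T w⟫_ℂ := by
      rw [mul_sub, ← mul_assoc, ← Complex.ofReal_mul, mul_inv_cancel₀ hlt.ne', ← h1]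
      push_cast
      ring
    have h3 := congrArg norm h2
    rw [norm_mul, Complex.norm_real, Real.norm_of_nonneg hlt.le] at h3
    have h4 := norm_sub_le (-(c * ((‖T e‖ ^ 2 - lam : ℝ) : ℂ))) ⟪T e, T w⟫_ℂ
    rw [norm_neg, norm_mul, Complex.norm_real, Real.norm_eq_abs] at h4
    have h5 : ‖c‖ * |‖T e‖ ^ 2 - lam| ≤ ‖f‖ / n * Δ := by gcongr
    have h6 : ‖⟪T e, T w⟫_ℂ‖ ≤ B * ((B / n + 1 / k) * ‖f‖) :=
      (hcouple w hew).trans (by gcongr)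
    rw [div_mul_eq_mul_div, le_div_iff₀ hlt, mul_comm, h3]
    refine h4.trans ((add_le_add h5 h6).trans (le_of_eq ?_))
    field_simp
    ring
  have hfin : (u : H) - (((lam + t)⁻¹ : ℝ) : ℂ) • ⟪(e : H), f⟫_ℂ • (e : H) =
      (c - (((lam + t)⁻¹ : ℝ) : ℂ) * ⟪(e : H), f⟫_ℂ) • (e : H) + (w : H) := by
    rw [hsplitH, sub_smul, mul_smul]; abel
  rw [hfin]
  refine (norm_add_le _ _).trans ?_
  rw [norm_smul, he, mul_one, add_mul]
  exact add_le_add hcoef hwn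

end Abstract

/-! ### Integration of periodic functions over the cell -/

lemma setLIntegral_cell_shift {d : ℕ} {f : Space d → ENNReal}
    (hf : ∀ n x, f (x + latticeVec n) = f x) (z : Space d) :
    ∫⁻ x in cell d, f (x - z) = ∫⁻ x in cell d, f x := by
  have hF := ZSpan.isAddFundamentalDomain (EuclideanSpace.basisFun (Fin d) ℝ).toBasis
    (volume : Measure (Space d))
  rw [← cell_eq] at hF
  have : VAddInvariantMeasure
      (Submodule.span ℤ (range (EuclideanSpace.basisFun (Fin d) ℝ).toBasis)) (Space d) volume :=
    inferInstanceAs <| VAddInvariantMeasure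
      (Submodule.span ℤ (range (EuclideanSpace.basisFun (Fin d) ℝ).toBasis)).toAddSubgroup
      (Space d) volume
  have : MeasurableConstVAdd
      (Submodule.span ℤ (range (EuclideanSpace.basisFun (Fin d) ℝ).toBasis)) (Space d) :=
    inferInstanceAs <| MeasurableConstVAdd
      (Submodule.span ℤ (range (EuclideanSpace.basisFun (Fin d) ℝ).toBasis)).toAddSubgroup
      (Space d)
  have hG := hF.vadd_of_comm (-z)
  have h1 := hG.setLIntegral_eq hF f ?_
  · have h2 := (measurePreserving_sub_right (volume : Measure (Space d))
      z).setLIntegral_comp_preimage_emb (MeasurableEquiv.subRight z).measurableEmbedding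
      f (-z +ᵥ cell d)
    have h3 : (fun x => x - z) ⁻¹' (-z +ᵥ cell d) = cell d := by
      ext x; simp [mem_vadd_set_iff_neg_vadd_mem]
    rw [h3] at h2
    rw [← h1, ← h2]
  · rintro ⟨g, hg⟩ x
    obtain ⟨n, rfl⟩ : ∃ n : Fin d → ℤ, latticeVec n = g := by
      obtain ⟨n, hn⟩ := (Submodule.mem_span_range_iff_exists_fun ℤ).1 hg
      refine ⟨n, ?_⟩
      rw [← hn]
      ext i
      simp [latticeVec, Finset.sum_apply, Pi.single_apply]
    simp only [Submodule.vadd_def, vadd_eq_add]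
    rw [add_comm, hf]

/-- Translations of the torus `ℝ^d / ℤ^d`, read in the cell, preserve the Lebesgue measure. -/
lemma measurePreserving_toCell_sub {d : ℕ} (z : Space d) :
    MeasurePreserving (fun x : Space d => toCell (x - z))
      ((volume : Measure (Space d)).restrict (cell d)) (volume.restrict (cell d)) := by
  have hm : Measurable fun x : Space d => toCell (x - z) := measurable_toCell.comp (by fun_prop)
  refine ⟨hm, Measure.ext fun s hs => ?_⟩
  have h := setLIntegral_cell_shift (f := fun x : Space d => s.indicator 1 (toCell x))
    (fun n x => by simp only [toCell_add]) z
  rw [Measure.map_apply hm hs, ← lintegral_indicator_one hs, ← lintegral_indicator_one (hm hs)]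
  refine Eq.trans ?_ (h.trans ?_)
  · rfl
  · exact setLIntegral_congr_fun (measurableSet_cell d) fun x hx => by rw [toCell_of_mem hx]

lemma integral_toCell_sub {d : ℕ} {F : Type*} [NormedAddCommGroup F] [NormedSpace ℝ F]
    {f : Space d → F} (hf : AEStronglyMeasurable f (volume.restrict (cell d))) (z : Space d) :
    ∫ x in cell d, f (toCell (x - z)) = ∫ x in cell d, f x := by
  have h := measurePreserving_toCell_sub z
  rw [← h.map_eq] at hf
  rw [← integral_map h.measurable.aemeasurable hf, h.map_eq]

lemma integral_toCell_add {d : ℕ} {F : Type*} [NormedAddCommGroup F] [NormedSpace ℝ F]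
    {f : Space d → F} (hf : AEStronglyMeasurable f (volume.restrict (cell d))) (z : Space d) :
    ∫ x in cell d, f (toCell (x + z)) = ∫ x in cell d, f x := by
  simpa using integral_toCell_sub hf (-z)

/-- Substitution `z = x - y` in integrals over `Ω × ℝ^d`. -/
lemma measurePreserving_fst_sub (d : ℕ) :
    MeasurePreserving (fun p : Space d × Space d => (p.1, p.1 - p.2)) (cellProd d) (cellProd d) :=
  (MeasurePreserving.id _).skew_product (by fun_prop)
    (Filter.Eventually.of_forall fun x => (Measure.measurePreserving_sub_left volume x).map_eq)

/-- The cell is a product of intervals under the identification of `ℝ^d` with `Fin d → ℝ`. -/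
lemma measurePreserving_ofLp_cell (d : ℕ) :
    MeasurePreserving (MeasurableEquiv.toLp 2 (Fin d → ℝ)).symm
      ((volume : Measure (Space d)).restrict (cell d))
      (Measure.pi fun _ => volume.restrict (Ico (0 : ℝ) 1)) := by
  have h := (EuclideanSpace.volume_preserving_symm_measurableEquiv_toLp (Fin d)).restrict_preimage
    (s := univ.pi fun _ => Ico (0 : ℝ) 1) (MeasurableSet.univ_pi fun _ => measurableSet_Ico)
  have h1 : (MeasurableEquiv.toLp 2 (Fin d → ℝ)).symm ⁻¹' (univ.pi fun _ => Ico (0 : ℝ) 1) =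
      cell d := by
    ext x; simp [cell]
  rw [h1, volume_pi, Measure.restrict_pi_pi] at h
  exact h

lemma volume_cell (d : ℕ) : volume (cell d) = 1 := by
  have h := (measurePreserving_ofLp_cell d).measure_preimage MeasurableSet.univ.nullMeasurableSet
  have h1 : Measure.pi (fun _ : Fin d => volume.restrict (Ico (0 : ℝ) 1)) univ = 1 := by
    rw [Measure.pi_univ]; simp
  simpa [h1] using h

instance (d : ℕ) : IsProbabilityMeasure ((volume : Measure (Space d)).restrict (cell d)) :=
  ⟨by simpa using volume_cell d⟩

lemma norm_integral_exp_Ico_ge {θ : ℝ} (hθ : |θ| ≤ Real.pi) :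
    2 / Real.pi ≤ ‖∫ t in Ico (0 : ℝ) 1, Complex.exp (Complex.I * (θ * t : ℝ))‖ := by
  rcases eq_or_ne θ 0 with rfl | h0
  · simp
    rw [div_le_one Real.pi_pos]; exact Real.two_le_pi
  have hc : Complex.I * θ ≠ 0 := mul_ne_zero Complex.I_ne_zero (Complex.ofReal_ne_zero.2 h0)
  have h1 : ∫ t in Ico (0 : ℝ) 1, Complex.exp (Complex.I * (θ * t : ℝ)) =
      (Complex.exp (Complex.I * θ) - 1) / (Complex.I * θ) := by
    rw [integral_Ico_eq_integral_Ioc, ← intervalIntegral.integral_of_le zero_le_one]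
    have := integral_exp_mul_complex (a := 0) (b := 1) hc
    simp only [Complex.ofReal_one, Complex.ofReal_zero, mul_zero, mul_one, Complex.exp_zero] at this
    rw [← this]
    congr 1; ext t; push_cast; ring_nf
  have hθ' : 0 < |θ| := abs_pos.2 h0
  rw [h1, norm_div, Complex.norm_exp_I_mul_ofReal_sub_one, norm_mul, norm_mul Complex.I,
    Complex.norm_I, one_mul,
    Complex.norm_real, Real.norm_two, Real.norm_eq_abs, Real.norm_eq_abs, le_div_iff₀ hθ']
  have h2 : |Real.sin (θ / 2)| = Real.sin (|θ| / 2) := by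
    rcases le_total 0 θ with h | h
    · rw [abs_of_nonneg h, abs_of_nonneg]
      rw [abs_of_nonneg h] at hθ
      exact Real.sin_nonneg_of_nonneg_of_le_pi (by linarith) (by linarith)
    · rw [abs_of_nonpos h] at hθ ⊢
      rw [neg_div, Real.sin_neg, abs_of_nonpos]
      have := Real.sin_nonneg_of_nonneg_of_le_pi (x := -θ / 2) (by linarith) (by linarith)
      rw [neg_div, Real.sin_neg] at this
      linarith
  rw [h2]
  have h3 := Real.mul_le_sin (x := |θ| / 2) (by positivity) (by linarith)
  linarith

/-- The mean over the cell of the character `e^{i⟨ξ,x⟩}` stays away from zero for `|ξ| ≤ π`. -/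
lemma norm_integral_cell_exp_ge {d : ℕ} {ξ : Space d} (hξ : ‖ξ‖ ≤ Real.pi) :
    (2 / Real.pi) ^ d ≤ ‖∫ x in cell d, Complex.exp (Complex.I * (⟪ξ, x⟫_ℝ : ℝ))‖ := by
  have h := (measurePreserving_ofLp_cell d).integral_comp'
    (fun x : Fin d → ℝ => ∏ i, Complex.exp (Complex.I * (ξ i * x i : ℝ)))
  rw [integral_fintype_prod_eq_prod
    (f := fun i (t : ℝ) => Complex.exp (Complex.I * (ξ i * t : ℝ)))] at h
  have h1 : ∀ x : Space d, Complex.exp (Complex.I * (⟪ξ, x⟫_ℝ : ℝ)) =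
      ∏ i, Complex.exp (Complex.I *
        (ξ i * (MeasurableEquiv.toLp 2 (Fin d → ℝ)).symm x i : ℝ)) := fun x => by
    rw [← Complex.exp_sum, ← Finset.mul_sum, ← Complex.ofReal_sum, PiLp.inner_apply]
    simp [mul_comm]
  simp only [h1, h, norm_prod]
  calc (2 / Real.pi) ^ d = ∏ i : Fin d, 2 / Real.pi := by
        rw [Finset.prod_const, Finset.card_univ, Fintype.card_fin]
    _ ≤ _ := Finset.prod_le_prod (fun i _ => by positivity) fun i _ =>
      norm_integral_exp_Ico_ge ((PiLp.norm_apply_le ξ i).trans hξ)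

/-! ### The symbol and the kernel integrals -/

/-- The kernel `k(z) = (1 - cos⟨ξ,z⟩) / |z|^{d+α}` whose integral is the symbol `V_α(ξ)`. -/
def symbolKernel {d : ℕ} (α : ℝ) (ξ z : Space d) : ℝ :=
  (1 - Real.cos ⟪ξ, z⟫_ℝ) / ‖z‖ ^ (d + α)

/-- The density `min(1, |z|²) / |z|^{d+α}` of the truncated Lévy measure. -/
def levyDensity {d : ℕ} (α : ℝ) (z : Space d) : ℝ := min 1 (‖z‖ ^ 2) / ‖z‖ ^ (d + α)

/-- The contribution of the long jumps, of length at least `1`, to the coupling between constants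
and functions of zero mean, at distance `t` from the origin of the dual space. -/
def levyTail (d : ℕ) (α t : ℝ) : ℝ :=
  ∫ z in (Metric.ball (0 : Space d) 1)ᶜ, min 1 (t * ‖z‖) / ‖z‖ ^ (d + α)

/-- The size of the coupling between constants and functions of zero mean: short jumps contribute
`t`, long jumps `levyTail`. -/
def couplingSize (d : ℕ) (α t : ℝ) : ℝ := t + levyTail d α t

@[fun_prop]
lemma measurable_symbolKernel {d : ℕ} (α : ℝ) (ξ : Space d) : Measurable (symbolKernel α ξ) := by
  unfold symbolKernel; fun_prop

lemma symbolKernel_nonneg {d : ℕ} (α : ℝ) (ξ z : Space d) : 0 ≤ symbolKernel α ξ z :=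
  div_nonneg (by linarith [Real.cos_le_one ⟪ξ, z⟫_ℝ]) (by positivity)

lemma one_sub_cos_inner_le {d : ℕ} (ξ z : Space d) :
    1 - Real.cos ⟪ξ, z⟫_ℝ ≤ ‖ξ‖ ^ 2 * ‖z‖ ^ 2 / 2 := by
  have h1 := Real.one_sub_sq_div_two_le_cos (x := ⟪ξ, z⟫_ℝ)
  have h2 := abs_real_inner_le_norm ξ z
  have h3 := pow_le_pow_left₀ (abs_nonneg _) h2 2
  rw [sq_abs, mul_pow] at h3
  linarith

lemma symbolKernel_le_levy {d : ℕ} (α : ℝ) (ξ z : Space d) :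
    symbolKernel α ξ z ≤ (2 + ‖ξ‖ ^ 2) * levyDensity α z := by
  unfold symbolKernel levyDensity
  rw [← mul_div_assoc]
  gcongr
  have h1 := one_sub_cos_inner_le ξ z
  have h2 := Real.neg_one_le_cos ⟪ξ, z⟫_ℝ
  rcases le_total 1 (‖z‖ ^ 2) with h | h
  · rw [min_eq_left h]; nlinarith [sq_nonneg ‖ξ‖]
  · rw [min_eq_right h]; nlinarith [sq_nonneg ‖ξ‖, mul_nonneg (sq_nonneg ‖ξ‖) (sq_nonneg ‖z‖)]

lemma integrable_symbolKernel {d : ℕ} [NeZero d] {α : ℝ} (h0 : 0 < α) (h2 : α < 2) (ξ : Space d) :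
    Integrable (symbolKernel α ξ) := by
  refine ((integrable_levy (d := d) h0 h2).const_mul (2 + ‖ξ‖ ^ 2)).mono'
    (measurable_symbolKernel α ξ).aestronglyMeasurable (Filter.Eventually.of_forall fun z => ?_)
  rw [Real.norm_of_nonneg (symbolKernel_nonneg _ _ _)]
  exact symbolKernel_le_levy α ξ z

lemma integrableOn_near {d : ℕ} [NeZero d] {α : ℝ} (h0 : 0 < α) (h2 : α < 2) (r : ℝ) :
    IntegrableOn (fun z : Space d => ‖z‖ ^ 2 / ‖z‖ ^ (d + α)) (Metric.ball 0 r) := by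
  refine (((integrable_levy (d := d) h0 h2).const_mul (1 + r ^ 2)).integrableOn).mono'
    (by fun_prop : Measurable _).aestronglyMeasurable
    (ae_restrict_of_forall_mem measurableSet_ball fun z hz => ?_)
  rw [Real.norm_of_nonneg (by positivity), ← mul_div_assoc]
  gcongr
  have hz : ‖z‖ < r := by simpa using hz
  have := pow_le_pow_left₀ (norm_nonneg z) hz.le 2
  rcases le_total 1 (‖z‖ ^ 2) with h | h
  · rw [min_eq_left h]; linarith
  · rw [min_eq_right h]; nlinarith [sq_nonneg ‖z‖, sq_nonneg r]

/-- The part of the symbol due to bounded jumps is quadratic in `ξ`. -/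
lemma integral_symbolKernel_ball_le {d : ℕ} [NeZero d] {α : ℝ} (h0 : 0 < α) (h2 : α < 2) (r : ℝ)
    (ξ : Space d) : ∫ z in Metric.ball 0 r, symbolKernel α ξ z ≤
      (∫ z in Metric.ball (0 : Space d) r, ‖z‖ ^ 2 / ‖z‖ ^ (d + α)) * ‖ξ‖ ^ 2 := by
  rw [← integral_mul_const]
  refine integral_mono (integrable_symbolKernel h0 h2 ξ).integrableOn
    ((integrableOn_near h0 h2 r).mul_const _) fun z => ?_
  simp only [symbolKernel]
  rw [div_mul_eq_mul_div]
  gcongr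
  have := one_sub_cos_inner_le ξ z
  nlinarith [mul_nonneg (sq_nonneg ‖ξ‖) (sq_nonneg ‖z‖)]

lemma integral_symbolKernel {d : ℕ} [NeZero d] {α : ℝ} (h0 : 0 < α) (ξ : Space d) :
    ∫ z, symbolKernel α ξ z = symbolV α ξ := by
  rcases eq_or_ne ξ 0 with rfl | hξ
  · simp [symbolKernel, symbolV, Real.zero_rpow h0.ne']
  have ht : 0 < ‖ξ‖ := norm_pos_iff.2 hξ
  set t := ‖ξ‖ with ht_def
  set e₀ : Space d := EuclideanSpace.single 0 1
  have hnorm : ‖t • e₀‖ = ‖ξ‖ := by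
    rw [norm_smul, PiLp.norm_single, norm_one, mul_one, Real.norm_of_nonneg ht.le]
  set f := Submodule.reflection (ℝ ∙ (t • e₀ - ξ))ᗮ
  have hf : f (t • e₀) = ξ := Submodule.reflection_sub hnorm
  have h1 : ∫ z, symbolKernel α ξ z = ∫ z, symbolKernel α ξ (f z) :=
    (f.measurePreserving.integral_comp f.toMeasurableEquiv.measurableEmbedding _).symm
  set g : Space d → ℝ := fun z => (1 - Real.cos (z 0)) / ‖z‖ ^ (d + α) with hg
  have h3 : ∀ z, symbolKernel α ξ (f z) = t ^ (d + α) * g (t • z) := fun z => by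
    have hin : ⟪ξ, f z⟫_ℝ = t * z 0 := by
      rw [← hf, LinearIsometryEquiv.inner_map_map, real_inner_smul_left]
      simp [e₀, EuclideanSpace.inner_single_left]
    have hpow : ‖t • z‖ ^ (d + α) = t ^ (d + α) * ‖z‖ ^ (d + α) := by
      rw [norm_smul, Real.norm_of_nonneg ht.le, Real.mul_rpow ht.le (norm_nonneg _)]
    have htp : t ^ (d + α) ≠ 0 := (Real.rpow_pos_of_pos ht _).ne'
    simp only [symbolKernel, hg]
    rw [hin, LinearIsometryEquiv.norm_map, hpow, PiLp.smul_apply, smul_eq_mul, mul_div_assoc',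
      mul_div_mul_left _ _ htp]
  rw [h1]
  simp only [h3]
  rw [integral_const_mul, Measure.integral_comp_smul, finrank_euclideanSpace, Fintype.card_fin,
    abs_of_nonneg (by positivity), symbolV, c₀, smul_eq_mul, Real.rpow_add ht, Real.rpow_natCast]
  field_simp
  rw [mul_comm]

lemma c₀_pos {d : ℕ} [NeZero d] {α : ℝ} (h0 : 0 < α) (h2 : α < 2) : 0 < c₀ d α := by
  set e₀ : Space d := EuclideanSpace.single 0 1
  have hin : ∀ z : Space d, ⟪e₀, z⟫_ℝ = z 0 := fun z => by
    simp [e₀, EuclideanSpace.inner_single_left]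
  have hk : c₀ d α = ∫ z, symbolKernel α e₀ z := by
    simp only [c₀, symbolKernel, hin]
  rw [hk, integral_pos_iff_support_of_nonneg (symbolKernel_nonneg α e₀)
    (integrable_symbolKernel h0 h2 e₀)]
  have hopen : IsOpen {z : Space d | 0 < z 0 ∧ z 0 < 1} := by
    have : Continuous fun z : Space d => z 0 := by fun_prop
    exact (isOpen_lt continuous_const this).inter (isOpen_lt this continuous_const)
  refine (hopen.measure_pos volume ⟨(2⁻¹ : ℝ) • e₀, ?_⟩).trans_le (measure_mono fun z hz => ?_)
  · simp only [mem_ofPred_eq, PiLp.smul_apply, e₀, PiLp.single_apply, smul_eq_mul]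
    norm_num
  · have hz1 : 0 < z 0 := hz.1
    have hz2 : z 0 < 1 := hz.2
    have hz0 : z ≠ 0 := fun h => by simp [h] at hz1
    have : Real.cos (z 0) < 1 := by
      rw [← Real.cos_zero]
      exact Real.cos_lt_cos_of_nonneg_of_le_pi_div_two le_rfl
        (by linarith [Real.two_le_pi]) hz1
    rw [Function.mem_support, symbolKernel, hin]
    exact (div_pos (by linarith) (Real.rpow_pos_of_pos (norm_pos_iff.2 hz0) _)).ne'

lemma symbolV_nonneg {d : ℕ} [NeZero d] {α : ℝ} (h0 : 0 < α) (h2 : α < 2) (ξ : Space d) :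
    0 ≤ symbolV α ξ := mul_nonneg (c₀_pos h0 h2).le (by positivity)

lemma integrableOn_levyTail {d : ℕ} [NeZero d] {α : ℝ} (h0 : 0 < α) (h2 : α < 2) {t : ℝ}
    (ht : 0 ≤ t) : IntegrableOn (fun z : Space d => min 1 (t * ‖z‖) / ‖z‖ ^ (d + α))
      (Metric.ball 0 1)ᶜ := by
  refine (integrable_levy (d := d) h0 h2).integrableOn.mono'
    (by fun_prop : Measurable _).aestronglyMeasurable
    (ae_restrict_of_forall_mem measurableSet_ball.compl fun z hz => ?_)
  have hz : 1 ≤ ‖z‖ := by simpa using hz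
  rw [Real.norm_of_nonneg (by positivity), min_eq_left (one_le_pow₀ hz)]
  gcongr
  exact min_le_left _ _

lemma levyTail_nonneg {d : ℕ} {α t : ℝ} (ht : 0 ≤ t) : 0 ≤ levyTail d α t :=
  integral_nonneg fun z => by positivity

lemma integral_compl_ball_rpow {d : ℕ} [NeZero d] {s : ℝ} (hs : 0 < s) :
    ∫ z in (Metric.ball (0 : Space d) 1)ᶜ, (‖z‖ ^ (d + s))⁻¹ =
      d * volume.real (Metric.ball (0 : Space d) 1) / s := by
  have hd : 1 ≤ d := NeZero.one_le
  have h1 := integral_fun_norm_addHaar (volume : Measure (Space d))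
    ((Ici (1 : ℝ)).indicator fun r => (r ^ (d + s))⁻¹)
  rw [← integral_indicator measurableSet_ball.compl]
  have h2 : ∀ z : Space d, (Metric.ball (0 : Space d) 1)ᶜ.indicator
      (fun z => (‖z‖ ^ (d + s))⁻¹) z = (Ici (1 : ℝ)).indicator (fun r => (r ^ (d + s))⁻¹) ‖z‖ := by
    intro z
    by_cases hz : 1 ≤ ‖z‖
    · rw [indicator_of_mem (by simpa using hz), indicator_of_mem (by simpa using hz)]
    · rw [indicator_of_notMem (by simpa using hz), indicator_of_notMem (by simpa using hz)]
  simp only [h2, h1, finrank_euclideanSpace, Fintype.card_fin]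
  have h3 : ∫ y in Ioi (0 : ℝ), y ^ (d - 1) • (Ici (1 : ℝ)).indicator (fun r => (r ^ (d + s))⁻¹) y =
      ∫ y in Ioi (1 : ℝ), y ^ (-1 - s) := by
    rw [← integral_Ici_eq_integral_Ioi (x := (1 : ℝ)), ← integral_indicator measurableSet_Ioi,
      ← integral_indicator measurableSet_Ici]
    congr 1
    ext y
    by_cases hy : 1 ≤ y
    · have hy0 : 0 < y := by linarith
      rw [indicator_of_mem (show y ∈ Ioi (0 : ℝ) from hy0), indicator_of_mem (show y ∈ Ici _ from hy),
        indicator_of_mem (show y ∈ Ici _ from hy), smul_eq_mul, ← Real.rpow_natCast,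
        ← Real.rpow_neg hy0.le, ← Real.rpow_add hy0, Nat.cast_sub hd]
      congr 1
      push_cast; ring
    · rw [indicator_of_notMem (s := Ici (1 : ℝ)) (by simpa using hy), indicator_apply,
        indicator_of_notMem (s := Ici (1 : ℝ)) (by simpa using hy)]
      simp
  rw [h3, integral_Ioi_rpow_of_lt (by linarith) one_pos, Real.one_rpow, nsmul_eq_mul, smul_eq_mul,
    show -1 - s + 1 = -s by ring, neg_div_neg_eq]
  ring

/-- The bound `min(1, t|z|) ≤ (t|z|)^θ` gives a power bound for the tail, with an explicit
dependence on `θ`, which may therefore be optimized. -/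
lemma levyTail_le_rpow {d : ℕ} [NeZero d] {α t θ : ℝ} (h0 : 0 < α) (h2 : α < 2) (ht : 0 ≤ t)
    (hθ0 : 0 ≤ θ) (hθ1 : θ ≤ 1) (hθ : θ < α) :
    levyTail d α t ≤ d * volume.real (Metric.ball (0 : Space d) 1) / (α - θ) * t ^ θ := by
  rw [← integral_compl_ball_rpow (sub_pos.2 hθ), levyTail, ← integral_mul_const]
  refine setIntegral_mono_on (integrableOn_levyTail h0 h2 ht) (Integrable.mul_const ?_ _)
    measurableSet_ball.compl fun z hz => ?_
  · refine (integrable_levy (d := d) (α := α - θ) (sub_pos.2 hθ) (by linarith)).integrableOn.mono'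
      (by fun_prop : Measurable _).aestronglyMeasurable
      (ae_restrict_of_forall_mem measurableSet_ball.compl fun z hz => ?_)
    have hz : 1 ≤ ‖z‖ := by simpa using hz
    rw [Real.norm_of_nonneg (by positivity), min_eq_left (one_le_pow₀ hz), one_div]
  · have hz : 1 ≤ ‖z‖ := by simpa using hz
    have hz0 : 0 < ‖z‖ := by linarith
    have hx : 0 ≤ t * ‖z‖ := by positivity
    have hmin : min 1 (t * ‖z‖) ≤ t ^ θ * ‖z‖ ^ θ := by
      rw [← Real.mul_rpow ht hz0.le]
      rcases le_total 1 (t * ‖z‖) with h | h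
      · rw [min_eq_left h]; exact Real.one_le_rpow h hθ0
      · rw [min_eq_right h]
        exact Real.self_le_rpow_of_le_one hx h hθ1
    rw [div_le_iff₀ (by positivity)]
    refine hmin.trans (le_of_eq ?_)
    rw [← Real.rpow_neg hz0.le, mul_right_comm, ← Real.rpow_add hz0, mul_comm]
    congr 2
    ring

/-- For `α < 1` the tail scales like the symbol. -/
lemma levyTail_le_of_lt_one {d : ℕ} [NeZero d] {α t : ℝ} (h0 : 0 < α) (h1 : α < 1) (ht : 0 ≤ t) :
    levyTail d α t ≤ (∫ z : Space d, min 1 ‖z‖ / ‖z‖ ^ (d + α)) * t ^ α := by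
  rcases ht.eq_or_lt with rfl | ht'
  · simp [levyTail, Real.zero_rpow h0.ne']
  set g : Space d → ℝ := fun z => min 1 ‖z‖ / ‖z‖ ^ (d + α) with hg
  have hint : Integrable g := by
    refine ((integrable_levy (d := d) h0 (by linarith)).add
      (integrable_levy (d := d) (α := α + 1) (by linarith) (by linarith))).mono'
      (by fun_prop : Measurable _).aestronglyMeasurable (Filter.Eventually.of_forall fun z => ?_)
    rw [Real.norm_of_nonneg (by positivity)]
    simp only [hg, Pi.add_apply]
    have e1 : 0 ≤ min 1 (‖z‖ ^ 2) / ‖z‖ ^ (d + α) := by positivity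
    have e2 : 0 ≤ min 1 (‖z‖ ^ 2) / ‖z‖ ^ (d + (α + 1)) := by positivity
    rcases le_total 1 ‖z‖ with h | h
    · rw [min_eq_left h]
      rw [min_eq_left (one_le_pow₀ h)] at e2 ⊢
      linarith
    · rcases (norm_nonneg z).eq_or_lt with hz | hz
      · rw [← hz]; simp
      · have e3 : min 1 ‖z‖ / ‖z‖ ^ (d + α) = min 1 (‖z‖ ^ 2) / ‖z‖ ^ (d + (α + 1)) := by
          rw [min_eq_right h, min_eq_right (pow_le_one₀ hz.le h), ← add_assoc,
            Real.rpow_add_one hz.ne']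
          field_simp
        rw [e3]; linarith
  have h3 : ∀ z : Space d, min 1 (t * ‖z‖) / ‖z‖ ^ (d + α) = t ^ (d + α) * g (t • z) := fun z => by
    have htp : t ^ (d + α) ≠ 0 := (Real.rpow_pos_of_pos ht' _).ne'
    simp only [hg]
    rw [norm_smul, Real.norm_of_nonneg ht, Real.mul_rpow ht (norm_nonneg _), mul_div_assoc',
      mul_div_mul_left _ _ htp]
  have h4 : ∫ z : Space d, t ^ (d + α) * g (t • z) = (∫ z, g z) * t ^ α := by
    rw [integral_const_mul, Measure.integral_comp_smul, finrank_euclideanSpace, Fintype.card_fin,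
      abs_of_nonneg (by positivity), smul_eq_mul, Real.rpow_add ht', Real.rpow_natCast]
    field_simp
  rw [← h4, levyTail]
  simp only [h3]
  exact setIntegral_le_integral ((hint.comp_smul ht'.ne').const_mul _)
    (Filter.Eventually.of_forall fun z => by simp only [hg]; positivity)

/-- The square root of the error bound. -/
def errorRoot (α ε : ℝ) : ℝ :=
  if α < 1 then 1 else if α = 1 then 1 + |Real.log ε| else ε ^ (1 - α)

lemma errorRoot_sq {α ε : ℝ} (hε : 0 < ε) : errorRoot α ε ^ 2 = errorBound α ε := by
  unfold errorRoot errorBound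
  split_ifs
  · norm_num
  · rfl
  · rw [← Real.rpow_natCast, ← Real.rpow_mul hε.le]
    congr 1
    push_cast; ring

lemma one_le_errorRoot {α ε : ℝ} (hε : 0 < ε) (hε1 : ε ≤ 1) : 1 ≤ errorRoot α ε := by
  unfold errorRoot
  split_ifs with h1 h2
  · exact le_rfl
  · linarith [abs_nonneg (Real.log ε)]
  · exact Real.one_le_rpow_of_pos_of_le_one_of_nonpos hε hε1 (by linarith [not_lt.1 h1])

/-- The coupling is dominated by the symbol plus `ε^α`, up to the square root of the error bound.
For `α = 1` the tail is estimated by `t^θ / (1 - θ)` with `1 - θ = 1 / (1 + |ln ε|)`: this choice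
costs only a bounded factor in the power and the factor `1 + |ln ε|` in front of it. -/
lemma exists_couplingSize_le (d : ℕ) [NeZero d] {α : ℝ} (h0 : 0 < α) (h2 : α < 2) :
    ∃ C : ℝ, 0 < C ∧ ∀ t ε : ℝ, 0 ≤ t → t ≤ Real.pi → 0 < ε → ε ≤ 1 →
      couplingSize d α t ≤ C * errorRoot α ε * (t ^ α + ε ^ α) := by
  set S : ℝ := d * volume.real (Metric.ball (0 : Space d) 1) with hS
  have hS0 : 0 ≤ S := by positivity
  rcases lt_trichotomy α 1 with h1 | h1 | h1
  · set J := ∫ z : Space d, min 1 ‖z‖ / ‖z‖ ^ (d + α)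
    have hJ : 0 ≤ J := integral_nonneg fun z => by positivity
    refine ⟨Real.pi ^ (1 - α) + J, by positivity, fun t ε ht htπ hε hε1 => ?_⟩
    have hle : t ≤ Real.pi ^ (1 - α) * t ^ α := by
      rcases ht.eq_or_lt with rfl | ht'
      · positivity
      calc t = t ^ (1 - α) * t ^ α := by
            rw [← Real.rpow_add ht', sub_add_cancel, Real.rpow_one]
        _ ≤ _ := by gcongr
    have htail := levyTail_le_of_lt_one (d := d) h0 h1 ht
    have hεα : 0 ≤ (Real.pi ^ (1 - α) + J) * ε ^ α := by positivity
    rw [couplingSize, errorRoot, if_pos h1, mul_one, mul_add, add_mul]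
    linarith
  · subst h1
    refine ⟨Real.pi + Real.exp 1 * S + 1, by positivity, fun t ε ht htπ hε hε1 => ?_⟩
    set L := |Real.log ε| with hL
    have hL0 : 0 ≤ L := abs_nonneg _
    set τ := 1 / (1 + L) with hτ
    have hτ0 : 0 < τ := by positivity
    have hτ1 : τ ≤ 1 := by rw [hτ, div_le_one (by positivity)]; linarith
    have htail := levyTail_le_rpow (d := d) (α := 1) (θ := 1 - τ) one_pos (by norm_num) ht
      (by linarith) (by linarith) (by linarith)
    have hpow : t ^ (1 - τ) ≤ Real.exp 1 * (t + ε) := by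
      calc t ^ (1 - τ) ≤ (t + ε) ^ (1 - τ) :=
            Real.rpow_le_rpow ht (by linarith) (by linarith)
        _ = (t + ε) ^ (-τ) * (t + ε) := by
            rw [← Real.rpow_add_one (by positivity)]; congr 1; ring
        _ ≤ ε ^ (-τ) * (t + ε) := by
            gcongr ?_ * _
            exact Real.rpow_le_rpow_of_nonpos hε (by linarith) (by linarith)
        _ ≤ Real.exp 1 * (t + ε) := by
            gcongr
            rw [Real.rpow_def_of_pos hε]
            gcongr
            have : -Real.log ε = L := by rw [hL, abs_of_nonpos (Real.log_nonpos hε.le hε1)]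
            calc Real.log ε * -τ = L * τ := by rw [← this]; ring
              _ = L / (1 + L) := by rw [hτ]; ring
              _ ≤ 1 := by rw [div_le_one (by positivity)]; linarith
    rw [couplingSize, errorRoot, if_neg (lt_irrefl _), if_pos rfl, Real.rpow_one, Real.rpow_one]
    rw [← hS, sub_sub_cancel, hτ, div_div_eq_mul_div, div_one, ← hτ] at htail
    have h3 : levyTail d 1 t ≤ S * (1 + L) * (Real.exp 1 * (t + ε)) := by
      refine htail.trans ?_
      gcongr
    have h4 : t ≤ 1 * (1 + L) * (t + ε) := by nlinarith [mul_nonneg hL0 (add_nonneg ht hε.le)]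
    have h5 : 0 ≤ Real.pi * ((1 + L) * (t + ε)) := by positivity
    nlinarith
  · refine ⟨1 + S / (α - 1), ?_, fun t ε ht htπ hε hε1 => ?_⟩
    · have := sub_pos.2 h1; positivity
    have htail := levyTail_le_rpow (d := d) (θ := 1) h0 h2 ht zero_le_one le_rfl h1
    rw [← hS, Real.rpow_one] at htail
    have hle : t ≤ ε ^ (1 - α) * (t ^ α + ε ^ α) := by
      rw [mul_add]
      rcases le_total t ε with h | h
      · have : ε ^ (1 - α) * ε ^ α = ε := by
          rw [← Real.rpow_add hε, sub_add_cancel, Real.rpow_one]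
        rw [this]
        have : 0 ≤ ε ^ (1 - α) * t ^ α := by positivity
        linarith
      · have ht' : 0 < t := hε.trans_le h
        have e1 : t = t ^ (1 - α) * t ^ α := by
          rw [← Real.rpow_add ht', sub_add_cancel, Real.rpow_one]
        have e2 : t ^ (1 - α) ≤ ε ^ (1 - α) :=
          Real.rpow_le_rpow_of_nonpos hε h (by linarith)
        have e3 : t ^ (1 - α) * t ^ α ≤ ε ^ (1 - α) * t ^ α := by gcongr
        have : 0 ≤ ε ^ (1 - α) * ε ^ α := by positivity
        linarith
    rw [couplingSize, errorRoot, if_neg h1.not_gt, if_neg h1.ne', mul_assoc]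
    have hq : 0 ≤ 1 + S / (α - 1) := by have := sub_pos.2 h1; positivity
    calc t + levyTail d α t ≤ (1 + S / (α - 1)) * t := by linarith
      _ ≤ _ := by gcongr

/-! ### Translations of the kernel -/

lemma abs_rpow_neg_sub_le {p r r' σ : ℝ} (hp : 0 < p) (hr : 0 < r) (hr' : r / 2 ≤ r')
    (hσ : |r' - r| ≤ σ) :
    |(r ^ p)⁻¹ - (r' ^ p)⁻¹| ≤ p * 2 ^ (p + 1) * (σ / r) * (r ^ p)⁻¹ := by
  have hr2 : 0 < r / 2 := by positivity
  have hr'0 : 0 < r' := hr2.trans_le hr'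
  rw [← Real.rpow_neg hr.le, ← Real.rpow_neg hr'0.le]
  have h := (convex_Ici (r / 2)).norm_image_sub_le_of_norm_hasDerivWithin_le
    (f := fun x : ℝ => x ^ (-p)) (f' := fun x => -p * x ^ (-p - 1))
    (C := p * (r / 2) ^ (-p - 1)) (x := r') (y := r)
    (fun x hx => (Real.hasDerivAt_rpow_const
      (Or.inl (hr2.trans_le hx).ne')).hasDerivWithinAt) (fun x hx => ?_) hr'
    (show r / 2 ≤ r by linarith)
  · rw [Real.norm_eq_abs, Real.norm_eq_abs] at h
    refine h.trans ?_
    rw [abs_sub_comm r r']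
    have e1 : (r / 2) ^ (-p - 1) = 2 ^ (p + 1) * (r ^ (-p) / r) := by
      rw [Real.div_rpow hr.le zero_le_two, Real.rpow_sub_one hr.ne', div_eq_mul_inv _ (2 ^ (-p - 1)),
        ← Real.rpow_neg zero_le_two, mul_comm]
      congr 2
      ring
    rw [e1]
    calc p * (2 ^ (p + 1) * (r ^ (-p) / r)) * |r' - r| ≤
        p * (2 ^ (p + 1) * (r ^ (-p) / r)) * σ := by gcongr
      _ = _ := by ring
  · have hx0 : 0 < x := hr2.trans_le hx
    rw [norm_mul, norm_neg, Real.norm_of_nonneg hp.le, Real.norm_of_nonneg (by positivity)]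
    gcongr ?_ * ?_
    exact Real.rpow_le_rpow_of_nonpos hr2 hx (by linarith)

lemma abs_cos_sub_cos_le {d : ℕ} (ξ z s : Space d) (hs : 2 * ‖s‖ ≤ ‖z‖) :
    |Real.cos ⟪ξ, z + s⟫_ℝ - Real.cos ⟪ξ, z⟫_ℝ| ≤ 2 * (‖ξ‖ * ‖s‖) * min 1 (‖ξ‖ * ‖z‖) := by
  have h1 : |Real.sin ((⟪ξ, z + s⟫_ℝ - ⟪ξ, z⟫_ℝ) / 2)| ≤ ‖ξ‖ * ‖s‖ / 2 := by
    refine Real.abs_sin_le_abs.trans ?_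
    rw [inner_add_right, add_sub_cancel_left, abs_div, abs_two]
    gcongr
    exact abs_real_inner_le_norm _ _
  have h2 : |Real.sin ((⟪ξ, z + s⟫_ℝ + ⟪ξ, z⟫_ℝ) / 2)| ≤ 2 * min 1 (‖ξ‖ * ‖z‖) := by
    rcases le_total 1 (‖ξ‖ * ‖z‖) with h | h
    · rw [min_eq_left h]
      linarith [Real.abs_sin_le_one ((⟪ξ, z + s⟫_ℝ + ⟪ξ, z⟫_ℝ) / 2)]
    · rw [min_eq_right h]
      refine Real.abs_sin_le_abs.trans ?_
      rw [inner_add_right, abs_div, abs_two]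
      have h3 := abs_real_inner_le_norm ξ z
      have h4 := abs_real_inner_le_norm ξ s
      have h5 := abs_add_le (⟪ξ, z⟫_ℝ + ⟪ξ, s⟫_ℝ) ⟪ξ, z⟫_ℝ
      have h6 := abs_add_le ⟪ξ, z⟫_ℝ ⟪ξ, s⟫_ℝ
      have h7 : ‖ξ‖ * (2 * ‖s‖) ≤ ‖ξ‖ * ‖z‖ := by gcongr
      have h8 : 0 ≤ ‖ξ‖ * ‖s‖ := by positivity
      linarith
  rw [Real.cos_sub_cos, abs_mul, abs_mul, abs_neg, abs_two]
  calc _ ≤ 2 * (2 * min 1 (‖ξ‖ * ‖z‖)) * (‖ξ‖ * ‖s‖ / 2) := by gcongr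
    _ = _ := by ring

/-- Away from the origin a translation of the kernel gains a factor `|ξ|`. -/
lemma abs_symbolKernel_sub_le {d : ℕ} {α : ℝ} (h0 : 0 < α) (ξ z s : Space d) (hz : 0 < ‖z‖)
    (hs : 2 * ‖s‖ ≤ ‖z‖) :
    |symbolKernel α ξ z - symbolKernel α ξ (z + s)| ≤
      (2 * 2 ^ (d + α) + 2 * ((d + α) * 2 ^ (d + α + 1))) * (‖ξ‖ * ‖s‖) *
        (min 1 (‖ξ‖ * ‖z‖) / ‖z‖ ^ (d + α)) := by
  set p : ℝ := d + α
  have hp : 0 < p := by positivity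
  set r := ‖z‖
  set r' := ‖z + s‖
  set x := min 1 (‖ξ‖ * r)
  have hx0 : 0 ≤ x := by positivity
  have htri1 : r - ‖s‖ ≤ r' := norm_sub_le_norm_add z s
  have hr' : r / 2 ≤ r' := by linarith
  have hr'0 : 0 < r' := by linarith
  have habs : |r' - r| ≤ ‖s‖ := by
    have := abs_norm_sub_norm_le (z + s) z
    rwa [add_sub_cancel_left] at this
  have e1 := abs_rpow_neg_sub_le hp hz hr' habs
  have e2 := abs_cos_sub_cos_le ξ z s hs
  have e3 : (r' ^ p)⁻¹ ≤ 2 ^ p * (r ^ p)⁻¹ := by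
    rw [← div_eq_mul_inv, ← inv_div, ← Real.div_rpow hz.le zero_le_two]
    gcongr
  have e4 : (1 - Real.cos ⟪ξ, z⟫_ℝ) / r ≤ 2 * (x * ‖ξ‖) := by
    rw [div_le_iff₀ hz]
    have h1 := one_sub_cos_inner_le ξ z
    have h2 := Real.neg_one_le_cos ⟪ξ, z⟫_ℝ
    rcases le_total 1 (‖ξ‖ * r) with h | h
    · rw [show x = 1 from min_eq_left h]; linarith
    · rw [show x = ‖ξ‖ * r from min_eq_right h]
      have : 0 ≤ ‖ξ‖ ^ 2 * r ^ 2 := by positivity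
      linarith
  have hsplit : symbolKernel α ξ z - symbolKernel α ξ (z + s) =
      (1 - Real.cos ⟪ξ, z⟫_ℝ) * ((r ^ p)⁻¹ - (r' ^ p)⁻¹) +
        (Real.cos ⟪ξ, z + s⟫_ℝ - Real.cos ⟪ξ, z⟫_ℝ) * (r' ^ p)⁻¹ := by
    simp only [symbolKernel, div_eq_mul_inv]; ring
  have hcos : 0 ≤ 1 - Real.cos ⟪ξ, z⟫_ℝ := by linarith [Real.cos_le_one ⟪ξ, z⟫_ℝ]
  rw [hsplit]
  refine (abs_add_le _ _).trans ?_
  rw [abs_mul, abs_mul, abs_of_nonneg hcos, abs_of_nonneg (a := (r' ^ p)⁻¹) (by positivity)]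
  calc _ ≤ (1 - Real.cos ⟪ξ, z⟫_ℝ) * (p * 2 ^ (p + 1) * (‖s‖ / r) * (r ^ p)⁻¹) +
        2 * (‖ξ‖ * ‖s‖) * x * (2 ^ p * (r ^ p)⁻¹) := by gcongr
    _ = (1 - Real.cos ⟪ξ, z⟫_ℝ) / r * (p * 2 ^ (p + 1) * ‖s‖ * (r ^ p)⁻¹) +
        2 * (‖ξ‖ * ‖s‖) * x * (2 ^ p * (r ^ p)⁻¹) := by ring
    _ ≤ 2 * (x * ‖ξ‖) * (p * 2 ^ (p + 1) * ‖s‖ * (r ^ p)⁻¹) +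
        2 * (‖ξ‖ * ‖s‖) * x * (2 ^ p * (r ^ p)⁻¹) := by gcongr
    _ = _ := by ring

/-- The kernel moves in `L₁` by at most the square of the coupling size under translations within
the cell: bounded jumps are quadratic in `ξ`, and for long jumps the factor `|ξ|` gained by the
translation multiplies the tail. -/
lemma exists_integral_symbolKernel_sub_le (d : ℕ) [NeZero d] {α : ℝ} (h0 : 0 < α) (h2 : α < 2)
    {ρ : ℝ} (hρ : 1 ≤ ρ) :
    ∃ C : ℝ, 0 ≤ C ∧ ∀ ξ s : Space d, ‖s‖ ≤ ρ →
      ∫ z, |symbolKernel α ξ z - symbolKernel α ξ (z + s)| ≤ C * couplingSize d α ‖ξ‖ ^ 2 := by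
  set N := ∫ z in Metric.ball (0 : Space d) (3 * ρ), ‖z‖ ^ 2 / ‖z‖ ^ (d + α)
  have hN : 0 ≤ N := integral_nonneg fun z => by positivity
  set c : ℝ := 2 * 2 ^ (d + α) + 2 * ((d + α) * 2 ^ (d + α + 1)) with hc
  have hc0 : 0 ≤ c := by positivity
  refine ⟨2 * N + c * ρ, by positivity, fun ξ s hs => ?_⟩
  have hk := integrable_symbolKernel (d := d) h0 h2 ξ
  have hk' : Integrable fun z => symbolKernel α ξ (z + s) := hk.comp_add_right s
  have hd : Integrable fun z => |symbolKernel α ξ z - symbolKernel α ξ (z + s)| :=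
    (hk.sub hk').abs
  have hkn := symbolKernel_nonneg (d := d) α ξ
  have hball := integral_symbolKernel_ball_le (d := d) h0 h2 (3 * ρ) ξ
  rw [← integral_add_compl (measurableSet_ball (x := (0 : Space d)) (ε := 2 * ρ)) hd]
  have near : ∫ z in Metric.ball 0 (2 * ρ), |symbolKernel α ξ z - symbolKernel α ξ (z + s)| ≤
      2 * (N * ‖ξ‖ ^ 2) := by
    have h1 : ∫ z in Metric.ball 0 (2 * ρ), symbolKernel α ξ z ≤ N * ‖ξ‖ ^ 2 := by
      refine (setIntegral_mono_set hk.integrableOn (Filter.Eventually.of_forall hkn) ?_).trans hball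
      exact (Metric.ball_subset_ball (by linarith)).eventuallyLE
    have h2 : ∫ z in Metric.ball 0 (2 * ρ), symbolKernel α ξ (z + s) ≤ N * ‖ξ‖ ^ 2 := by
      have h3 := (measurePreserving_add_right (volume : Measure (Space d)) s).setIntegral_preimage_emb
        (MeasurableEquiv.addRight s).measurableEmbedding (symbolKernel α ξ)
        (Metric.ball 0 (3 * ρ))
      rw [← h3] at hball
      refine (setIntegral_mono_set hk'.integrableOn
        (Filter.Eventually.of_forall fun z => hkn (z + s)) ?_).trans hball
      refine LE.le.eventuallyLE fun z hz => ?_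
      have hz : ‖z‖ < 2 * ρ := by simpa using hz
      have := norm_add_le z s
      simp only [mem_preimage, Metric.mem_ball, dist_zero_right]
      linarith
    calc _ ≤ ∫ z in Metric.ball 0 (2 * ρ), (symbolKernel α ξ z + symbolKernel α ξ (z + s)) := by
          refine integral_mono hd.integrableOn (hk.integrableOn.add hk'.integrableOn) fun z => ?_
          have e1 := hkn z
          have e2 := hkn (z + s)
          simp only
          rw [abs_le]; constructor <;> linarith
      _ = _ := integral_add hk.integrableOn hk'.integrableOn
      _ ≤ _ := by linarith
  have far : ∫ z in (Metric.ball 0 (2 * ρ))ᶜ, |symbolKernel α ξ z - symbolKernel α ξ (z + s)| ≤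
      c * (‖ξ‖ * ρ) * levyTail d α ‖ξ‖ := by
    have hsub : (Metric.ball (0 : Space d) (2 * ρ))ᶜ ⊆ (Metric.ball 0 1)ᶜ :=
      compl_subset_compl.2 (Metric.ball_subset_ball (by linarith))
    have hint : IntegrableOn (fun z : Space d => c * (‖ξ‖ * ρ) *
        (min 1 (‖ξ‖ * ‖z‖) / ‖z‖ ^ (d + α))) (Metric.ball 0 1)ᶜ :=
      (integrableOn_levyTail (d := d) h0 h2 (norm_nonneg ξ)).const_mul (c * (‖ξ‖ * ρ))
    rw [levyTail, ← integral_const_mul]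
    calc _ ≤ ∫ z in (Metric.ball (0 : Space d) (2 * ρ))ᶜ,
          c * (‖ξ‖ * ρ) * (min 1 (‖ξ‖ * ‖z‖) / ‖z‖ ^ (d + α)) := by
          refine setIntegral_mono_on hd.integrableOn (hint.mono_set hsub)
            measurableSet_ball.compl fun z hz => ?_
          have hz : 2 * ρ ≤ ‖z‖ := by simpa using hz
          refine (abs_symbolKernel_sub_le h0 ξ z s (by linarith) (by linarith)).trans ?_
          rw [← hc]
          gcongr
      _ ≤ _ := setIntegral_mono_set hint
          (Filter.Eventually.of_forall fun z => by simp only [Pi.zero_apply]; positivity)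
          hsub.eventuallyLE
  have ht := levyTail_nonneg (d := d) (α := α) (norm_nonneg ξ)
  refine (add_le_add near far).trans ?_
  rw [couplingSize]
  have h3 : ‖ξ‖ * levyTail d α ‖ξ‖ ≤ (‖ξ‖ + levyTail d α ‖ξ‖) ^ 2 := by
    nlinarith [norm_nonneg ξ, sq_nonneg ‖ξ‖, sq_nonneg (levyTail d α ‖ξ‖), mul_nonneg (norm_nonneg ξ) ht]
  have h4 : ‖ξ‖ ^ 2 ≤ (‖ξ‖ + levyTail d α ‖ξ‖) ^ 2 := by
    gcongr; linarith
  calc _ = 2 * N * ‖ξ‖ ^ 2 + c * ρ * (‖ξ‖ * levyTail d α ‖ξ‖) := by ring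
    _ ≤ 2 * N * (‖ξ‖ + levyTail d α ‖ξ‖) ^ 2 + c * ρ * (‖ξ‖ + levyTail d α ‖ξ‖) ^ 2 := by gcongr
    _ = _ := by ring

/-! ### Regular representatives of the coefficient -/

/-- A coefficient which is measurable, bounded and `ℤ^d`-periodic everywhere, rather than almost
everywhere. -/
structure RegularCoefficient (d : ℕ) (m M : ℝ) where
  toFun : Space d × Space d → ℝ
  measurable' : Measurable toFun
  lower' : ∀ p, m ≤ toFun p
  upper' : ∀ p, toFun p ≤ M
  periodic' : ∀ p, toFun (toCell p.1, toCell p.2) = toFun p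

lemma Coefficient.le {d : ℕ} {m M : ℝ} (μ : Coefficient d m M) : m ≤ M := by
  obtain ⟨p, hp⟩ := μ.bounds'.exists
  exact hp.1.trans hp.2

lemma toCell_toCell {d : ℕ} (x : Space d) : toCell (toCell x) = toCell x :=
  toCell_of_mem (toCell_mem x)

lemma Coefficient.exists_regular {d : ℕ} {m M : ℝ} (μ : Coefficient d m M) :
    ∃ g : RegularCoefficient d m M, ∀ᵐ p : Space d × Space d, μ.toFun p.1 p.2 = g.toFun p := by
  set f := fun p : Space d × Space d => μ.toFun p.1 p.2 with hf
  obtain ⟨f₀, hf₀, hff₀⟩ := μ.aestronglyMeasurable'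
  refine ⟨⟨fun p => max m (min M (f₀ (toCell p.1, toCell p.2))), ?_, fun p => le_max_left _ _,
    fun p => max_le μ.le (min_le_left _ _), fun p => ?_⟩, ?_⟩
  · have h1 : Measurable fun p : Space d × Space d => (toCell p.1, toCell p.2) :=
      (measurable_toCell.comp measurable_fst).prodMk (measurable_toCell.comp measurable_snd)
    exact measurable_const.max (measurable_const.min (hf₀.measurable.comp h1))
  · simp only [toCell_toCell]
  · have h1 : ∀ᵐ p : Space d × Space d, ∀ k l : Fin d → ℤ,
        μ.toFun (p.1 + latticeVec k) (p.2 + latticeVec l) = μ.toFun p.1 p.2 :=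
      ae_all_iff.2 fun k => ae_all_iff.2 fun l => μ.periodic' k l
    have hac : ((volume : Measure (Space d)).restrict (cell d)).prod (volume.restrict (cell d)) ≪
        (volume : Measure (Space d × Space d)) :=
      Measure.absolutelyContinuous_of_le
        (Measure.prod_mono Measure.restrict_le_self Measure.restrict_le_self)
    have h2 := (QuasiMeasurePreserving.prodMap (quasi_toCell (d := d)) (quasi_toCell (d := d))).ae (hac.ae_le hff₀)
    filter_upwards [h1, h2, μ.bounds'] with p hp1 hp2 hp3
    have hsub : ∀ x : Space d, x + latticeVec (fun i => -⌊x i⌋) = toCell x := fun x => by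
      ext i; simp [toCell, latticeVec, Int.fract, sub_eq_add_neg]
    have hp4 := hp1 (fun i => -⌊p.1 i⌋) (fun i => -⌊p.2 i⌋)
    rw [hsub, hsub] at hp4
    simp only [Prod.map] at hp2
    rw [← hp2, hp4, min_eq_right hp3.2, max_eq_right hp3.1]

/-- The coefficient identically equal to `1`. -/
def RegularCoefficient.one (d : ℕ) : RegularCoefficient d 1 1 where
  toFun _ := 1
  measurable' := measurable_const
  lower' _ := le_rfl
  upper' _ := le_rfl
  periodic' _ := rfl

/-! ### The form as the square of a closed operator -/

lemma norm_exp_inner {d : ℕ} (ξ x : Space d) : ‖Complex.exp (Complex.I * (⟪ξ, x⟫_ℝ : ℝ))‖ = 1 := by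
  rw [mul_comm]; exact Complex.norm_exp_ofReal_mul_I _

lemma norm_exp_inner_sub_sq {d : ℕ} (ξ x y : Space d) :
    ‖Complex.exp (Complex.I * (⟪ξ, x⟫_ℝ : ℝ)) - Complex.exp (Complex.I * (⟪ξ, y⟫_ℝ : ℝ))‖ ^ 2 =
      2 * (1 - Real.cos ⟪ξ, x - y⟫_ℝ) := by
  have h1 : Complex.exp (Complex.I * (⟪ξ, x⟫_ℝ : ℝ)) - Complex.exp (Complex.I * (⟪ξ, y⟫_ℝ : ℝ)) =
      Complex.exp (Complex.I * (⟪ξ, y⟫_ℝ : ℝ)) *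
        (Complex.exp (Complex.I * (⟪ξ, x - y⟫_ℝ : ℝ)) - 1) := by
    rw [mul_sub, ← Complex.exp_add, inner_sub_right, mul_one]
    congr 2
    push_cast; ring
  rw [h1, norm_mul, norm_exp_inner, one_mul, Complex.norm_exp_I_mul_ofReal_sub_one, Real.norm_eq_abs,
    sq_abs, mul_pow, Real.sin_sq_eq_half_sub, mul_div_cancel₀ _ (two_ne_zero' ℝ)]
  ring

/-- Finite energy for one value of `ξ` already forces membership in the form domain. -/
lemma mem_perSobolev_of_integrable {d : ℕ} [NeZero d] {α : ℝ} (h0 : 0 < α) (h2 : α < 2)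
    (ξ : Space d) {u : L2Cell d}
    (hu : Integrable (fun p => ‖twistedDiff ξ u p‖ ^ 2 / ‖p.1 - p.2‖ ^ (d + α)) (cellProd d)) :
    u ∈ perSobolev d (α / 2) := by
  have hum := measurable_perExt u
  set F : Space d × Space d → ℝ := fun p =>
    ‖perExt u p.1 - perExt u p.2‖ ^ 2 / ‖p.1 - p.2‖ ^ (d + α) with hF
  have hfar := (integrable_far u (integrable_symbolKernel h0 h2 ξ)
    (measurable_symbolKernel α ξ)).2
  have hcell : Integrable F (cellProd d) := by
    refine ((hu.const_mul 2).add (hfar.const_mul 4)).mono'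
      (by fun_prop : Measurable _).aestronglyMeasurable (Filter.Eventually.of_forall fun p => ?_)
    set a := perExt u p.1
    set b := perExt u p.2
    set e₁ := Complex.exp (Complex.I * (⟪ξ, p.1⟫_ℝ : ℝ)) with he₁
    set e₂ := Complex.exp (Complex.I * (⟪ξ, p.2⟫_ℝ : ℝ)) with he₂
    have h1 : ‖a - b‖ ≤ ‖twistedDiff ξ u p‖ + ‖e₁ - e₂‖ * ‖b‖ := by
      calc ‖a - b‖ = ‖e₁ * (a - b)‖ := by rw [norm_mul, norm_exp_inner, one_mul]
        _ = ‖twistedDiff ξ u p - (e₁ - e₂) * b‖ := by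
            congr 1; simp only [twistedDiff, he₁, he₂]; ring
        _ ≤ _ := (norm_sub_le _ _).trans (by rw [norm_mul])
    have h3 := norm_exp_inner_sub_sq ξ p.1 p.2
    rw [← he₁, ← he₂] at h3
    have h4 : ‖a - b‖ ^ 2 ≤ 2 * ‖twistedDiff ξ u p‖ ^ 2 +
        4 * (‖b‖ ^ 2 * (1 - Real.cos ⟪ξ, p.1 - p.2⟫_ℝ)) := by
      have h5 := pow_le_pow_left₀ (norm_nonneg _) h1 2
      have h6 : 4 * (‖b‖ ^ 2 * (1 - Real.cos ⟪ξ, p.1 - p.2⟫_ℝ)) =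
        2 * (‖e₁ - e₂‖ * ‖b‖) ^ 2 := by rw [mul_pow, h3]; ring
      rw [h6]
      nlinarith [sq_nonneg (‖twistedDiff ξ u p‖ - ‖e₁ - e₂‖ * ‖b‖)]
    rw [Real.norm_of_nonneg (by simp only [hF]; positivity)]
    simp only [hF, Pi.add_apply, symbolKernel]
    refine (div_le_div_of_nonneg_right h4 (by positivity)).trans (le_of_eq ?_)
    ring
  have hon : IntegrableOn F (cell d ×ˢ univ) := by
    rw [IntegrableOn, Measure.volume_eq_prod, ← Measure.prod_restrict, Measure.restrict_univ]
    exact hcell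
  set v : (Fin d → ℤ) → Space d × Space d := fun n => (latticeVec n, latticeVec n)
  have hshift : ∀ n, IntegrableOn F ((fun p => p - v n) ⁻¹' (cell d ×ˢ univ)) := fun n => by
    have h1 := ((measurePreserving_sub_right ((volume : Measure (Space d)).prod volume)
      (v n)).integrableOn_comp_preimage (MeasurableEquiv.subRight (v n)).measurableEmbedding).2 hon
    refine h1.congr_fun (fun p _ => ?_) ((measurableSet_cell d).prod MeasurableSet.univ |>.preimage
      (by fun_prop))
    have hper : ∀ x : Space d, perExt u (x - latticeVec n) = perExt u x := fun x => by
      rw [perExt, perExt, ← toCell_add (x - latticeVec n) n, sub_add_cancel]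
    simp only [hF, Function.comp_apply, v, Prod.fst_sub, Prod.snd_sub, hper, sub_sub_sub_cancel_right]
  intro r
  rw [show (d + 2 * (α / 2) : ℝ) = d + α by ring]
  set N : ℤ := ⌈r⌉
  refine ((integrableOn_finset_iUnion (s := Fintype.piFinset fun _ : Fin d => Finset.Icc (-N) N)).2
    fun n _ => hshift n).mono_set ?_
  rintro p ⟨hp, -⟩
  have hp : ‖p.1‖ < r := by simpa using hp
  refine mem_biUnion (x := fun i => ⌊p.1 i⌋) ?_ ?_
  · simp only [Finset.mem_coe, Fintype.mem_piFinset, Finset.mem_Icc]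
    intro i
    have h1 := (PiLp.norm_apply_le p.1 i).trans hp.le
    rw [Real.norm_eq_abs, abs_le] at h1
    have h3 := Int.le_ceil r
    constructor
    · rw [Int.le_floor]; push_cast; linarith
    · have := Int.floor_le (p.1 i)
      have h4 : (⌊p.1 i⌋ : ℝ) ≤ N := by linarith
      exact_mod_cast h4
  · refine ⟨?_, mem_univ _⟩
    have := toCell_mem p.1
    rwa [toCell_eq_sub] at this

section FormRoot

variable {d : ℕ} {α m M : ℝ}

/-- The difference `e^{i⟨ξ,x⟩}u(x) - e^{i⟨ξ,y⟩}u(y)` multiplied by the square root of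
`g(x,y) / (2|x-y|^{d+α})`, so that the square of its `L₂` norm is the form. -/
def weightedDiff (α : ℝ) (g : RegularCoefficient d m M) (ξ : Space d) (u : L2Cell d)
    (p : Space d × Space d) : ℂ :=
  (Real.sqrt (g.toFun p / (2 * ‖p.1 - p.2‖ ^ (d + α))) : ℝ) * twistedDiff ξ u p

lemma measurable_weightedDiff (g : RegularCoefficient d m M) (ξ : Space d) (u : L2Cell d) :
    Measurable (weightedDiff α g ξ u) := by
  have h1 := g.measurable'
  have h2 := measurable_twistedDiff ξ u
  unfold weightedDiff
  fun_prop

lemma RegularCoefficient.weight_nonneg (hm : 0 < m) (g : RegularCoefficient d m M)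
    (p : Space d × Space d) : 0 ≤ g.toFun p / (2 * ‖p.1 - p.2‖ ^ (d + α)) :=
  div_nonneg (hm.le.trans (g.lower' p)) (by positivity)

lemma norm_weightedDiff_sq (hm : 0 < m) (g : RegularCoefficient d m M) (ξ : Space d) (u : L2Cell d)
    (p : Space d × Space d) : ‖weightedDiff α g ξ u p‖ ^ 2 =
      g.toFun p / (2 * ‖p.1 - p.2‖ ^ (d + α)) * ‖twistedDiff ξ u p‖ ^ 2 := by
  rw [weightedDiff, norm_mul, mul_pow, Complex.norm_real, Real.norm_eq_abs, sq_abs,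
    Real.sq_sqrt (g.weight_nonneg hm p)]

lemma weightedDiff_add (g : RegularCoefficient d m M) (ξ : Space d) (u v : L2Cell d) :
    weightedDiff α g ξ (u + v) =ᵐ[cellProd d] weightedDiff α g ξ u + weightedDiff α g ξ v := by
  filter_upwards [twistedDiff_add ξ u v] with p hp
  simp only [weightedDiff, hp, Pi.add_apply, mul_add]

lemma weightedDiff_smul (g : RegularCoefficient d m M) (ξ : Space d) (c : ℂ) (u : L2Cell d) :
    weightedDiff α g ξ (c • u) =ᵐ[cellProd d] c • weightedDiff α g ξ u := by
  filter_upwards [twistedDiff_smul ξ c u] with p hp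
  simp only [weightedDiff, hp, Pi.smul_apply, smul_eq_mul]; ring

variable [NeZero d]

lemma memLp_weightedDiff_iff (h0 : 0 < α) (h2 : α < 2) (hm : 0 < m) (g : RegularCoefficient d m M)
    (ξ : Space d) (u : L2Cell d) :
    MemLp (weightedDiff α g ξ u) 2 (cellProd d) ↔ u ∈ perSobolev d (α / 2) := by
  have hgm := g.measurable'
  have htm := measurable_twistedDiff ξ u
  rw [memLp_two_iff_integrable_sq_norm (measurable_weightedDiff g ξ u).aestronglyMeasurable]
  simp only [norm_weightedDiff_sq hm]
  constructor
  · intro h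
    refine mem_perSobolev_of_integrable h0 h2 ξ ((h.const_mul (2 / m)).mono'
      (by fun_prop : Measurable _).aestronglyMeasurable (Filter.Eventually.of_forall fun p => ?_))
    rw [Real.norm_of_nonneg (by positivity)]
    have h1 : 1 ≤ g.toFun p / m := by rw [le_div_iff₀ hm, one_mul]; exact g.lower' p
    calc ‖twistedDiff ξ u p‖ ^ 2 / ‖p.1 - p.2‖ ^ (d + α) =
        1 * (‖twistedDiff ξ u p‖ ^ 2 / ‖p.1 - p.2‖ ^ (d + α)) := by rw [one_mul]
      _ ≤ g.toFun p / m * (‖twistedDiff ξ u p‖ ^ 2 / ‖p.1 - p.2‖ ^ (d + α)) := by gcongr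
      _ = _ := by field_simp
  · intro h
    refine ((integrable_twistedDiff h0 h2 ξ h).const_mul (M / 2)).mono'
      (by fun_prop : Measurable _).aestronglyMeasurable (Filter.Eventually.of_forall fun p => ?_)
    rw [Real.norm_of_nonneg (mul_nonneg (g.weight_nonneg hm p) (by positivity))]
    calc _ ≤ M / (2 * ‖p.1 - p.2‖ ^ (d + α)) * ‖twistedDiff ξ u p‖ ^ 2 := by
          gcongr; exact g.upper' p
      _ = _ := by ring

/-- The operator `T` with `a(ξ)[u,v] = ⟪T u, T v⟫`, from the form domain to `L₂(Ω × ℝ^d)`. -/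
def formRoot (h0 : 0 < α) (h2 : α < 2) (hm : 0 < m) (g : RegularCoefficient d m M) (ξ : Space d) :
    perSobolev d (α / 2) →ₗ[ℂ] Lp ℂ 2 (cellProd d) where
  toFun u := ((memLp_weightedDiff_iff h0 h2 hm g ξ u).2 u.2).toLp _
  map_add' u v := by
    rw [← MemLp.toLp_add, MemLp.toLp_eq_toLp_iff]
    exact weightedDiff_add g ξ u v
  map_smul' c u := by
    rw [RingHom.id_apply, ← MemLp.toLp_const_smul, MemLp.toLp_eq_toLp_iff]
    exact weightedDiff_smul g ξ c u

lemma formRoot_ae (h0 : 0 < α) (h2 : α < 2) (hm : 0 < m) (g : RegularCoefficient d m M)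
    (ξ : Space d) (u : perSobolev d (α / 2)) :
    formRoot h0 h2 hm g ξ u =ᵐ[cellProd d] weightedDiff α g ξ u :=
  MemLp.coeFn_toLp ((memLp_weightedDiff_iff h0 h2 hm g ξ u).2 u.2)

lemma inner_formRoot (h0 : 0 < α) (h2 : α < 2) (hm : 0 < m) (g : RegularCoefficient d m M)
    (ξ : Space d) (u v : perSobolev d (α / 2)) :
    ⟪formRoot h0 h2 hm g ξ u, formRoot h0 h2 hm g ξ v⟫_ℂ =
      ∫ p, ((g.toFun p / (2 * ‖p.1 - p.2‖ ^ (d + α)) : ℝ) : ℂ) *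
        (conj (twistedDiff ξ u p) * twistedDiff ξ v p) ∂(cellProd d) := by
  rw [L2.inner_def]
  refine integral_congr_ae ?_
  filter_upwards [formRoot_ae h0 h2 hm g ξ u, formRoot_ae h0 h2 hm g ξ v] with p hu hv
  rw [hu, hv, RCLike.inner_apply, weightedDiff, weightedDiff, map_mul, Complex.conj_ofReal]
  nth_rewrite 3 [← Real.mul_self_sqrt (g.weight_nonneg hm p)]
  push_cast; ring

lemma norm_formRoot_sq (h0 : 0 < α) (h2 : α < 2) (hm : 0 < m) (g : RegularCoefficient d m M)
    (ξ : Space d) (u : perSobolev d (α / 2)) :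
    ‖formRoot h0 h2 hm g ξ u‖ ^ 2 =
      ∫ p, g.toFun p / (2 * ‖p.1 - p.2‖ ^ (d + α)) * ‖twistedDiff ξ u p‖ ^ 2 ∂(cellProd d) := by
  have h := inner_formRoot h0 h2 hm g ξ u u
  rw [inner_self_eq_ofReal] at h
  apply Complex.ofReal_injective
  rw [h, ← integral_complex_ofReal]
  refine integral_congr_ae (Filter.Eventually.of_forall fun p => ?_)
  simp only
  rw [mul_comm (conj _), Complex.mul_conj, Complex.normSq_eq_norm_sq]
  push_cast; ring

lemma fiberForm_eq_inner (h0 : 0 < α) (h2 : α < 2) (hm : 0 < m) (g : RegularCoefficient d m M)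
    (μ : Coefficient d m M) (hg : ∀ᵐ p : Space d × Space d, μ.toFun p.1 p.2 = g.toFun p)
    (ξ : Space d) (u v : perSobolev d (α / 2)) :
    fiberForm h0 h2 μ ξ u v = ⟪formRoot h0 h2 hm g ξ u, formRoot h0 h2 hm g ξ v⟫_ℂ := by
  rw [inner_formRoot]
  change (1 / 2) * ∫ p, formIntegrand α μ ξ u v p ∂(cellProd d) = _
  rw [← integral_const_mul]
  refine integral_congr_ae ?_
  filter_upwards [(cellProd_ac d).ae_le hg] with p hp
  rw [formIntegrand, hp]
  push_cast
  ring

/-- The form is closed: along subsequences `u_n → u` and `T u_n → f` hold almost everywhere, which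
identifies the limit `f`, and finiteness of the energy of `u` puts `u` into the form domain. -/
lemma isClosed_formRoot (h0 : 0 < α) (h2 : α < 2) (hm : 0 < m) (g : RegularCoefficient d m M)
    (ξ : Space d) :
    IsClosed {p : L2Cell d × Lp ℂ 2 (cellProd d) |
      ∃ u : perSobolev d (α / 2), (u : L2Cell d) = p.1 ∧ formRoot h0 h2 hm g ξ u = p.2} := by
  refine IsSeqClosed.isClosed fun x y hx hxy => ?_
  choose u hu1 hu2 using hx
  obtain ⟨y1, y2⟩ := y
  rw [nhds_prod_eq, Filter.tendsto_prod_iff'] at hxy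
  obtain ⟨hy1, hy2⟩ := hxy
  obtain ⟨n1, hn1, hae1⟩ := (tendstoInMeasure_of_tendsto_Lp hy1).exists_seq_tendsto_ae
  obtain ⟨n2, hn2, hae2⟩ := (tendstoInMeasure_of_tendsto_Lp
    (hy2.comp hn1.tendsto_atTop)).exists_seq_tendsto_ae
  have hper : ∀ᵐ z, Filter.Tendsto (fun i => perExt (x (n1 i)).1 z) Filter.atTop
      (nhds (perExt y1 z)) := quasi_toCell.ae hae1
  have hroot : ∀ᵐ p ∂(cellProd d), ∀ i,
      (x (n1 (n2 i))).2 p = weightedDiff α g ξ (x (n1 (n2 i))).1 p := ae_all_iff.2 fun i => by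
    rw [← hu1, ← hu2]
    exact formRoot_ae h0 h2 hm g ξ _
  have hlim : weightedDiff α g ξ y1 =ᵐ[cellProd d] y2 := by
    filter_upwards [hroot, hae2, (cellProd_ac d).ae_le (ae_fst hper),
      (cellProd_ac d).ae_le (ae_snd hper)] with p hp1 hp2 hp3 hp4
    have h3 : Filter.Tendsto (fun i => weightedDiff α g ξ (x (n1 (n2 i))).1 p) Filter.atTop
        (nhds (weightedDiff α g ξ y1 p)) := by
      unfold weightedDiff twistedDiff
      exact (((hp3.comp hn2.tendsto_atTop).const_mul _).sub
        ((hp4.comp hn2.tendsto_atTop).const_mul _)).const_mul _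
    refine tendsto_nhds_unique h3 ?_
    simp only [← hp1]
    exact hp2
  have hmem : MemLp (weightedDiff α g ξ y1) 2 (cellProd d) :=
    (memLp_congr_ae hlim).2 (Lp.memLp y2)
  have hD := (memLp_weightedDiff_iff h0 h2 hm g ξ y1).1 hmem
  refine ⟨⟨y1, hD⟩, rfl, Lp.ext ?_⟩
  exact (formRoot_ae h0 h2 hm g ξ ⟨y1, hD⟩).trans hlim

end FormRoot

/-! ### Convolutions over the cell -/

/-- The pair (position modulo `ℤ^d` of the second point, jump) is again uniformly distributed. -/
lemma measurePreserving_toCell_snd_sub (d : ℕ) :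
    MeasurePreserving (fun p : Space d × Space d => (toCell p.2, p.1 - p.2))
      (cellProd d) (cellProd d) := by
  have h1 : MeasurePreserving (fun q : Space d × Space d => (q.1, toCell (q.2 - q.1)))
      ((volume : Measure (Space d)).prod (volume.restrict (cell d)))
      ((volume : Measure (Space d)).prod (volume.restrict (cell d))) :=
    (MeasurePreserving.id _).skew_product (g := fun z x => toCell (x - z))
      (measurable_toCell.comp (measurable_snd.sub measurable_fst))
      (Filter.Eventually.of_forall fun z => (measurePreserving_toCell_sub z).map_eq)
  have h2 := (Measure.measurePreserving_swap.comp h1).comp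
    ((Measure.measurePreserving_swap (μ := (volume : Measure (Space d)).restrict (cell d))
      (ν := volume)).comp (measurePreserving_fst_sub d))
  convert! h2 using 1
  ext p : 1
  simp

section Convolution

variable {d : ℕ} {F k : Space d → ℝ}

lemma integrable_fst_mul_jump (hF : IntegrableOn F (cell d)) (hk : Integrable k) :
    Integrable (fun p : Space d × Space d => F p.1 * k (p.1 - p.2)) (cellProd d) :=
  (measurePreserving_fst_sub d).integrable_comp_of_integrable (hF.mul_prod hk)

lemma integrable_snd_mul_jump (hF : IntegrableOn F (cell d)) (hper : ∀ x, F (toCell x) = F x)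
    (hk : Integrable k) :
    Integrable (fun p : Space d × Space d => F p.2 * k (p.1 - p.2)) (cellProd d) := by
  have h := (measurePreserving_toCell_snd_sub d).integrable_comp_of_integrable (hF.mul_prod hk)
  simpa only [Function.comp_def, hper] using h

lemma integral_fst_mul_jump (hF : IntegrableOn F (cell d)) (hk : Integrable k) :
    ∫ p, F p.1 * k (p.1 - p.2) ∂(cellProd d) = (∫ x in cell d, F x) * ∫ z, k z := by
  have h := measurePreserving_fst_sub d
  have hi : AEStronglyMeasurable (fun q : Space d × Space d => F q.1 * k q.2)
      ((cellProd d).map fun p : Space d × Space d => (p.1, p.1 - p.2)) := by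
    rw [h.map_eq]; exact (hF.mul_prod hk).aestronglyMeasurable
  have h2 := integral_map h.measurable.aemeasurable hi
  rw [h.map_eq] at h2
  rw [← h2, integral_prod_mul]

lemma integral_snd_mul_jump (hF : IntegrableOn F (cell d)) (hper : ∀ x, F (toCell x) = F x)
    (hk : Integrable k) :
    ∫ p, F p.2 * k (p.1 - p.2) ∂(cellProd d) = (∫ x in cell d, F x) * ∫ z, k z := by
  have h := measurePreserving_toCell_snd_sub d
  have hi : AEStronglyMeasurable (fun q : Space d × Space d => F q.1 * k q.2)
      ((cellProd d).map fun p : Space d × Space d => (toCell p.2, p.1 - p.2)) := by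
    rw [h.map_eq]; exact (hF.mul_prod hk).aestronglyMeasurable
  have h2 := integral_map h.measurable.aemeasurable hi
  simp only [h.map_eq, hper] at h2
  rw [← h2, integral_prod_mul]

/-- Averaging: integrating a periodic function `h` against the kernel `k(x - ·)` gives its mean
value times `∫ k`, up to the `L₁` modulus of continuity of `k`. Indeed the product of the integrals
is the average over the translations `s ∈ Ω` of the integrals of `h` against `k(x - · + s)`. -/
lemma abs_integral_mul_sub_mean_le {h : Space d → ℝ} {M B : ℝ} (hh : Measurable h)
    (hM : ∀ y, |h y| ≤ M) (hper : ∀ y, h (toCell y) = h y) (hk : Integrable k)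
    (hB : ∀ s ∈ cell d, ∫ z, |k z - k (z + s)| ≤ B) (x : Space d) :
    |(∫ y, h y * k (x - y)) - (∫ y in cell d, h y) * ∫ z, k z| ≤ M * B := by
  have hM0 : 0 ≤ M := (abs_nonneg _).trans (hM 0)
  have hkx : Integrable fun y => k (x - y) := hk.comp_sub_left x
  have hkxs : ∀ s, Integrable fun y => k (x - y + s) := fun s =>
    (hk.comp_add_right s).comp_sub_left x
  have hbd : ∀ {g : Space d → ℝ}, Integrable g → Integrable fun y => h y * g y := fun hg =>
    hg.bdd_mul hh.aestronglyMeasurable (Filter.Eventually.of_forall hM)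
  have hjoint : Integrable (fun q : Space d × Space d => h (q.2 + q.1) * k (x - q.2))
      (cellProd d) :=
    Integrable.bdd_mul (hkx.comp_snd _) (hh.comp (by fun_prop)).aestronglyMeasurable
      (Filter.Eventually.of_forall fun q => hM _)
  have hshift : ∀ s, ∫ y, h y * k (x - y + s) = ∫ y, h (y + s) * k (x - y) := fun s => by
    rw [← integral_add_right_eq_self (fun y => h y * k (x - y + s)) s]
    congr 1; ext y; congr 2; abel
  have hmean : ∫ s in cell d, ∫ y, h y * k (x - y + s) =
      (∫ y in cell d, h y) * ∫ z, k z := by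
    simp only [hshift]
    rw [integral_integral_swap hjoint]
    have : ∀ y, ∫ s in cell d, h (y + s) * k (x - y) = (∫ y in cell d, h y) * k (x - y) :=
      fun y => by
        rw [integral_mul_const, ← integral_toCell_add hh.aestronglyMeasurable y]
        simp only [hper, add_comm]
    simp only [this]
    rw [integral_const_mul, integral_sub_left_eq_self]
  have hint : Integrable (fun s => ∫ y, h y * k (x - y + s)) (volume.restrict (cell d)) := by
    simp only [hshift]
    exact hjoint.integral_prod_left
  have hconst : ∫ _ in cell d, (∫ y, h y * k (x - y)) = ∫ y, h y * k (x - y) := by simp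
  rw [← hmean, ← hconst, ← integral_sub (integrable_const _) hint]
  have hle : ∀ s ∈ cell d, ‖(∫ y, h y * k (x - y)) - ∫ y, h y * k (x - y + s)‖ ≤ M * B :=
    fun s hs => by
      rw [← integral_sub (hbd hkx) (hbd (hkxs s))]
      refine (norm_integral_le_integral_norm _).trans ?_
      have hd : Integrable fun y => |k (x - y) - k (x - y + s)| := (hkx.sub (hkxs s)).abs
      calc _ ≤ ∫ y, M * |k (x - y) - k (x - y + s)| := by
            refine integral_mono ((hbd hkx).sub (hbd (hkxs s))).norm (hd.const_mul M) fun y => ?_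
            simp only
            rw [← mul_sub, norm_mul]
            exact mul_le_mul_of_nonneg_right (hM y) (norm_nonneg _)
        _ = M * ∫ z, |k z - k (z + s)| := by
            rw [integral_const_mul, integral_sub_left_eq_self fun z => |k z - k (z + s)|]
        _ ≤ _ := by gcongr; exact hB s hs
  have := norm_setIntegral_le_of_norm_le_const (volume_cell_lt_top d) hle
  simpa [Measure.real, volume_cell] using this

end Convolution

/-! ### The constant function -/

section Constants

variable {d : ℕ}

/-- The constant function `1` as an element of `L₂(Ω)`. -/
abbrev constOne (d : ℕ) : L2Cell d :=
  Lp.const 2 ((volume : Measure (Space d)).restrict (cell d)) (1 : ℂ)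

lemma norm_constOne (d : ℕ) : ‖constOne d‖ = 1 := by
  refine (Lp.norm_const' 2 _ _ two_ne_zero ENNReal.ofNat_ne_top).trans ?_
  simp

lemma perExt_constOne (d : ℕ) : ∀ᵐ x, perExt (constOne d) x = 1 :=
  quasi_toCell.ae (Lp.coeFn_const 2 _ (1 : ℂ))

lemma inner_constOne (u : L2Cell d) : ⟪constOne d, u⟫_ℂ = ∫ x in cell d, u x := by
  rw [L2.inner_def]
  refine integral_congr_ae ?_
  filter_upwards [Lp.coeFn_const 2 ((volume : Measure (Space d)).restrict (cell d)) (1 : ℂ)]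
    with x hx
  rw [hx, RCLike.inner_apply]
  simp

lemma constOne_mem_perSobolev (d : ℕ) (s : ℝ) : constOne d ∈ perSobolev d s := fun r => by
  refine (integrableOn_zero).congr (ae_restrict_of_ae ?_)
  filter_upwards [ae_fst (perExt_constOne d), ae_snd (perExt_constOne d)] with p h1 h2
  simp [h1, h2]

/-- The constant function `1` as an element of the form domain. -/
def constForm (d : ℕ) (s : ℝ) : perSobolev d s := ⟨constOne d, constOne_mem_perSobolev d s⟩

lemma twistedDiff_constOne (ξ : Space d) : ∀ᵐ p ∂(cellProd d), twistedDiff ξ (constOne d) p =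
    Complex.exp (Complex.I * (⟪ξ, p.1⟫_ℝ : ℝ)) - Complex.exp (Complex.I * (⟪ξ, p.2⟫_ℝ : ℝ)) := by
  filter_upwards [(cellProd_ac d).ae_le (ae_fst (perExt_constOne d)),
    (cellProd_ac d).ae_le (ae_snd (perExt_constOne d))] with p h1 h2
  rw [twistedDiff, h1, h2, mul_one, mul_one]

lemma norm_weightedDiff_constOne_sq {α m M : ℝ} (hm : 0 < m) (g : RegularCoefficient d m M)
    (ξ : Space d) : ∀ᵐ p ∂(cellProd d), ‖weightedDiff α g ξ (constOne d) p‖ ^ 2 =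
      g.toFun p * symbolKernel α ξ (p.1 - p.2) := by
  filter_upwards [twistedDiff_constOne ξ] with p hp
  rw [norm_weightedDiff_sq hm, hp, norm_exp_inner_sub_sq, symbolKernel]
  ring

variable {α m M : ℝ}

/-- The mean value of a regular coefficient over `Ω × Ω`. -/
def RegularCoefficient.mean (g : RegularCoefficient d m M) : ℝ :=
  ∫ x in cell d, ∫ y in cell d, g.toFun (x, y)

lemma RegularCoefficient.integrable (g : RegularCoefficient d m M) (x : Space d) :
    Integrable (fun y => g.toFun (x, y)) (volume.restrict (cell d)) := by
  refine Integrable.of_bound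
    (g.measurable'.comp measurable_prodMk_left).aestronglyMeasurable (max |m| |M|)
    (Filter.Eventually.of_forall fun y => ?_)
  exact abs_le_max_abs_abs (g.lower' _) (g.upper' _)

lemma RegularCoefficient.integrable_integral (g : RegularCoefficient d m M) :
    Integrable (fun x => ∫ y in cell d, g.toFun (x, y)) (volume.restrict (cell d)) := by
  refine Integrable.of_bound
    (g.measurable'.stronglyMeasurable.integral_prod_right').aestronglyMeasurable (max |m| |M|)
    (Filter.Eventually.of_forall fun x => ?_)
  have := norm_setIntegral_le_of_norm_le_const (f := fun y => g.toFun (x, y))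
    (volume_cell_lt_top d) (fun y _ => abs_le_max_abs_abs (g.lower' (x, y)) (g.upper' (x, y)))
  simpa [Measure.real, volume_cell] using this

lemma RegularCoefficient.le_mean (g : RegularCoefficient d m M) : m ≤ g.mean := by
  have h1 : ∀ x, m ≤ ∫ y in cell d, g.toFun (x, y) := fun x => by
    have := integral_mono (μ := (volume : Measure (Space d)).restrict (cell d))
      (integrable_const m) (g.integrable x) (fun y => g.lower' (x, y))
    simpa using this
  have := integral_mono (μ := (volume : Measure (Space d)).restrict (cell d))
      (integrable_const m) g.integrable_integral h1
  simpa [RegularCoefficient.mean] using this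

lemma Coefficient.mean_eq (μ : Coefficient d m M) (g : RegularCoefficient d m M)
    (hg : ∀ᵐ p : Space d × Space d, μ.toFun p.1 p.2 = g.toFun p) : μ.mean = g.mean := by
  have hac : ((volume : Measure (Space d)).restrict (cell d)).prod (volume.restrict (cell d)) ≪
      (volume : Measure (Space d × Space d)) :=
    Measure.absolutelyContinuous_of_le
      (Measure.prod_mono Measure.restrict_le_self Measure.restrict_le_self)
  refine integral_congr_ae ?_
  filter_upwards [Measure.ae_ae_of_ae_prod (hac.ae_le hg)] with x hx
  exact integral_congr_ae hx

variable [NeZero d]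

lemma norm_formRoot_constForm_sq (h0 : 0 < α) (h2 : α < 2) (hm : 0 < m)
    (g : RegularCoefficient d m M) (ξ : Space d) :
    ‖formRoot h0 h2 hm g ξ (constForm d (α / 2))‖ ^ 2 =
      ∫ p, g.toFun p * symbolKernel α ξ (p.1 - p.2) ∂(cellProd d) := by
  rw [norm_formRoot_sq]
  refine integral_congr_ae ?_
  filter_upwards [norm_weightedDiff_constOne_sq (α := α) hm g ξ] with p hp
  rw [← hp, norm_weightedDiff_sq hm]
  rfl

/-- The value of the form at the constant function is `μ⁰ V_α(ξ)`, up to the square of the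
coupling size. -/
lemma exists_norm_formRoot_constForm_sq_sub_le (d : ℕ) [NeZero d] (h0 : 0 < α) (h2 : α < 2)
    (hm : 0 < m) :
    ∃ C : ℝ, 0 ≤ C ∧ ∀ (g : RegularCoefficient d m M) (ξ : Space d),
      |‖formRoot h0 h2 hm g ξ (constForm d (α / 2))‖ ^ 2 - g.mean * symbolV α ξ| ≤
        C * couplingSize d α ‖ξ‖ ^ 2 := by
  obtain ⟨ρ, -, hρ⟩ := (isBounded_cell d).exists_pos_norm_lt
  obtain ⟨C, hC0, hC⟩ := exists_integral_symbolKernel_sub_le d h0 h2 (le_max_left 1 ρ)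
  refine ⟨max |m| |M| * C, by positivity, fun g ξ => ?_⟩
  have hk := integrable_symbolKernel (d := d) h0 h2 ξ
  have hbound : ∀ p, |g.toFun p| ≤ max |m| |M| := fun p =>
    abs_le_max_abs_abs (g.lower' p) (g.upper' p)
  have hint : Integrable (fun p => g.toFun p * symbolKernel α ξ (p.1 - p.2)) (cellProd d) := by
    have h1 := integrable_fst_mul_jump (F := fun _ => 1) (integrable_const _) hk
    simp only [one_mul] at h1
    exact h1.bdd_mul g.measurable'.aestronglyMeasurable (Filter.Eventually.of_forall hbound)
  have hpt : ∀ x, ‖(∫ y, g.toFun (x, y) * symbolKernel α ξ (x - y)) -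
      (∫ y in cell d, g.toFun (x, y)) * symbolV α ξ‖ ≤
        max |m| |M| * (C * couplingSize d α ‖ξ‖ ^ 2) := fun x => by
    rw [← integral_symbolKernel h0, Real.norm_eq_abs]
    refine abs_integral_mul_sub_mean_le (g.measurable'.comp measurable_prodMk_left)
      (fun y => hbound _) (fun y => ?_) hk
      (fun s hs => hC ξ s ((hρ s hs).le.trans (le_max_right _ _))) x
    change g.toFun (x, toCell y) = g.toFun (x, y)
    rw [← g.periodic' (x, toCell y), ← g.periodic' (x, y)]
    simp only [toCell_toCell]
  rw [norm_formRoot_constForm_sq, integral_prod _ hint, RegularCoefficient.mean,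
    ← integral_mul_const, ← integral_sub hint.integral_prod_left (g.integrable_integral.mul_const _)]
  have := norm_setIntegral_le_of_norm_le_const (volume_cell_lt_top d)
    (fun x (_ : x ∈ cell d) => hpt x)
  simp only [Measure.real, volume_cell, ENNReal.toReal_one, mul_one, Real.norm_eq_abs] at this
  rw [mul_assoc]
  exact this

lemma norm_formRoot_one_constForm_sq (h0 : 0 < α) (h2 : α < 2) (ξ : Space d) :
    ‖formRoot h0 h2 one_pos (RegularCoefficient.one d) ξ (constForm d (α / 2))‖ ^ 2 =
      symbolV α ξ := by
  have h := integral_fst_mul_jump (F := fun _ => 1) (integrable_const _)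
    (integrable_symbolKernel (d := d) h0 h2 ξ)
  rw [norm_formRoot_constForm_sq]
  refine h.trans ?_
  rw [integral_symbolKernel h0]
  simp

end Constants

/-! ### Lower bounds for the form -/

section LowerBounds

variable {d : ℕ}

/-- The double integral of `|v(x) - v(y)|²` over a probability space. -/
lemma integral_norm_sub_sq {X : Type*} [MeasurableSpace X] {ν : Measure X} [IsProbabilityMeasure ν]
    {v : X → ℂ} (hv : MemLp v 2 ν) :
    Integrable (fun p : X × X => ‖v p.1 - v p.2‖ ^ 2) (ν.prod ν) ∧
    ∫ p, ‖v p.1 - v p.2‖ ^ 2 ∂(ν.prod ν) = 2 * ∫ x, ‖v x‖ ^ 2 ∂ν - 2 * ‖∫ x, v x ∂ν‖ ^ 2 := by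
  have hi : Integrable v ν := hv.integrable (by norm_num)
  have hs : Integrable (fun x => ‖v x‖ ^ 2) ν :=
    (memLp_two_iff_integrable_sq_norm hv.1).1 hv
  have hc : Integrable (fun x => conj (v x)) ν := by
    have := (RCLike.conjCLE (K := ℂ)).toContinuousLinearMap.integrable_comp hi
    simpa using this
  have h1 : Integrable (fun p : X × X => ‖v p.1‖ ^ 2) (ν.prod ν) := hs.comp_fst ν
  have h2 : Integrable (fun p : X × X => ‖v p.2‖ ^ 2) (ν.prod ν) := hs.comp_snd ν
  have h3 : Integrable (fun p : X × X => v p.1 * conj (v p.2)) (ν.prod ν) := hi.mul_prod hc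
  have hpt : ∀ p : X × X, ‖v p.1 - v p.2‖ ^ 2 =
      (‖v p.1‖ ^ 2 + ‖v p.2‖ ^ 2) - 2 * RCLike.re (v p.1 * conj (v p.2)) := fun p => by
    rw [← Complex.normSq_eq_norm_sq, Complex.normSq_sub, Complex.normSq_eq_norm_sq,
      Complex.normSq_eq_norm_sq]
    rfl
  have h4 : Integrable (fun p : X × X => 2 * RCLike.re (v p.1 * conj (v p.2))) (ν.prod ν) :=
    h3.re.const_mul 2
  simp only [hpt]
  refine ⟨(h1.add h2).sub h4, ?_⟩
  have e1 : ∫ p, ‖v p.1‖ ^ 2 ∂(ν.prod ν) = ∫ x, ‖v x‖ ^ 2 ∂ν := by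
    have := integral_prod_mul (μ := ν) (ν := ν) (fun x => ‖v x‖ ^ 2) (fun _ => (1 : ℝ))
    simpa using this
  have e2 : ∫ p, ‖v p.2‖ ^ 2 ∂(ν.prod ν) = ∫ x, ‖v x‖ ^ 2 ∂ν := by
    have := integral_prod_mul (μ := ν) (ν := ν) (fun _ => (1 : ℝ)) (fun x => ‖v x‖ ^ 2)
    simpa using this
  have e3 : ∫ p, RCLike.re (v p.1 * conj (v p.2)) ∂(ν.prod ν) = ‖∫ x, v x ∂ν‖ ^ 2 := by
    rw [integral_re h3, integral_prod_mul (μ := ν) (ν := ν) v fun x => conj (v x), integral_conj,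
      Complex.mul_conj, Complex.normSq_eq_norm_sq]
    exact Complex.ofReal_re _
  rw [integral_sub (f := fun p : X × X => ‖v p.1‖ ^ 2 + ‖v p.2‖ ^ 2) (h1.add h2) h4,
    integral_const_mul, e3, integral_add h1 h2, e1, e2]
  ring

lemma norm_inner_sq_le_of_inner_eq_zero {H : Type*} [NormedAddCommGroup H] [InnerProductSpace ℂ H]
    {e φ w : H} (he : ‖e‖ = 1) (hφ : ‖φ‖ = 1) (hw : ⟪e, w⟫_ℂ = 0) :
    ‖⟪φ, w⟫_ℂ‖ ^ 2 ≤ (1 - ‖⟪e, φ⟫_ℂ‖ ^ 2) * ‖w‖ ^ 2 := by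
  set c := ⟪e, φ⟫_ℂ with hc
  have h1 : ⟪φ, w⟫_ℂ = ⟪φ - c • e, w⟫_ℂ := by
    rw [inner_sub_left, inner_smul_left, hw, mul_zero, sub_zero]
  have h2 : ‖φ - c • e‖ ^ 2 = 1 - ‖c‖ ^ 2 := by
    have h3 := inner_self_eq_ofReal (φ - c • e)
    have h4 : ⟪φ, e⟫_ℂ = conj c := by rw [hc, inner_conj_symm]
    have h5 : ⟪φ - c • e, φ - c • e⟫_ℂ = ((1 - ‖c‖ ^ 2 : ℝ) : ℂ) := by
      rw [inner_sub_left, inner_sub_right, inner_sub_right, inner_smul_left, inner_smul_left,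
        inner_smul_right, inner_smul_right, h4, inner_self_eq_ofReal, inner_self_eq_ofReal, he, hφ,
        ← hc]
      have hcc : c * conj c = ((‖c‖ ^ 2 : ℝ) : ℂ) := by
        rw [Complex.mul_conj, Complex.normSq_eq_norm_sq]
      push_cast at hcc ⊢
      linear_combination -hcc
    exact Complex.ofReal_injective (h3.symm.trans h5)
  rw [h1, ← h2, ← mul_pow]
  exact pow_le_pow_left₀ (norm_nonneg _) (norm_inner_le_norm _ _) 2

/-- A function of zero mean cannot become constant after multiplication by `e^{i⟨ξ,x⟩}`, since for
`|ξ| ≤ π` the character has nonzero mean. -/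
lemma norm_integral_exp_mul_sq_le {ξ : Space d} (hξ : ‖ξ‖ ≤ Real.pi) {w : L2Cell d}
    (hw : ⟪constOne d, w⟫_ℂ = 0) :
    ‖∫ x in cell d, Complex.exp (Complex.I * (⟪ξ, x⟫_ℝ : ℝ)) * w x‖ ^ 2 ≤
      (1 - ((2 / Real.pi) ^ d) ^ 2) * ‖w‖ ^ 2 := by
  set E : Space d → ℂ := fun x => Complex.exp (Complex.I * (⟪ξ, x⟫_ℝ : ℝ)) with hE
  have hEm : Measurable E := by fun_prop
  have hmem : MemLp (fun x => conj (E x)) 2 (volume.restrict (cell d)) := by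
    refine MemLp.of_bound (Complex.continuous_conj.measurable.comp hEm).aestronglyMeasurable 1
      (Filter.Eventually.of_forall fun x => ?_)
    rw [RCLike.norm_conj, hE, norm_exp_inner]
  set φ : L2Cell d := hmem.toLp _ with hφ
  have hae : φ =ᵐ[volume.restrict (cell d)] fun x => conj (E x) := hmem.coeFn_toLp
  have h1 : ⟪φ, w⟫_ℂ = ∫ x in cell d, E x * w x := by
    rw [L2.inner_def]
    refine integral_congr_ae ?_
    filter_upwards [hae] with x hx
    rw [hx, RCLike.inner_apply, Complex.conj_conj, mul_comm]
  have h2 : ⟪constOne d, φ⟫_ℂ = conj (∫ x in cell d, E x) := by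
    rw [inner_constOne, ← integral_conj]
    exact integral_congr_ae hae
  have h3 : ‖φ‖ = 1 := by
    have h4 : ⟪φ, φ⟫_ℂ = 1 := by
      rw [L2.inner_def]
      have : ∀ᵐ x ∂((volume : Measure (Space d)).restrict (cell d)), ⟪φ x, φ x⟫_ℂ = 1 := by
        filter_upwards [hae] with x hx
        rw [hx, RCLike.inner_apply, Complex.conj_conj, mul_comm, Complex.mul_conj,
          Complex.normSq_eq_norm_sq, hE, norm_exp_inner]
        simp
      rw [integral_congr_ae this]
      simp
    rw [inner_self_eq_ofReal] at h4
    have h5 : ‖φ‖ ^ 2 = 1 := by exact_mod_cast h4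
    nlinarith [norm_nonneg φ]
  have h6 := norm_inner_sq_le_of_inner_eq_zero (norm_constOne d) h3 hw
  rw [h1, h2, RCLike.norm_conj] at h6
  refine h6.trans ?_
  gcongr
  exact norm_integral_cell_exp_ge hξ

lemma norm_sq_eq_integral (w : L2Cell d) : ‖w‖ ^ 2 = ∫ x in cell d, ‖w x‖ ^ 2 := by
  have h := inner_self_eq_ofReal w
  rw [L2.inner_def] at h
  apply Complex.ofReal_injective
  rw [← h, ← integral_complex_ofReal]
  refine integral_congr_ae (Filter.Eventually.of_forall fun x => ?_)
  exact inner_self_eq_ofReal (w x)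

variable [NeZero d] {α m M : ℝ}

/-- The form with unit coefficient has a spectral gap on functions of zero mean: keeping only the
jumps within the cell leaves a multiple of the double integral of `|v(x) - v(y)|²`, where
`v = e^{i⟨ξ,x⟩}w`. -/
lemma exists_gap (d : ℕ) [NeZero d] (h0 : 0 < α) (h2 : α < 2) :
    ∃ κ : ℝ, 0 < κ ∧ ∀ ξ : Space d, ‖ξ‖ ≤ Real.pi → ∀ w : perSobolev d (α / 2),
      ⟪constOne d, (w : L2Cell d)⟫_ℂ = 0 →
        κ * ‖(w : L2Cell d)‖ ^ 2 ≤ ‖formRoot h0 h2 one_pos (RegularCoefficient.one d) ξ w‖ ^ 2 := by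
  obtain ⟨ρ, hρ0, hρ⟩ := (isBounded_cell d).exists_pos_norm_lt
  set D : ℝ := (2 * ρ) ^ (d + α)
  have hD : 0 < D := by positivity
  refine ⟨((2 / Real.pi) ^ d) ^ 2 / D, by positivity, fun ξ hξ w hw => ?_⟩
  set ν : Measure (Space d) := volume.restrict (cell d)
  set v : Space d → ℂ := fun x =>
    Complex.exp (Complex.I * (⟪ξ, x⟫_ℝ : ℝ)) * (w : L2Cell d) x with hv
  have hEm : Measurable fun x : Space d => Complex.exp (Complex.I * (⟪ξ, x⟫_ℝ : ℝ)) := by fun_prop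
  have hnorm : ∀ x, ‖v x‖ = ‖(w : L2Cell d) x‖ := fun x => by
    simp only [hv]
    rw [norm_mul, norm_exp_inner, one_mul]
  have hvm : MemLp v 2 ν := by
    refine (Lp.memLp (w : L2Cell d)).congr_norm ?_ (Filter.Eventually.of_forall fun x =>
      (hnorm x).symm)
    exact hEm.aestronglyMeasurable.mul (Lp.aestronglyMeasurable _)
  obtain ⟨hint, heq⟩ := integral_norm_sub_sq hvm
  have hmean := norm_integral_exp_mul_sq_le hξ hw
  rw [norm_formRoot_sq]
  set Q : Space d × Space d → ℝ := fun p => (RegularCoefficient.one d).toFun p /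
    (2 * ‖p.1 - p.2‖ ^ (d + α)) * ‖twistedDiff ξ (w : L2Cell d) p‖ ^ 2 with hQ
  have hQ0 : ∀ p, 0 ≤ Q p := fun p =>
    mul_nonneg ((RegularCoefficient.one d).weight_nonneg one_pos p) (by positivity)
  have hQi : Integrable Q (cellProd d) := by
    have h1 := (memLp_weightedDiff_iff h0 h2 one_pos (RegularCoefficient.one d) ξ w).2 w.2
    rw [memLp_two_iff_integrable_sq_norm
      (measurable_weightedDiff _ ξ _).aestronglyMeasurable] at h1
    simpa only [norm_weightedDiff_sq one_pos] using h1
  have hle : ν.prod ν ≤ cellProd d := Measure.prod_mono le_rfl Measure.restrict_le_self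
  have h3 : ∫ p, Q p ∂(ν.prod ν) ≤ ∫ p, Q p ∂(cellProd d) :=
    integral_mono_measure hle (Filter.Eventually.of_forall hQ0) hQi
  have h4 : ∫ p, (1 / (2 * D)) * ‖v p.1 - v p.2‖ ^ 2 ∂(ν.prod ν) ≤ ∫ p, Q p ∂(ν.prod ν) := by
    refine integral_mono_ae (hint.const_mul _) (hQi.mono_measure hle) ?_
    have hc1 : ∀ᵐ p ∂(ν.prod ν), p.1 ∈ cell d :=
      Measure.quasiMeasurePreserving_fst.ae (ae_restrict_mem (measurableSet_cell d))
    have hc2 : ∀ᵐ p ∂(ν.prod ν), p.2 ∈ cell d :=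
      Measure.quasiMeasurePreserving_snd.ae (ae_restrict_mem (measurableSet_cell d))
    filter_upwards [hc1, hc2] with p hp1 hp2
    have htw : twistedDiff ξ (w : L2Cell d) p = v p.1 - v p.2 := by
      simp only [twistedDiff, perExt, toCell_of_mem hp1, toCell_of_mem hp2, hv]
    simp only [hQ, htw, RegularCoefficient.one]
    rcases eq_or_ne p.1 p.2 with heq | hne
    · rw [heq]; simp
    have hz : 0 < ‖p.1 - p.2‖ := norm_pos_iff.2 (sub_ne_zero.2 hne)
    have hzle : ‖p.1 - p.2‖ ≤ 2 * ρ := by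
      have := norm_sub_le p.1 p.2
      linarith [hρ _ hp1, hρ _ hp2]
    gcongr
    exact Real.rpow_le_rpow hz.le hzle (by positivity)
  rw [integral_const_mul, heq] at h4
  have h5 : ∫ x, ‖v x‖ ^ 2 ∂ν = ‖(w : L2Cell d)‖ ^ 2 := by
    rw [norm_sq_eq_integral]
    simp only [hnorm]; rfl
  rw [h5] at h4
  refine le_trans ?_ (h4.trans h3)
  calc ((2 / Real.pi) ^ d) ^ 2 / D * ‖(w : L2Cell d)‖ ^ 2 =
      1 / (2 * D) * (2 * ‖(w : L2Cell d)‖ ^ 2 -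
        2 * ((1 - ((2 / Real.pi) ^ d) ^ 2) * ‖(w : L2Cell d)‖ ^ 2)) := by
        field_simp; ring
    _ ≤ _ := by gcongr

/-- For the unit coefficient, constants and functions of zero mean are not coupled: for each jump
`z` the integral over the cell vanishes, because translations preserve the mean value. -/
lemma inner_formRoot_one_constForm (h0 : 0 < α) (h2 : α < 2) (ξ : Space d)
    {w : perSobolev d (α / 2)} (hw : ⟪constOne d, (w : L2Cell d)⟫_ℂ = 0) :
    ⟪formRoot h0 h2 one_pos (RegularCoefficient.one d) ξ (constForm d (α / 2)),
      formRoot h0 h2 one_pos (RegularCoefficient.one d) ξ w⟫_ℂ = 0 := by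
  set T := formRoot h0 h2 one_pos (RegularCoefficient.one d) ξ
  set e := constForm d (α / 2)
  set E : Space d → ℂ := fun x => Complex.exp (Complex.I * (⟪ξ, x⟫_ℝ : ℝ)) with hE
  set P : Space d × Space d → ℂ := fun p => ((1 / (2 * ‖p.1 - p.2‖ ^ (d + α)) : ℝ) : ℂ) *
    (conj (E p.1 - E p.2) * twistedDiff ξ (w : L2Cell d) p) with hP
  have hPae : (fun p => ((((RegularCoefficient.one d).toFun p) /
      (2 * ‖p.1 - p.2‖ ^ (d + α)) : ℝ) : ℂ) *
      (conj (twistedDiff ξ (e : L2Cell d) p) * twistedDiff ξ (w : L2Cell d) p))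
        =ᵐ[cellProd d] P := by
    filter_upwards [twistedDiff_constOne ξ] with p hp
    have hp' : twistedDiff ξ (e : L2Cell d) p = E p.1 - E p.2 := hp
    simp only [hP, hp']
    rfl
  have hPi : Integrable P (cellProd d) := by
    refine (L2.integrable_inner (𝕜 := ℂ) (T e) (T w)).congr (Filter.EventuallyEq.trans ?_ hPae)
    filter_upwards [formRoot_ae h0 h2 one_pos (RegularCoefficient.one d) ξ e,
      formRoot_ae h0 h2 one_pos (RegularCoefficient.one d) ξ w] with p hu hv
    rw [hu, hv, RCLike.inner_apply, weightedDiff, weightedDiff, map_mul, Complex.conj_ofReal]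
    nth_rewrite 3 [← Real.mul_self_sqrt ((RegularCoefficient.one d).weight_nonneg one_pos p)]
    push_cast; ring
  rw [inner_formRoot, integral_congr_ae hPae]
  have hΦ := measurePreserving_fst_sub d
  have hPm : AEStronglyMeasurable P
      ((cellProd d).map fun p : Space d × Space d => (p.1, p.1 - p.2)) := by
    rw [hΦ.map_eq]; exact hPi.aestronglyMeasurable
  have hchange := integral_map hΦ.measurable.aemeasurable hPm
  rw [hΦ.map_eq] at hchange
  have hint : Integrable (fun q : Space d × Space d => P (q.1, q.1 - q.2)) (cellProd d) :=
    hΦ.integrable_comp_of_integrable hPi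
  rw [hchange, integral_prod_symm _ hint]
  have hw0 : ∫ x in cell d, (w : L2Cell d) x = 0 := by rw [← inner_constOne, hw]
  have hwi : Integrable (w : L2Cell d) (volume.restrict (cell d)) :=
    (Lp.memLp (w : L2Cell d)).integrable (by norm_num)
  have hinner : ∀ z : Space d, ∫ x in cell d, P (x, x - z) = 0 := fun z => by
    have h3 : ∀ x ∈ cell d, P (x, x - z) = ((1 / (2 * ‖z‖ ^ (d + α)) : ℝ) : ℂ) * (1 - E z) *
        ((w : L2Cell d) x - E (-z) * (w : L2Cell d) (toCell (x - z))) := fun x hx => by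
      have e1 : conj (E x) = E (-x) := by
        simp only [hE]
        rw [← Complex.exp_conj, map_mul, Complex.conj_I, Complex.conj_ofReal, inner_neg_right]
        congr 1; push_cast; ring
      have e2 : conj (E (x - z)) = E (-x) * E z := by
        simp only [hE]
        rw [← Complex.exp_conj, map_mul, Complex.conj_I, Complex.conj_ofReal, inner_neg_right,
          inner_sub_right, ← Complex.exp_add]
        congr 1; push_cast; ring
      have e3 : E (x - z) = E x * E (-z) := by
        simp only [hE]
        rw [inner_neg_right, inner_sub_right, ← Complex.exp_add]
        congr 1; push_cast; ring
      have e4 : E (-x) * E x = 1 := by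
        simp only [hE]
        rw [inner_neg_right, ← Complex.exp_add, ← Complex.exp_zero]
        congr 1; push_cast; ring
      have e5 : twistedDiff ξ (w : L2Cell d) (x, x - z) =
          E x * (w : L2Cell d) x - E (x - z) * (w : L2Cell d) (toCell (x - z)) := by
        simp only [twistedDiff, perExt, toCell_of_mem hx, hE]
      simp only [hP]
      rw [e5, map_sub, e1, e2, e3, sub_sub_cancel]
      linear_combination ((1 / (2 * ‖z‖ ^ (d + α)) : ℝ) : ℂ) * (1 - E z) *
        ((w : L2Cell d) x - E (-z) * (w : L2Cell d) (toCell (x - z))) * e4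
    rw [setIntegral_congr_fun (measurableSet_cell d) h3, integral_const_mul,
      integral_sub hwi, integral_const_mul, integral_toCell_sub (Lp.aestronglyMeasurable _), hw0]
    · simp
    · exact ((measurePreserving_toCell_sub z).integrable_comp_of_integrable hwi).const_mul _
  simp only [hinner, integral_zero]

lemma norm_formRoot_one_le (h0 : 0 < α) (h2 : α < 2) (hm : 0 < m) (g : RegularCoefficient d m M)
    (ξ : Space d) (u : perSobolev d (α / 2)) :
    m * ‖formRoot h0 h2 one_pos (RegularCoefficient.one d) ξ u‖ ^ 2 ≤
      ‖formRoot h0 h2 hm g ξ u‖ ^ 2 := by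
  have hi : ∀ {m M : ℝ} (hm : 0 < m) (g : RegularCoefficient d m M),
      Integrable (fun p => g.toFun p / (2 * ‖p.1 - p.2‖ ^ (d + α)) *
        ‖twistedDiff ξ (u : L2Cell d) p‖ ^ 2) (cellProd d) := fun hm g => by
    have h1 := (memLp_weightedDiff_iff h0 h2 hm g ξ u).2 u.2
    rw [memLp_two_iff_integrable_sq_norm
      (measurable_weightedDiff _ ξ _).aestronglyMeasurable] at h1
    simpa only [norm_weightedDiff_sq hm] using h1
  rw [norm_formRoot_sq, norm_formRoot_sq, ← integral_const_mul]
  refine integral_mono ((hi one_pos _).const_mul m) (hi hm g) fun p => ?_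
  simp only [RegularCoefficient.one]
  rw [← mul_assoc, mul_one_div]
  gcongr
  exact g.lower' p

/-- The form dominates its symbol on the whole form domain: for the unit coefficient constants and
functions of zero mean are orthogonal, and the gap absorbs the bounded symbol. -/
lemma exists_symbolV_mul_le (d : ℕ) [NeZero d] (h0 : 0 < α) (h2 : α < 2) (hm : 0 < m) :
    ∃ κ : ℝ, 0 < κ ∧ ∀ (g : RegularCoefficient d m M) (ξ : Space d), ‖ξ‖ ≤ Real.pi →
      ∀ u : perSobolev d (α / 2),
        κ * symbolV α ξ * ‖(u : L2Cell d)‖ ^ 2 ≤ ‖formRoot h0 h2 hm g ξ u‖ ^ 2 := by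
  obtain ⟨κ, hκ0, hκ⟩ := exists_gap d h0 h2
  set W : ℝ := c₀ d α * Real.pi ^ α
  have hW : 0 < W := mul_pos (c₀_pos h0 h2) (by positivity)
  refine ⟨m * (κ / (κ + W)), by positivity, fun g ξ hξ u => ?_⟩
  refine le_trans ?_ (norm_formRoot_one_le h0 h2 hm g ξ u)
  rw [mul_assoc, mul_assoc]
  refine mul_le_mul_of_nonneg_left ?_ hm.le
  set T := formRoot h0 h2 one_pos (RegularCoefficient.one d) ξ
  set e := constForm d (α / 2)
  set c : ℂ := ⟪constOne d, (u : L2Cell d)⟫_ℂ with hc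
  set w := u - c • e with hwdef
  have hee : ⟪constOne d, constOne d⟫_ℂ = 1 := by
    rw [inner_self_eq_ofReal, norm_constOne]; simp
  have hw : ⟪constOne d, (w : L2Cell d)⟫_ℂ = 0 := by
    change ⟪constOne d, (u : L2Cell d) - c • constOne d⟫_ℂ = 0
    rw [inner_sub_right, inner_smul_right, hee, hc]; ring
  have hu : u = c • e + w := by rw [hwdef]; abel
  have hTu : T u = c • T e + T w := by
    conv_lhs => rw [hu]
    rw [map_add, map_smul]
  have huH : (u : L2Cell d) = c • constOne d + (w : L2Cell d) := by
    conv_lhs => rw [hu]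
    rfl
  have pyth : ∀ {K : Type _} [NormedAddCommGroup K] [InnerProductSpace ℂ K] (x y : K),
      ⟪x, y⟫_ℂ = 0 → ‖c • x + y‖ ^ 2 = ‖c‖ ^ 2 * ‖x‖ ^ 2 + ‖y‖ ^ 2 := fun x y hxy => by
    have := norm_add_sq_eq_norm_sq_add_norm_sq_of_inner_eq_zero (𝕜 := ℂ) (c • x) y
      (by rw [inner_smul_left, hxy, mul_zero])
    rw [← sq, ← sq, ← sq, norm_smul, mul_pow] at this
    exact this
  have h1 := pyth (T e) (T w) (inner_formRoot_one_constForm h0 h2 ξ hw)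
  have h3 := pyth (constOne d) (w : L2Cell d) hw
  rw [← hTu, norm_formRoot_one_constForm_sq] at h1
  rw [← huH, norm_constOne] at h3
  rw [h1, h3]
  have hV0 := symbolV_nonneg (d := d) h0 h2 ξ
  have hVW : symbolV α ξ ≤ W := by
    exact mul_le_mul_of_nonneg_left (Real.rpow_le_rpow (norm_nonneg _) hξ h0.le)
      (c₀_pos h0 h2).le
  have hgap := hκ ξ hξ w hw
  have hle1 : κ / (κ + W) ≤ 1 := by rw [div_le_one (by positivity)]; linarith
  have hle2 : κ / (κ + W) * symbolV α ξ ≤ κ := by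
    rw [div_mul_eq_mul_div, div_le_iff₀ (by positivity)]
    gcongr
    linarith
  have h5 : κ / (κ + W) * symbolV α ξ * ‖c‖ ^ 2 ≤ ‖c‖ ^ 2 * symbolV α ξ := by
    have : κ / (κ + W) * symbolV α ξ ≤ 1 * symbolV α ξ := by gcongr
    calc _ ≤ 1 * symbolV α ξ * ‖c‖ ^ 2 := by gcongr
      _ = _ := by ring
  have h6 : κ / (κ + W) * symbolV α ξ * ‖(w : L2Cell d)‖ ^ 2 ≤ ‖T w‖ ^ 2 :=
    le_trans (by gcongr) hgap
  calc _ = κ / (κ + W) * symbolV α ξ * ‖c‖ ^ 2 +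
        κ / (κ + W) * symbolV α ξ * ‖(w : L2Cell d)‖ ^ 2 := by ring
    _ ≤ _ := add_le_add h5 h6

end LowerBounds

/-! ### The coupling between constants and functions of zero mean -/

section Coupling

variable {d : ℕ} {α m M : ℝ}

lemma norm_exp_inner_sub_le (ξ x y : Space d) :
    ‖Complex.exp (Complex.I * (⟪ξ, x⟫_ℝ : ℝ)) - Complex.exp (Complex.I * (⟪ξ, y⟫_ℝ : ℝ))‖ ≤
      2 * min 1 (‖ξ‖ * ‖x - y‖) := by
  have h1 := norm_exp_inner_sub_sq ξ x y
  have h2 := one_sub_cos_inner_le ξ (x - y)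
  have h3 := Real.neg_one_le_cos ⟪ξ, x - y⟫_ℝ
  have h4 : 0 ≤ ‖ξ‖ * ‖x - y‖ := by positivity
  refine abs_le_of_sq_le_sq' ?_ (by positivity) |>.2
  rw [h1]
  rcases le_total 1 (‖ξ‖ * ‖x - y‖) with h | h
  · rw [min_eq_left h]; linarith
  · rw [min_eq_right h]; nlinarith [sq_nonneg (‖ξ‖ * ‖x - y‖)]

lemma integral_norm_le_norm (w : L2Cell d) : ∫ x in cell d, ‖w x‖ ≤ ‖w‖ := by
  have hv : MemLp (fun x => ((‖w x‖ : ℝ) : ℂ)) 2 (volume.restrict (cell d)) :=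
    (Lp.memLp w).norm.ofReal
  -- the variance of `‖w‖` is nonnegative
  have h1 := (integral_norm_sub_sq hv).2
  have h2 : 0 ≤ ∫ p : Space d × Space d, ‖((‖w p.1‖ : ℝ) : ℂ) - ((‖w p.2‖ : ℝ) : ℂ)‖ ^ 2
      ∂(((volume : Measure (Space d)).restrict (cell d)).prod (volume.restrict (cell d))) :=
    integral_nonneg fun p => by positivity
  rw [h1, integral_complex_ofReal, Complex.norm_real, Real.norm_eq_abs, sq_abs] at h2
  simp only [Complex.norm_real, norm_norm] at h2
  rw [← norm_sq_eq_integral] at h2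
  refine abs_le_of_sq_le_sq' (by linarith) (norm_nonneg w) |>.2

variable [NeZero d]

/-- Short jumps are controlled by the Cauchy–Schwarz inequality for the form, and long jumps by the
`L₁` norm: both only see the smallness of `e^{i⟨ξ,x⟩} - e^{i⟨ξ,y⟩}`. -/
lemma exists_norm_inner_formRoot_le (d : ℕ) [NeZero d] (h0 : 0 < α) (h2 : α < 2) (hm : 0 < m) :
    ∃ C : ℝ, 0 ≤ C ∧ ∀ (g : RegularCoefficient d m M) (ξ : Space d) (w : perSobolev d (α / 2)),
      ‖⟪formRoot h0 h2 hm g ξ (constForm d (α / 2)), formRoot h0 h2 hm g ξ w⟫_ℂ‖ ≤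
        C * (‖ξ‖ * ‖formRoot h0 h2 hm g ξ w‖ + levyTail d α ‖ξ‖ * ‖(w : L2Cell d)‖) := by
  set N := ∫ z in Metric.ball (0 : Space d) 1, ‖z‖ ^ 2 / ‖z‖ ^ (d + α)
  have hN : 0 ≤ N := integral_nonneg fun z => by positivity
  refine ⟨max (Real.sqrt (|M| * N)) (2 * |M|), by positivity, fun g ξ w => ?_⟩
  have hgM : ∀ p, g.toFun p ≤ |M| := fun p => (g.upper' p).trans (le_abs_self M)
  set T := formRoot h0 h2 hm g ξ
  set e := constForm d (α / 2)
  set φ := weightedDiff α g ξ (constOne d)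
  set ψ := weightedDiff α g ξ (w : L2Cell d)
  have hφ : MemLp φ 2 (cellProd d) := (memLp_weightedDiff_iff h0 h2 hm g ξ _).2 e.2
  have hψ : MemLp ψ 2 (cellProd d) := (memLp_weightedDiff_iff h0 h2 hm g ξ _).2 w.2
  have hprod : Integrable (fun p => ‖φ p‖ * ‖ψ p‖) (cellProd d) := hφ.norm.integrable_mul hψ.norm
  have hstart : ‖⟪T e, T w⟫_ℂ‖ ≤ ∫ p, ‖φ p‖ * ‖ψ p‖ ∂(cellProd d) := by
    rw [L2.inner_def]
    refine (norm_integral_le_integral_norm _).trans (le_of_eq (integral_congr_ae ?_))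
    filter_upwards [formRoot_ae h0 h2 hm g ξ e, formRoot_ae h0 h2 hm g ξ w] with p hp1 hp2
    rw [hp1, hp2, RCLike.inner_apply, norm_mul, RCLike.norm_conj, mul_comm]
    rfl
  set S : Set (Space d × Space d) := {p | ‖p.1 - p.2‖ < 1} with hS
  have hSm : MeasurableSet S := measurableSet_lt (by fun_prop) measurable_const
  rw [← integral_add_compl hSm hprod] at hstart
  have hk := integrable_symbolKernel (d := d) h0 h2 ξ
  have near : ∫ p in S, ‖φ p‖ * ‖ψ p‖ ∂(cellProd d) ≤
      Real.sqrt (|M| * N) * (‖ξ‖ * ‖T w‖) := by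
    have hφS : MemLp (fun p => ‖φ p‖) (ENNReal.ofReal 2) ((cellProd d).restrict S) := by
      simpa using hφ.norm.restrict S
    have hψS : MemLp (fun p => ‖ψ p‖) (ENNReal.ofReal 2) ((cellProd d).restrict S) := by
      simpa using hψ.norm.restrict S
    have h1 := integral_mul_le_Lp_mul_Lq_of_nonneg Real.HolderConjugate.two_two
      (Filter.Eventually.of_forall fun p => norm_nonneg (φ p))
      (Filter.Eventually.of_forall fun p => norm_nonneg (ψ p)) hφS hψS
    simp only [Real.rpow_two, ← Real.sqrt_eq_rpow] at h1
    have h3 : ∫ p in S, ‖φ p‖ ^ 2 ∂(cellProd d) ≤ |M| * N * ‖ξ‖ ^ 2 := by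
      set kb := (Metric.ball (0 : Space d) 1).indicator (symbolKernel α ξ)
      have hkb : Integrable kb := hk.indicator measurableSet_ball
      have e1 := integrable_fst_mul_jump (F := fun _ => |M|) (integrable_const _) hkb
      have e2 := integral_fst_mul_jump (F := fun _ => |M|) (integrable_const _) hkb
      rw [integral_indicator measurableSet_ball] at e2
      have hi : Integrable (fun p => ‖φ p‖ ^ 2) (cellProd d) :=
        (memLp_two_iff_integrable_sq_norm hφ.1).1 hφ
      rw [← integral_indicator hSm]
      calc _ ≤ ∫ p, |M| * kb (p.1 - p.2) ∂(cellProd d) := by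
            refine integral_mono_ae (hi.indicator hSm) e1 ?_
            filter_upwards [norm_weightedDiff_constOne_sq (α := α) hm g ξ] with p hp
            by_cases hpS : p ∈ S
            · have hb : p.1 - p.2 ∈ Metric.ball (0 : Space d) 1 := by simpa [hS] using hpS
              simp only [kb]
              rw [indicator_of_mem hpS, indicator_of_mem hb]
              refine hp.le.trans ?_
              exact mul_le_mul_of_nonneg_right (hgM p) (symbolKernel_nonneg _ _ _)
            · rw [indicator_of_notMem hpS]
              exact mul_nonneg (abs_nonneg _)
                (indicator_nonneg (fun z _ => symbolKernel_nonneg α ξ z) _)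
        _ = |M| * ∫ z in Metric.ball 0 1, symbolKernel α ξ z := by
            rw [e2]; simp
        _ ≤ |M| * (N * ‖ξ‖ ^ 2) := by
            gcongr
            exact integral_symbolKernel_ball_le h0 h2 1 ξ
        _ = _ := by ring
    have h4 : ∫ p in S, ‖ψ p‖ ^ 2 ∂(cellProd d) ≤ ‖T w‖ ^ 2 := by
      rw [norm_formRoot_sq]
      simp only [← norm_weightedDiff_sq hm]
      exact setIntegral_le_integral ((memLp_two_iff_integrable_sq_norm hψ.1).1 hψ)
        (Filter.Eventually.of_forall fun p => by simp only [Pi.zero_apply]; positivity)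
    calc _ ≤ _ := h1
      _ ≤ Real.sqrt (|M| * N * ‖ξ‖ ^ 2) * Real.sqrt (‖T w‖ ^ 2) := by gcongr
      _ = _ := by
        rw [Real.sqrt_mul (by positivity), Real.sqrt_sq (norm_nonneg _),
          Real.sqrt_sq (norm_nonneg _), mul_assoc]
  have far : ∫ p in Sᶜ, ‖φ p‖ * ‖ψ p‖ ∂(cellProd d) ≤
      2 * |M| * (levyTail d α ‖ξ‖ * ‖(w : L2Cell d)‖) := by
    set j := (Metric.ball (0 : Space d) 1)ᶜ.indicator
      (fun z => min 1 (‖ξ‖ * ‖z‖) / ‖z‖ ^ (d + α)) with hj_def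
    have hj : Integrable j := (integrable_indicator_iff measurableSet_ball.compl).2
      (integrableOn_levyTail h0 h2 (norm_nonneg ξ))
    have hj0 : ∀ z, 0 ≤ j z := fun z => indicator_nonneg (fun z _ => by positivity) z
    have hjint : ∫ z, j z = levyTail d α ‖ξ‖ := integral_indicator measurableSet_ball.compl
    set F : Space d → ℝ := fun x => ‖perExt (w : L2Cell d) x‖ with hF
    have hFper : ∀ x, F (toCell x) = F x := fun x => by
      simp only [hF, perExt, toCell_toCell]
    have hFw : ∀ x ∈ cell d, F x = ‖(w : L2Cell d) x‖ := fun x hx => by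
      simp only [hF, perExt, toCell_of_mem hx]
    have hFi : IntegrableOn F (cell d) :=
      IntegrableOn.congr_fun ((Lp.memLp (w : L2Cell d)).integrable (by norm_num)).norm
        (fun x hx => (hFw x hx).symm) (measurableSet_cell d)
    have hFint : ∫ x in cell d, F x ≤ ‖(w : L2Cell d)‖ := by
      rw [setIntegral_congr_fun (measurableSet_cell d) hFw]
      exact integral_norm_le_norm _
    have e1 := integrable_fst_mul_jump hFi hj
    have e2 := integrable_snd_mul_jump hFi hFper hj
    rw [← integral_indicator hSm.compl]
    calc _ ≤ ∫ p, |M| * (F p.1 * j (p.1 - p.2) + F p.2 * j (p.1 - p.2)) ∂(cellProd d) := by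
          refine integral_mono_ae (hprod.indicator hSm.compl) ((e1.add e2).const_mul _) ?_
          filter_upwards [twistedDiff_constOne ξ] with p hp
          have hrhs : 0 ≤ |M| * (F p.1 * j (p.1 - p.2) + F p.2 * j (p.1 - p.2)) := by
            have := hj0 (p.1 - p.2)
            simp only [hF]; positivity
          by_cases hpS : p ∈ Sᶜ
          · have hb : p.1 - p.2 ∈ (Metric.ball (0 : Space d) 1)ᶜ := by simpa [hS] using hpS
            rw [indicator_of_mem hpS]
            have hτe : ‖twistedDiff ξ (constOne d) p‖ ≤ 2 * min 1 (‖ξ‖ * ‖p.1 - p.2‖) := by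
              rw [hp]; exact norm_exp_inner_sub_le ξ p.1 p.2
            have hτw : ‖twistedDiff ξ (w : L2Cell d) p‖ ≤ F p.1 + F p.2 := by
              refine (norm_sub_le _ _).trans (le_of_eq ?_)
              rw [norm_mul, norm_mul, norm_exp_inner, norm_exp_inner, one_mul, one_mul]
            have hsplit : ‖φ p‖ * ‖ψ p‖ = g.toFun p / (2 * ‖p.1 - p.2‖ ^ (d + α)) *
                (‖twistedDiff ξ (constOne d) p‖ * ‖twistedDiff ξ (w : L2Cell d) p‖) := by
              simp only [φ, ψ, weightedDiff]
              rw [norm_mul, norm_mul, Complex.norm_real, Real.norm_of_nonneg (Real.sqrt_nonneg _)]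
              nth_rewrite 3 [← Real.mul_self_sqrt (g.weight_nonneg hm p)]
              ring
            rw [hsplit]
            have hjv : j (p.1 - p.2) = min 1 (‖ξ‖ * ‖p.1 - p.2‖) / ‖p.1 - p.2‖ ^ (d + α) := by
              rw [hj_def, indicator_of_mem hb]
            rw [hjv]
            have hF0 : 0 ≤ F p.1 + F p.2 := by simp only [hF]; positivity
            calc _ ≤ |M| / (2 * ‖p.1 - p.2‖ ^ (d + α)) *
                  ((2 * min 1 (‖ξ‖ * ‖p.1 - p.2‖)) * (F p.1 + F p.2)) := by
                  gcongr
                  exact hgM p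
              _ = _ := by ring
          · rw [indicator_of_notMem hpS]
            exact hrhs
      _ = |M| * ((∫ x in cell d, F x) * levyTail d α ‖ξ‖ +
            (∫ x in cell d, F x) * levyTail d α ‖ξ‖) := by
          rw [integral_const_mul, integral_add e1 e2, integral_fst_mul_jump hFi hj,
            integral_snd_mul_jump hFi hFper hj, hjint]
      _ ≤ |M| * (‖(w : L2Cell d)‖ * levyTail d α ‖ξ‖ + ‖(w : L2Cell d)‖ * levyTail d α ‖ξ‖) := by
          have := levyTail_nonneg (d := d) (α := α) (norm_nonneg ξ)
          gcongr
      _ = _ := by ring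
  have ht := levyTail_nonneg (d := d) (α := α) (norm_nonneg ξ)
  calc _ ≤ _ := hstart
    _ ≤ Real.sqrt (|M| * N) * (‖ξ‖ * ‖T w‖) +
        2 * |M| * (levyTail d α ‖ξ‖ * ‖(w : L2Cell d)‖) := add_le_add near far
    _ ≤ max (Real.sqrt (|M| * N)) (2 * |M|) * (‖ξ‖ * ‖T w‖) +
        max (Real.sqrt (|M| * N)) (2 * |M|) * (levyTail d α ‖ξ‖ * ‖(w : L2Cell d)‖) := by
        gcongr
        · exact le_max_left _ _
        · exact le_max_right _ _
    _ = _ := by ring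

end Coupling

/-! ### The resolvent estimate -/

section Resolvent

variable {d : ℕ} {α m M : ℝ}

lemma δ₀_le_pi (h0 : 0 < α) (hm : 0 < m) (hmM : m ≤ M) : δ₀ α m M ≤ Real.pi := by
  have h1 : m / (3 * M) ≤ 1 := by
    rw [div_le_one (by linarith)]; linarith
  have h3 : 0 ≤ m / (3 * M) := div_nonneg hm.le (by linarith)
  have := Real.rpow_le_one h3 h1 (by positivity : 0 ≤ 1 / α)
  exact mul_le_of_le_one_right Real.pi_pos.le this

lemma constProj_apply (f : L2Cell d) :
    constProj d f = ⟪constOne d, f⟫_ℂ • constOne d :=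
  Submodule.starProjection_unit_singleton ℂ (norm_constOne d) f

lemma rpow_neg_le_errorBound {ε : ℝ} (h2 : α < 2) (h0 : 0 < α) (hε : 1 ≤ ε) :
    (ε ^ α)⁻¹ ≤ errorBound α ε := by
  have h1 : (ε ^ α)⁻¹ ≤ 1 := inv_le_one_of_one_le₀ (Real.one_le_rpow hε h0.le)
  unfold errorBound
  split_ifs
  · exact h1
  · exact h1.trans (one_le_pow₀ (by linarith [abs_nonneg (Real.log ε)]))
  · rw [← Real.rpow_neg (by linarith)]
    exact Real.rpow_le_rpow_of_exponent_le hε (by linarith)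

/-- The bound of the Schur complement argument depends on the coupling size `b` only through the
ratio `b / N`, which is at most `C₁ E`. -/
lemma schur_bound_le {C₁ C₃ K b k cn cl N E l : ℝ} (hC₃ : 0 ≤ C₃) (hK : 0 ≤ K)
    (hb : 0 ≤ b) (hk : 0 < k) (hcn : 0 < cn) (hcl : 0 < cl) (hN : 0 < N) (hl : cl * N ≤ l)
    (hbN : b / N ≤ C₁ * E) (hE : 1 ≤ E) :
    ((C₃ * b ^ 2 + (K * b) ^ 2) / (cn * N) + K * b / k) / l + (K * b / (cn * N) + 1 / k) / k ≤
      ((C₃ + K ^ 2) * C₁ ^ 2 / (cn * cl) + K * C₁ / (k * cl) + K * C₁ / (cn * k) + 1 / (k * k)) *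
        E ^ 2 := by
  obtain ⟨x, hx⟩ : ∃ x, x = b / N := ⟨_, rfl⟩
  have hx0 : 0 ≤ x := by rw [hx]; positivity
  have hxE : x ≤ C₁ * E := hx ▸ hbN
  have hxE2 : x ≤ C₁ * E ^ 2 := by nlinarith
  have hx2 : x ^ 2 ≤ C₁ ^ 2 * E ^ 2 := by rw [← mul_pow]; gcongr
  have hE2 : 1 ≤ E ^ 2 := one_le_pow₀ hE
  have hb' : b = x * N := by rw [hx, div_mul_cancel₀ _ hN.ne']
  calc _ ≤ ((C₃ * b ^ 2 + (K * b) ^ 2) / (cn * N) + K * b / k) / (cl * N) +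
        (K * b / (cn * N) + 1 / k) / k := by gcongr
    _ = (C₃ + K ^ 2) * x ^ 2 / (cn * cl) + K * x / (k * cl) + K * x / (cn * k) +
        1 * 1 / (k * k) := by
        rw [hb']
        field_simp
        ring
    _ ≤ (C₃ + K ^ 2) * (C₁ ^ 2 * E ^ 2) / (cn * cl) + K * (C₁ * E ^ 2) / (k * cl) +
        K * (C₁ * E ^ 2) / (cn * k) + 1 * E ^ 2 / (k * k) := by gcongr
    _ = _ := by ring

variable [NeZero d]

/-- The estimate for `ε ≤ 1`, for the weak solutions `u` of `A(ξ)u + ε^α u = f`. -/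
lemma exists_norm_weakSolution_sub_le (d : ℕ) [NeZero d] (h0 : 0 < α) (h2 : α < 2) (hm : 0 < m) :
    ∃ C : ℝ, 0 ≤ C ∧ ∀ (g : RegularCoefficient d m M) (ε : ℝ) (ξ : Space d), 0 < ε → ε ≤ 1 →
      ‖ξ‖ ≤ Real.pi → ∀ (u : perSobolev d (α / 2)) (f : L2Cell d),
        (∀ v : perSobolev d (α / 2), ⟪formRoot h0 h2 hm g ξ u, formRoot h0 h2 hm g ξ v⟫_ℂ +
          (ε ^ α : ℝ) * ⟪(u : L2Cell d), (v : L2Cell d)⟫_ℂ = ⟪f, (v : L2Cell d)⟫_ℂ) →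
        ‖(u : L2Cell d) - (((g.mean * symbolV α ξ + ε ^ α)⁻¹ : ℝ) : ℂ) • constProj d f‖ ≤
          C * errorBound α ε * ‖f‖ := by
  obtain ⟨C₁, hC₁, hsize⟩ := exists_couplingSize_le d h0 h2
  obtain ⟨C₂, hC₂, hcouple⟩ := exists_norm_inner_formRoot_le (M := M) d h0 h2 hm
  obtain ⟨C₃, hC₃, hmean⟩ := exists_norm_formRoot_constForm_sq_sub_le (M := M) d h0 h2 hm
  obtain ⟨κ, hκ, hgap⟩ := exists_gap d h0 h2
  obtain ⟨κ', hκ', hlow⟩ := exists_symbolV_mul_le (M := M) d h0 h2 hm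
  have hc₀ := c₀_pos (d := d) h0 h2
  set k : ℝ := Real.sqrt (m * κ) with hk_def
  have hk : 0 < k := Real.sqrt_pos.2 (by positivity)
  set K : ℝ := C₂ * (1 + 1 / k) with hK_def
  have hK : 0 ≤ K := by positivity
  set cn : ℝ := min (κ' * c₀ d α) 1
  have hcn : 0 < cn := lt_min (by positivity) one_pos
  set cl : ℝ := min (m * c₀ d α) 1
  have hcl : 0 < cl := lt_min (by positivity) one_pos
  refine ⟨(C₃ + K ^ 2) * C₁ ^ 2 / (cn * cl) + K * C₁ / (k * cl) + K * C₁ / (cn * k) + 1 / (k * k),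
    by positivity, fun g ε ξ hε hε1 hξ u f hu => ?_⟩
  set t : ℝ := ε ^ α
  have ht : 0 < t := Real.rpow_pos_of_pos hε _
  set b := couplingSize d α ‖ξ‖ with hb_def
  have htail := levyTail_nonneg (d := d) (α := α) (norm_nonneg ξ)
  have hb : 0 ≤ b := add_nonneg (norm_nonneg _) htail
  set N : ℝ := ‖ξ‖ ^ α + t
  have hN : 0 < N := by positivity
  set E := errorRoot α ε
  have hE : 1 ≤ E := one_le_errorRoot hε hε1
  have hbN : b / N ≤ C₁ * E := by
    rw [div_le_iff₀ hN]; exact hsize ‖ξ‖ ε (norm_nonneg _) hξ hε hε1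
  have hx0 : 0 ≤ b / N := by positivity
  set T := formRoot h0 h2 hm g ξ
  set e := constForm d (α / 2)
  have hgapT : ∀ w : perSobolev d (α / 2), ⟪(e : L2Cell d), (w : L2Cell d)⟫_ℂ = 0 →
      k * ‖(w : L2Cell d)‖ ≤ ‖T w‖ := fun w hw => by
    refine abs_le_of_sq_le_sq' ?_ (norm_nonneg _) |>.2
    rw [mul_pow, hk_def, Real.sq_sqrt (by positivity), mul_assoc]
    exact (mul_le_mul_of_nonneg_left (hgap ξ hξ w hw) hm.le).trans
      (norm_formRoot_one_le h0 h2 hm g ξ w)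
  have hcoupleT : ∀ w : perSobolev d (α / 2), ⟪(e : L2Cell d), (w : L2Cell d)⟫_ℂ = 0 →
      ‖⟪T e, T w⟫_ℂ‖ ≤ K * b * ‖T w‖ := fun w hw => by
    have h3 : ‖(w : L2Cell d)‖ ≤ ‖T w‖ / k := by
      rw [le_div_iff₀ hk, mul_comm]; exact hgapT w hw
    have h4 : ‖ξ‖ ≤ b := by rw [hb_def, couplingSize]; linarith
    have h5 : levyTail d α ‖ξ‖ ≤ b := by
      rw [hb_def, couplingSize]; linarith [norm_nonneg ξ]
    calc _ ≤ _ := hcouple g ξ w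
      _ ≤ C₂ * (b * ‖T w‖ + b * (‖T w‖ / k)) := by gcongr
      _ = _ := by rw [hK_def]; ring
  have hlowT : ∀ v : perSobolev d (α / 2), cn * N * ‖(v : L2Cell d)‖ ^ 2 ≤
      ‖T v‖ ^ 2 + t * ‖(v : L2Cell d)‖ ^ 2 := fun v => by
    have h3 := hlow g ξ hξ v
    have h4 : cn * N ≤ κ' * symbolV α ξ + t := by
      have e1 : cn * ‖ξ‖ ^ α ≤ κ' * c₀ d α * ‖ξ‖ ^ α := by gcongr; exact min_le_left _ _
      have e2 : cn * t ≤ 1 * t := by gcongr; exact min_le_right _ _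
      have e3 : cn * N = cn * ‖ξ‖ ^ α + cn * t := mul_add _ _ _
      rw [e3, symbolV]
      linarith
    calc _ ≤ (κ' * symbolV α ξ + t) * ‖(v : L2Cell d)‖ ^ 2 := by gcongr
      _ = κ' * symbolV α ξ * ‖(v : L2Cell d)‖ ^ 2 + t * ‖(v : L2Cell d)‖ ^ 2 := by ring
      _ ≤ _ := by linarith
  have hV := symbolV_nonneg (d := d) h0 h2 ξ
  have hgm : m ≤ g.mean := g.le_mean
  have hlam : 0 ≤ g.mean * symbolV α ξ := mul_nonneg (hm.le.trans hgm) hV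
  have hlamN : cl * N ≤ g.mean * symbolV α ξ + t := by
    have e1 : cl * ‖ξ‖ ^ α ≤ m * c₀ d α * ‖ξ‖ ^ α := by gcongr; exact min_le_left _ _
    have e2 : cl * t ≤ 1 * t := by gcongr; exact min_le_right _ _
    have e3 : m * symbolV α ξ ≤ g.mean * symbolV α ξ := by gcongr
    have e4 : cl * N = cl * ‖ξ‖ ^ α + cl * t := mul_add _ _ _
    have e5 : m * symbolV α ξ = m * c₀ d α * ‖ξ‖ ^ α := by rw [symbolV, mul_assoc]
    linarith
  have main := norm_weakSolution_sub_le T (e := e) (norm_constOne d) (n := cn * N) (B := K * b) ht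
    hk (by positivity) (by positivity) hlam hcoupleT hgapT hlowT (hmean g ξ) hu
  rw [constProj_apply]
  refine main.trans ?_
  gcongr
  rw [← errorRoot_sq hε]
  exact schur_bound_le hC₃ hK hb hk hcn hcl hN hlamN hbN hE

end Resolvent

end LevyPeriodic

end

theorem theorem4p2 (d : ℕ) [NeZero d] (α m M : ℝ) (hα0 : 0 < α) (hα2 : α < 2) (hm : 0 < m) :
    ∃ C : ℝ, ∀ (μ : LevyPeriodic.Coefficient d m M) (ε : ℝ) (ξ : LevyPeriodic.Space d),
      0 < ε → ‖ξ‖ ≤ LevyPeriodic.δ₀ α m M →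
        ∃ R : LevyPeriodic.L2Cell d →L[ℂ] LevyPeriodic.L2Cell d,
          LevyPeriodic.IsShiftedInverse (LevyPeriodic.fiberOperator hα0 hα2 μ ξ) (ε ^ α) R ∧
          ‖R - (((μ.mean * LevyPeriodic.symbolV α ξ + ε ^ α)⁻¹ : ℝ) : ℂ) •
              LevyPeriodic.constProj d‖ ≤ C * LevyPeriodic.errorBound α ε := by
  obtain ⟨C, hC, hest⟩ :=
    LevyPeriodic.exists_norm_weakSolution_sub_le (M := M) d hα0 hα2 hm
  refine ⟨max C 2, fun μ ε ξ hε hξ => ?_⟩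
  obtain ⟨g, hg⟩ := μ.exists_regular
  have ht : 0 < ε ^ α := Real.rpow_pos_of_pos hε _
  obtain ⟨R, hR, hRn, hweak⟩ := LevyPeriodic.exists_isShiftedInverse
    (LevyPeriodic.dense_perSobolev hα2) (LevyPeriodic.fiberForm hα0 hα2 μ ξ)
    (LevyPeriodic.formRoot hα0 hα2 hm g ξ) (LevyPeriodic.fiberForm_eq_inner hα0 hα2 hm g μ hg ξ)
    (LevyPeriodic.isClosed_formRoot hα0 hα2 hm g ξ) ht
  refine ⟨R, hR, ?_⟩
  rw [μ.mean_eq g hg]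
  have hlam : 0 ≤ g.mean * LevyPeriodic.symbolV α ξ :=
    mul_nonneg (hm.le.trans g.le_mean) (LevyPeriodic.symbolV_nonneg hα0 hα2 ξ)
  rcases le_total ε 1 with hε1 | hε1
  · have hE : 0 ≤ LevyPeriodic.errorBound α ε := by
      rw [← LevyPeriodic.errorRoot_sq hε]; positivity
    refine ContinuousLinearMap.opNorm_le_bound _ (by positivity) fun f => ?_
    obtain ⟨u, hu, hweak⟩ := hweak f
    have h := hest g ε ξ hε hε1 (hξ.trans (LevyPeriodic.δ₀_le_pi hα0 hm μ.le)) u f hweak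
    rw [hu] at h
    calc _ ≤ C * LevyPeriodic.errorBound α ε * ‖f‖ := h
      _ ≤ _ := by gcongr; exact le_max_left _ _
  · -- for `ε ≥ 1` both resolvents are smaller than `ε^{-α}`
    have h1 := LevyPeriodic.rpow_neg_le_errorBound hα2 hα0 hε1
    have h2 : ‖(((g.mean * LevyPeriodic.symbolV α ξ + ε ^ α)⁻¹ : ℝ) : ℂ) •
        LevyPeriodic.constProj d‖ ≤ (ε ^ α)⁻¹ := by
      rw [norm_smul, Complex.norm_real, Real.norm_of_nonneg (by positivity)]
      refine (mul_le_of_le_one_right (by positivity)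
        (Submodule.starProjection_norm_le _)).trans ?_
      gcongr
      linarith
    have h0 : 0 < (ε ^ α)⁻¹ := by positivity
    calc _ ≤ _ := norm_sub_le _ _
      _ ≤ 2 * LevyPeriodic.errorBound α ε := by linarith
      _ ≤ _ := by
        gcongr
        · linarith
        · exact le_max_right _ _
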